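/- **Theorem (duality).** Let $p$ be a prime, $k$ a field of characteristic $p$, and $E=\langle g_1,\dots,g_r\rangle$ an elementary abelian $p$-group of rank $r$; put $X_i=g_i-1\in kE$. For a finitely generated $kE$-module $M$ let $\widetilde M(j)=M\otimes_k\mathcal O(j)$ on $\mathbb P^{r-1}=\operatorname{Proj}k[Y_1,\dots,Y_r]$, let $\theta\colon\widetilde M(j)\to\widetilde M(j+1)$ be the map $\theta(m\otimes f)=\sum_{i=1}^r X_im\otimes Y_if$, and for $1\le i\le p$ define $$\mathcal F_i(M)=\frac{\operatorname{Ker}\theta\cap\operatorname{Im}\theta^{i-1}}{\operatorname{Ker}\theta\cap\operatorname{Im}\theta^{i}},$$ a subquotient of $\widetilde M$. For a sheaf of $\mathcal O$-modules $\mathcal E$ write $\mathcal E^\vee=\mathcal Hom_{\mathcal O}(\mathcal E,\mathcal O)$ and $\mathcal E(j)=\mathcal E\otimes_{\mathcal O}\mathcal O(j)$. Let $M$ be a finitely generated $kE$-module of constant Jordan type, that is, the Jordan type of $X_\alpha=\lambda_1X_1+\dots+\lambda_rX_r$ on $K\otimes_kM$ is the same for all field extensions $K/k$ and all $0\ne\alpha=(\lambda_1,\dots,\lambda_r)\in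 K^r$. 1. Let $M^*=\operatorname{Hom}_k(M,k)$ be the $k$-linear dual, as a module over the commutative ring $kE$ by $(af)(m)=f(am)$ for $a\in kE$. Then for all $1\le i\le p$ there is an isomorphism $$\mathcal F_i(M^*)\cong\mathcal F_i(M)^\vee(-i+1).$$ 2. For $1\le i\le p-1$ the same isomorphism exists if $M^*$ is instead given the contragredient action $(gf)(m)=f(g^{-1}m)$ for $g\in E$. -/

import Mathlib

open CategoryTheory CategoryTheory.Limits TopologicalSpace Opposite AlgebraicGeometry
open scoped TensorProduct

universe u v

noncomputable section

namespace JordanBundle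

attribute [local instance] MvPolynomial.gradedAlgebra

/-! ### Projective space and the sheaf associated to a graded module -/

/-- The coordinate ring `k[Y₁, …, Y_r]` of affine `r`-space. -/
abbrev Coord (k : Type u) [Field k] (r : ℕ) : Type u := MvPolynomial (Fin r) k

/-- The projective space `ℙ^{r-1} = Proj k[Y₁, …, Y_r]`. -/
abbrev PSpace (k : Type u) [Field k] (r : ℕ) : Scheme.{u} :=
  Proj (MvPolynomial.homogeneousSubmodule (Fin r) k)

/-- A `ℤ`-grading (only the homogeneous pieces matter here) on a module over `k[Y₁, …, Y_r]`,
compatible with the grading of the polynomial ring. -/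
structure Grading (k : Type u) [Field k] (r : ℕ) (N : Type u) [AddCommGroup N]
    [Module (Coord k r) N] where
  /-- the homogeneous elements of degree `d` -/
  piece : ℤ → AddSubgroup N
  smul_mem : ∀ {m : ℕ} {d : ℤ} {a : Coord k r} {n : N},
    a ∈ MvPolynomial.homogeneousSubmodule (Fin r) k m → n ∈ piece d → a • n ∈ piece (d + m)

section Tilde

variable {k : Type u} [Field k] {r : ℕ}
variable {N : Type u} [AddCommGroup N] [Module (Coord k r) N]
variable {N' : Type u} [AddCommGroup N'] [Module (Coord k r) N']
variable {N'' : Type u} [AddCommGroup N''] [Module (Coord k r) N'']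

/-- The complement in `k[Y₁, …, Y_r]` of the homogeneous prime ideal `x`. -/
abbrev primeCompl (x : ProjectiveSpectrum (MvPolynomial.homogeneousSubmodule (Fin r) k)) :
    Submonoid (Coord k r) :=
  x.asHomogeneousIdeal.toIdeal.primeCompl

/-- The localization of the module `N` at the homogeneous prime `x`. -/
abbrev LocAt (N : Type u) [AddCommGroup N] [Module (Coord k r) N] (x : PSpace k r) : Type u :=
  LocalizedModule (primeCompl x) N

/-- A function on `U` is a fraction of degree `j` if it is of the form `n / b` with `b` homogeneous
of some degree `m`, not vanishing on `U`, and `n` homogeneous of degree `j + m`. -/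
def IsFrac (G : Grading k r N) (j : ℤ) {U : (PSpace k r).Opens} (s : ∀ x : U, LocAt N x.1) :
    Prop :=
  ∃ (m : ℕ) (n : N) (b : Coord k r), n ∈ G.piece (j + m) ∧
    b ∈ MvPolynomial.homogeneousSubmodule (Fin r) k m ∧
    ∀ x : U, ∃ hb : b ∈ primeCompl x.1,
      s x = LocalizedModule.mk n ⟨b, hb⟩

/-- Being a fraction of degree `j` on an open set passes to smaller open sets. -/
def isFracPrelocal (G : Grading k r N) (j : ℤ) :
    TopCat.PrelocalPredicate (X := (PSpace k r).carrier) (fun x => LocAt N x) where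
  pred {_} s := IsFrac G j s
  res := by
    rintro V U i s ⟨m, n, b, hn, hb, h⟩
    exact ⟨m, n, b, hn, hb, fun x => h (i x)⟩

/-- Being locally a fraction of degree `j`. -/
def isLocFrac (G : Grading k r N) (j : ℤ) :
    TopCat.LocalPredicate (X := (PSpace k r).carrier) (fun x => LocAt N x) :=
  (isFracPrelocal G j).sheafify

/-- The value of a regular function at a point, as an element of the localization of
`k[Y₁, …, Y_r]` at the corresponding homogeneous prime. -/
def evalAt {U : (PSpace k r).Opens} (f : Γ(PSpace k r, U)) (x : U) :
    Localization (primeCompl x.1) :=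
  HomogeneousLocalization.val (f.1 x)

/-- The sections over `U` of the sheaf `Ñ(j)` associated to the shifted graded module `N(j)`: the
functions which are locally fractions of degree `j`. -/
def tildeSections (G : Grading k r N) (j : ℤ) (U : (PSpace k r).Opens) :
    AddSubgroup (∀ x : U, LocAt N x.1) where
  carrier := {s | (isLocFrac G j).pred s}
  zero_mem' := fun x => ⟨U, x.2, 𝟙 _, 0, 0, 1, zero_mem _, 
    MvPolynomial.isHomogeneous_one (Fin r) k, fun y =>
      ⟨Submonoid.one_mem _, by simp⟩⟩
  add_mem' := by
    intro s t hs ht x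
    obtain ⟨V, hV, iV, m, n, b, hn, hb, h⟩ := hs x
    obtain ⟨V', hV', iV', m', n', b', hn', hb', h'⟩ := ht x
    refine ⟨V ⊓ V', ⟨hV, hV'⟩, Opens.infLELeft _ _ ≫ iV, m + m', b' • n + b • n', b * b', ?_, ?_,
      fun y => ?_⟩
    · refine add_mem ?_ ?_
      · have := G.smul_mem hb' hn
        rwa [show j + (m : ℤ) + (m' : ℤ) = j + ((m + m' : ℕ) : ℤ) by push_cast; ring] at this
      · have := G.smul_mem hb hn'
        rwa [show j + (m' : ℤ) + (m : ℤ) = j + ((m + m' : ℕ) : ℤ) by push_cast; ring] at this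
    · exact MvPolynomial.IsHomogeneous.mul hb hb'
    · obtain ⟨h1, e1⟩ := h ⟨y.1, y.2.1⟩
      obtain ⟨h2, e2⟩ := h' ⟨y.1, y.2.2⟩
      refine ⟨Submonoid.mul_mem _ h1 h2, ?_⟩
      exact (congrArg₂ (· + ·) e1 e2).trans (LocalizedModule.mk_add_mk ..)
  neg_mem' := by
    intro s hs x
    obtain ⟨V, hV, iV, m, n, b, hn, hb, h⟩ := hs x
    refine ⟨V, hV, iV, m, -n, b, neg_mem hn, hb, fun y => ?_⟩
    obtain ⟨h1, e1⟩ := h y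
    exact ⟨h1, (congrArg Neg.neg e1).trans (LocalizedModule.mk_neg ..).symm⟩

theorem tildeSections_smul (G : Grading k r N) (j : ℤ) (U : (PSpace k r).Opens)
    (f : Γ(PSpace k r, U)) {s : ∀ x : U, LocAt N x.1} (hs : s ∈ tildeSections G j U) :
    (fun x => evalAt f x • s x) ∈ tildeSections G j U := by
  intro x
  obtain ⟨V, hV, iV, m, n, b, hn, hb, h⟩ := hs x
  obtain ⟨V', hV', iV', m', ⟨a, ha⟩, ⟨c, hc⟩, hc', h'⟩ := f.2 x
  refine ⟨V ⊓ V', ⟨hV, hV'⟩, Opens.infLELeft _ _ ≫ iV, m + m', a • n, c * b, ?_, ?_, fun y => ?_⟩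
  · have := G.smul_mem ha hn
    rwa [show j + (m : ℤ) + (m' : ℤ) = j + ((m + m' : ℕ) : ℤ) by push_cast; ring] at this
  · rw [mul_comm]
    exact MvPolynomial.IsHomogeneous.mul hb hc
  · obtain ⟨h1, e1⟩ := h ⟨y.1, y.2.1⟩
    have e2 := congrArg HomogeneousLocalization.val (h' ⟨y.1, y.2.2⟩)
    refine ⟨Submonoid.mul_mem _ (hc' ⟨y.1, y.2.2⟩) h1, ?_⟩
    refine (congrArg₂ (· • ·) e2 e1).trans ?_
    exact LocalizedModule.mk_smul_mk a n ⟨c, hc' ⟨y.1, y.2.2⟩⟩ ⟨b, h1⟩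

/-- A regular function acts on a section of `Ñ(j)` pointwise. -/
instance tildeModule (G : Grading k r N) (j : ℤ) (U : (PSpace k r).Opens) :
    Module Γ(PSpace k r, U) (tildeSections G j U) where
  smul f s := ⟨fun x => evalAt f x • s.1 x, tildeSections_smul G j U f s.2⟩
  one_smul s := Subtype.ext (funext fun x =>
    (congrArg (· • s.1 x) (HomogeneousLocalization.val_one)).trans (one_smul _ _))
  mul_smul f g s := Subtype.ext (funext fun x =>
    (congrArg (· • s.1 x) (HomogeneousLocalization.val_mul (f.1 x) (g.1 x))).trans
      (mul_smul _ _ _))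
  smul_zero _ := Subtype.ext (funext fun _ => smul_zero _)
  smul_add _ _ _ := Subtype.ext (funext fun _ => smul_add _ _ _)
  add_smul f g s := Subtype.ext (funext fun x =>
    (congrArg (· • s.1 x) (HomogeneousLocalization.val_add (f.1 x) (g.1 x))).trans
      (add_smul _ _ _))
  zero_smul s := Subtype.ext (funext fun x =>
    (congrArg (· • s.1 x) (HomogeneousLocalization.val_zero)).trans (zero_smul _ _))

/-- The presheaf of abelian groups `U ↦ Ñ(j)(U)`. -/
def tildeAb (G : Grading k r N) (j : ℤ) : (PSpace k r).Opensᵒᵖ ⥤ Ab.{u} where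
  obj U := AddCommGrpCat.of (tildeSections G j U.unop)
  map {U V} i := AddCommGrpCat.ofHom
    { toFun := fun s => ⟨fun x => s.1 ⟨x.1, i.unop.le x.2⟩, (isLocFrac G j).res i.unop _ s.2⟩
      map_zero' := rfl
      map_add' := fun _ _ => rfl }

instance (G : Grading k r N) (j : ℤ) (U : (PSpace k r).Opensᵒᵖ) :
    Module ((PSpace k r).ringCatSheaf.obj.obj U) ((tildeAb G j).obj U) :=
  tildeModule G j U.unop

/-- The sheaf of `𝒪`-modules `Ñ(j)` on `ℙ^{r-1}` associated to the graded module `N(j)`. -/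
def tilde (G : Grading k r N) (j : ℤ) : (PSpace k r).Modules where
  val := PresheafOfModules.ofPresheaf (tildeAb G j) fun _ _ _ _ _ => rfl
  isSheaf := (TopCat.Presheaf.isSheaf_iff_isSheaf_comp (forget AddCommGrpCat) _).2
    (TopCat.subsheafToTypes (isLocFrac G j)).2

/-- A linear map of graded modules which sends homogeneous elements of degree `d` to homogeneous
elements of degree `d + e`. -/
def IsOfDegree (G : Grading k r N) (G' : Grading k r N') (e : ℤ) (φ : N →ₗ[Coord k r] N') : Prop :=
  ∀ (d : ℤ) (n : N), n ∈ G.piece d → φ n ∈ G'.piece (d + e)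

/-- The map induced by `φ` on the localizations at the point `x`. -/
def locMap (φ : N →ₗ[Coord k r] N') (x : PSpace k r) :
    LocAt N x →ₗ[Localization (primeCompl x)] LocAt N' x :=
  LocalizedModule.map (primeCompl x) φ

theorem locMap_mk (φ : N →ₗ[Coord k r] N') (x : PSpace k r) (n : N) (b : primeCompl x) :
    locMap φ x (LocalizedModule.mk n b) = LocalizedModule.mk (φ n) b :=
  IsLocalizedModule.map_LocalizedModules ..

theorem tildeSections_map {G : Grading k r N} {G' : Grading k r N'} {e : ℤ}
    {φ : N →ₗ[Coord k r] N'} (hφ : IsOfDegree G G' e φ) {j j' : ℤ} (h : j + e = j')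
    (U : (PSpace k r).Opens) {s : ∀ x : U, LocAt N x.1} (hs : s ∈ tildeSections G j U) :
    (fun x : U => locMap φ x.1 (s x)) ∈ tildeSections G' j' U := by
  intro x
  obtain ⟨V, hV, iV, m, n, b, hn, hb, hs⟩ := hs x
  refine ⟨V, hV, iV, m, φ n, b, ?_, hb, fun y => ?_⟩
  · have := hφ _ _ hn
    rwa [show j + (m : ℤ) + e = j' + m by omega] at this
  · obtain ⟨h1, e1⟩ := hs y
    exact ⟨h1, (congrArg (locMap φ y.1) e1).trans (locMap_mk ..)⟩

/-- The morphism `Ñ(j) ⟶ Ñ'(j + e)` induced by a map of graded modules of degree `e`. -/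
def tildeMap {G : Grading k r N} {G' : Grading k r N'} {e : ℤ}
    (φ : N →ₗ[Coord k r] N') (hφ : IsOfDegree G G' e φ) {j j' : ℤ} (h : j + e = j') :
    tilde G j ⟶ tilde G' j' where
  val := PresheafOfModules.homMk
    { app := fun U => AddCommGrpCat.ofHom
        { toFun := fun s => ⟨fun x => locMap φ x.1 (s.1 x), tildeSections_map hφ h U.unop s.2⟩
          map_zero' := Subtype.ext (funext fun _ => map_zero _)
          map_add' := fun _ _ => Subtype.ext (funext fun _ => map_add _ _ _) }
      naturality := fun _ _ _ => rfl }
    fun U f s => Subtype.ext (funext fun x => map_smul _ (evalAt (U := U.unop) f x) (s.1 x))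

theorem tildeMap_comp {G : Grading k r N} {G' : Grading k r N'} {G'' : Grading k r N''}
    {e e' e'' : ℤ} {φ : N →ₗ[Coord k r] N'} {ψ : N' →ₗ[Coord k r] N''}
    {χ : N →ₗ[Coord k r] N''} (hφ : IsOfDegree G G' e φ) (hψ : IsOfDegree G' G'' e' ψ)
    (hχ : IsOfDegree G G'' e'' χ) (hc : ψ ∘ₗ φ = χ) {j j' j'' : ℤ} (h : j + e = j')
    (h' : j' + e' = j'') (h'' : j + e'' = j'') :
    tildeMap φ hφ h ≫ tildeMap ψ hψ h' = tildeMap χ hχ h'' := by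
  subst hc
  ext U s
  refine Subtype.ext (funext fun x => ?_)
  change locMap ψ x.1 (locMap φ x.1 (s.1 x)) = locMap (ψ ∘ₗ φ) x.1 (s.1 x)
  induction s.1 x using LocalizedModule.induction_on with
  | _ n b => rw [locMap_mk, locMap_mk, locMap_mk]; rfl

end Tilde

/-! ### Serre twists and duals -/

section Twist

variable (k : Type u) [Field k] (r : ℕ)

/-- The grading of `k[Y₁, …, Y_r]` by the degree. -/
def coordGrading : Grading k r (Coord k r) where
  piece d :=
    { carrier := {f | f = 0 ∨ ∃ n : ℕ, (n : ℤ) = d ∧ f.IsHomogeneous n}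
      zero_mem' := Or.inl rfl
      add_mem' := by
        rintro f g (rfl | ⟨n, rfl, hf⟩) (rfl | ⟨n', h, hg⟩)
        · simp
        · exact Or.inr ⟨n', h, by simpa using hg⟩
        · exact Or.inr ⟨n, rfl, by simpa using hf⟩
        · obtain rfl : n' = n := by exact_mod_cast h
          exact Or.inr ⟨n', rfl, hf.add hg⟩
      neg_mem' := by
        rintro f (rfl | ⟨n, rfl, hf⟩)
        · simp
        · exact Or.inr ⟨n, rfl, hf.neg⟩ }
  smul_mem := by
    rintro m d a f ha (rfl | ⟨n, rfl, hf⟩)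
    · exact Or.inl (smul_zero _)
    · exact Or.inr ⟨n + m, by push_cast; ring, by
        rw [smul_eq_mul, mul_comm]; exact hf.mul ha⟩

/-- The invertible sheaf `𝒪(j)` on `ℙ^{r-1}`. -/
def serreSheaf (j : ℤ) : (PSpace k r).Modules := tilde (coordGrading k r) j

end Twist

/-- The tensor product `F ⊗ G` of two sheaves of modules on a scheme: the sheaf associated to
the presheaf `U ↦ F(U) ⊗ G(U)`. -/
def tensorSheaf {X : Scheme.{u}} (F G : X.Modules) : X.Modules :=
  (PresheafOfModules.sheafification (𝟙 X.ringCatSheaf.obj)).obj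
    (PresheafOfModules.Monoidal.tensorObj (R := X.presheaf) F.val G.val)

/-- The Serre twist `F(j) = F ⊗ 𝒪(j)`. -/
def serreTwist {k : Type u} [Field k] {r : ℕ} (F : (PSpace k r).Modules) (j : ℤ) :
    (PSpace k r).Modules :=
  tensorSheaf F (serreSheaf k r j)

/-! The dual sheaf `F^∨ = ℋom(F, 𝒪)`. -/

section Dual

variable {X : Scheme.{u}} (F : X.Modules)

/-- The sections over `U` of `ℋom(F, 𝒪)`: the morphisms of sheaves of modules `F|_U ⟶ 𝒪_U`, i.e.
the families of linear maps `F(V) → 𝒪(V)` for `V ⊆ U` which are compatible with restriction. -/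
def dualSections (U : X.Opens) :
    AddSubgroup (∀ V : {V : X.Opens // V ≤ U}, (Γ(F, V.1) →ₗ[Γ(X, V.1)] Γ(X, V.1))) where
  carrier := {φ | ∀ (V W : {V : X.Opens // V ≤ U}) (h : W.1 ≤ V.1) (s : Γ(F, V.1)),
    φ W (F.presheaf.map (homOfLE h).op s) = X.presheaf.map (homOfLE h).op (φ V s)}
  zero_mem' := fun _ _ h _ => (map_zero (X.presheaf.map (homOfLE h).op).hom).symm
  add_mem' := fun hφ hψ V W h s =>
    (congrArg₂ (· + ·) (hφ V W h s) (hψ V W h s)).trans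
      (map_add (X.presheaf.map (homOfLE h).op).hom _ _).symm
  neg_mem' := fun hφ V W h s =>
    (congrArg Neg.neg (hφ V W h s)).trans (map_neg (X.presheaf.map (homOfLE h).op).hom _).symm

instance dualModule (U : X.Opens) : Module Γ(X, U) (dualSections F U) where
  smul f φ := ⟨fun V => X.presheaf.map (homOfLE V.2).op f • φ.1 V, fun V W h s => by
    have e : X.presheaf.map (homOfLE W.2).op f =
        X.presheaf.map (homOfLE h).op (X.presheaf.map (homOfLE V.2).op f) := by
      rw [← CommRingCat.comp_apply, ← X.presheaf.map_comp]; rfl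
    refine (congrArg₂ (· * ·) e (φ.2 V W h s)).trans ?_
    exact (map_mul (X.presheaf.map (homOfLE h).op).hom _ _).symm⟩
  one_smul φ := Subtype.ext (funext fun V => by
    change X.presheaf.map (homOfLE V.2).op 1 • φ.1 V = φ.1 V
    rw [map_one, one_smul])
  mul_smul f g φ := Subtype.ext (funext fun V => by
    change X.presheaf.map (homOfLE V.2).op (f * g) • φ.1 V =
      X.presheaf.map (homOfLE V.2).op f • X.presheaf.map (homOfLE V.2).op g • φ.1 V
    rw [map_mul, mul_smul])
  smul_zero _ := Subtype.ext (funext fun _ => smul_zero _)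
  smul_add _ _ _ := Subtype.ext (funext fun _ => smul_add _ _ _)
  add_smul f g φ := Subtype.ext (funext fun V => by
    change X.presheaf.map (homOfLE V.2).op (f + g) • φ.1 V =
      X.presheaf.map (homOfLE V.2).op f • φ.1 V + X.presheaf.map (homOfLE V.2).op g • φ.1 V
    rw [map_add, add_smul])
  zero_smul φ := Subtype.ext (funext fun V => by
    change X.presheaf.map (homOfLE V.2).op 0 • φ.1 V = 0
    rw [map_zero, zero_smul])

/-- The presheaf of abelian groups underlying `ℋom(F, 𝒪)`. -/
def dualAb : X.Opensᵒᵖ ⥤ Ab.{u} where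
  obj U := AddCommGrpCat.of (dualSections F U.unop)
  map {U V} i := AddCommGrpCat.ofHom
    { toFun := fun φ => ⟨fun W => φ.1 ⟨W.1, W.2.trans i.unop.le⟩,
        fun W W' h s => φ.2 ⟨W.1, W.2.trans i.unop.le⟩ ⟨W'.1, W'.2.trans i.unop.le⟩ h s⟩
      map_zero' := rfl
      map_add' := fun _ _ => rfl }

instance (U : X.Opensᵒᵖ) : Module (X.ringCatSheaf.obj.obj U) ((dualAb F).obj U) :=
  dualModule F U.unop

theorem res_res {U V W : X.Opens} (h : V ≤ U) (h' : W ≤ V) (s : Γ(X, U)) :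
    X.presheaf.map (homOfLE h').op (X.presheaf.map (homOfLE h).op s) =
      X.presheaf.map (homOfLE (h'.trans h)).op s := by
  rw [← CommRingCat.comp_apply, ← X.presheaf.map_comp]; rfl

theorem res_res' {U V W : X.Opens} (h : V ≤ U) (h' : W ≤ V) (s : Γ(F, U)) :
    F.presheaf.map (homOfLE h').op (F.presheaf.map (homOfLE h).op s) =
      F.presheaf.map (homOfLE (h'.trans h)).op s := by
  rw [← ConcreteCategory.comp_apply, ← F.presheaf.map_comp]; rfl

theorem dualAb_isSheaf : TopCat.Presheaf.IsSheaf (X := X.carrier) (dualAb F) := by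
  rw [TopCat.Presheaf.isSheaf_iff_isSheafUniqueGluing]
  intro ι U φ hφ
  -- values of the local sections on a common open set agree
  have hagree : ∀ (i j : ι) (W : X.Opens) (hi : W ≤ U i) (hj : W ≤ U j) (s : Γ(F, W)),
      (φ i).1 ⟨W, hi⟩ s = (φ j).1 ⟨W, hj⟩ s := by
    intro i j W hi hj s
    have := congrArg (fun ψ : dualSections F (U i ⊓ U j) => ψ.1 ⟨W, le_inf hi hj⟩ s) (hφ i j)
    exact this
  have hcov : ∀ V : X.Opens, V ≤ iSup U → V ≤ ⨆ i, V ⊓ U i := fun V hV => by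
    rw [← inf_iSup_eq]; exact le_inf le_rfl hV
  -- gluing the values
  have hglue : ∀ (V : {V : X.Opens // V ≤ iSup U}) (s : Γ(F, V.1)), ∃! t : Γ(X, V.1), ∀ i,
      X.presheaf.map (homOfLE (inf_le_left : V.1 ⊓ U i ≤ V.1)).op t =
        (φ i).1 ⟨V.1 ⊓ U i, inf_le_right⟩ (F.presheaf.map (homOfLE inf_le_left).op s) := by
    intro V s
    refine X.sheaf.existsUnique_gluing' (fun i => V.1 ⊓ U i) V.1 (fun i => homOfLE inf_le_left)
      (hcov V.1 V.2)
      (fun i => (φ i).1 ⟨V.1 ⊓ U i, inf_le_right⟩ (F.presheaf.map (homOfLE inf_le_left).op s)) ?_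
    intro i j
    have hi := (φ i).2 ⟨V.1 ⊓ U i, inf_le_right⟩
      ⟨(V.1 ⊓ U i) ⊓ (V.1 ⊓ U j), inf_le_left.trans inf_le_right⟩ inf_le_left
      (F.presheaf.map (homOfLE inf_le_left).op s)
    have hj := (φ j).2 ⟨V.1 ⊓ U j, inf_le_right⟩
      ⟨(V.1 ⊓ U i) ⊓ (V.1 ⊓ U j), inf_le_right.trans inf_le_right⟩ inf_le_right
      (F.presheaf.map (homOfLE inf_le_left).op s)
    rw [res_res'] at hi hj
    exact hi.symm.trans ((hagree i j _ _ _ _).trans hj)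
  choose t ht htu using hglue
  have hext : ∀ (V : {V : X.Opens // V ≤ iSup U}) (a b : Γ(X, V.1)),
      (∀ i, X.presheaf.map (homOfLE (inf_le_left : V.1 ⊓ U i ≤ V.1)).op a =
        X.presheaf.map (homOfLE (inf_le_left : V.1 ⊓ U i ≤ V.1)).op b) → a = b := fun V a b h =>
    X.sheaf.eq_of_locally_eq' (fun i => V.1 ⊓ U i) V.1 (fun i => homOfLE inf_le_left)
      (hcov V.1 V.2) a b h
  refine ⟨⟨fun V => { toFun := t V, map_add' := ?_, map_smul' := ?_ }, ?_⟩, ?_, ?_⟩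
  · intro a b
    refine hext V _ _ fun i => ?_
    rw [ht, map_add, map_add, map_add, ht, ht]
  · intro f a
    refine hext V _ _ fun i => ?_
    rw [ht, Scheme.Modules.map_smul, map_smul, RingHom.id_apply, smul_eq_mul, smul_eq_mul, map_mul,
      ht]
  · intro V W h s
    refine hext W _ _ fun i => ?_
    have h1 := ht W (F.presheaf.map (homOfLE h).op s) i
    have h2 := congrArg (X.presheaf.map (homOfLE (inf_le_inf_right (U i) h)).op) (ht V s i)
    have h3 := (φ i).2 ⟨V.1 ⊓ U i, inf_le_right⟩ ⟨W.1 ⊓ U i, inf_le_right⟩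
      (inf_le_inf_right (U i) h) (F.presheaf.map (homOfLE inf_le_left).op s)
    rw [res_res'] at h1 h3
    rw [res_res] at h2
    refine h1.trans (h3.trans ?_)
    rw [← h2]
    exact (res_res h _ _).symm
  · intro i
    refine Subtype.ext (funext fun V => LinearMap.ext fun s => ?_)
    refine hext ⟨V.1, V.2.trans (le_iSup U i)⟩ _ _ fun j => ?_
    refine (ht ⟨V.1, V.2.trans (le_iSup U i)⟩ s j).trans ?_
    refine (hagree j i _ _ (inf_le_left.trans V.2) _).trans ?_
    exact (φ i).2 V ⟨V.1 ⊓ U j, inf_le_left.trans V.2⟩ inf_le_left s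
  · intro ψ hψ
    refine Subtype.ext (funext fun V => LinearMap.ext fun s => htu V s _ fun i => ?_)
    refine (ψ.2 V ⟨V.1 ⊓ U i, inf_le_left.trans V.2⟩ inf_le_left s).symm.trans ?_
    have := hψ i
    exact congrArg (fun χ : dualSections F (U i) => χ.1 ⟨V.1 ⊓ U i, inf_le_right⟩
      (F.presheaf.map (homOfLE inf_le_left).op s)) this

/-- The dual sheaf `F^∨ = ℋom(F, 𝒪)`. -/
def dualSheaf : X.Modules where
  val := PresheafOfModules.ofPresheaf (dualAb F) fun _ _ i f φ =>
    Subtype.ext (funext fun W => congrArg (· • φ.1 ⟨W.1, W.2.trans i.unop.le⟩)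
      (res_res i.unop.le W.2 f).symm)
  isSheaf := dualAb_isSheaf F

end Dual

/-! ### The operator `θ` and the subquotients `ℱ_i` -/

section Theta

variable {k : Type u} [Field k] {r : ℕ} (M : Type u) [AddCommGroup M] [Module k M]

/-- The grading of `k[Y₁, …, Y_r] ⊗ M` by the degree in the variables `Y₁, …, Y_r`. -/
def tensorGrading : Grading k r (Coord k r ⊗[k] M) where
  piece d := AddSubgroup.closure
    {z | ∃ (n : ℕ) (f : Coord k r) (m : M), (n : ℤ) = d ∧ f.IsHomogeneous n ∧ z = f ⊗ₜ[k] m}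
  smul_mem := by
    intro m d a z ha hz
    induction hz using AddSubgroup.closure_induction with
    | mem z hz =>
      obtain ⟨n, f, x, rfl, hf, rfl⟩ := hz
      refine AddSubgroup.subset_closure ⟨n + m, f * a, x, by push_cast; ring, hf.mul ha, ?_⟩
      rw [TensorProduct.smul_tmul', smul_eq_mul, mul_comm]
    | zero => rw [smul_zero]; exact zero_mem _
    | add y z _ _ hy hz => rw [smul_add]; exact add_mem hy hz
    | neg y _ hy => rw [smul_neg]; exact neg_mem hy

/-- The vector bundle `M̃(j) = M ⊗ 𝒪(j)`: the sheaf associated to the free graded module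
`M ⊗ k[Y₁, …, Y_r]`, shifted by `j`. -/
def trivBundle (j : ℤ) : (PSpace k r).Modules := tilde (tensorGrading (k := k) (r := r) M) j

variable {M}

/-- The operator `m ⊗ f ↦ ∑ᵢ Xᵢ m ⊗ Yᵢ f` for a family `X` of endomorphisms of `M`. -/
def thetaLin (X : Fin r → Module.End k M) : Module.End (Coord k r) (Coord k r ⊗[k] M) :=
  ∑ i, (MvPolynomial.X i : Coord k r) • LinearMap.baseChange (Coord k r) (X i)

theorem thetaLin_isOfDegree (X : Fin r → Module.End k M) :
    IsOfDegree (tensorGrading M) (tensorGrading M) 1 (thetaLin X) := by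
  intro d z hz
  induction hz using AddSubgroup.closure_induction with
  | mem z hz =>
    obtain ⟨n, f, x, rfl, hf, rfl⟩ := hz
    simp only [thetaLin, LinearMap.sum_apply, LinearMap.smul_apply, LinearMap.baseChange_tmul]
    refine sum_mem fun i _ => AddSubgroup.subset_closure
      ⟨n + 1, f * MvPolynomial.X i, X i x, by push_cast; ring,
        hf.mul (MvPolynomial.isHomogeneous_X k i), ?_⟩
    rw [TensorProduct.smul_tmul', smul_eq_mul, mul_comm]
  | zero => rw [map_zero]; exact zero_mem _
  | add y z _ _ hy hz => rw [map_add]; exact add_mem hy hz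
  | neg y _ hy => rw [map_neg]; exact neg_mem hy

theorem thetaLin_pow_isOfDegree (X : Fin r → Module.End k M) (a : ℕ) :
    IsOfDegree (tensorGrading M) (tensorGrading M) a (thetaLin X ^ a) := by
  induction a with
  | zero => intro d z hz; simpa using hz
  | succ a ih =>
    intro d z hz
    have := thetaLin_isOfDegree X _ _ (ih d z hz)
    rw [pow_succ']
    rwa [show d + (a : ℤ) + 1 = d + ((a + 1 : ℕ) : ℤ) by push_cast; ring] at this

/-- The morphism `θ : M̃(j) ⟶ M̃(j + 1)`. -/
def theta (X : Fin r → Module.End k M) {j j' : ℤ} (h : j + 1 = j') :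
    trivBundle M j ⟶ trivBundle (k := k) (r := r) M j' :=
  tildeMap (thetaLin X) (thetaLin_isOfDegree X) h

/-- The iterate `θ^a : M̃(j) ⟶ M̃(j + a)`. -/
def thetaPow (X : Fin r → Module.End k M) (a : ℕ) {j j' : ℤ} (h : j + a = j') :
    trivBundle M j ⟶ trivBundle (k := k) (r := r) M j' :=
  tildeMap (thetaLin X ^ a) (thetaLin_pow_isOfDegree X a) h

theorem thetaPow_one (X : Fin r → Module.End k M) {j j' : ℤ} (h : j + 1 = j') :
    thetaPow X 1 (by simpa using h) = theta X h := by
  unfold thetaPow theta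
  congr 1

theorem thetaPow_succ (X : Fin r → Module.End k M) (a : ℕ) {j j' j'' : ℤ} (h : j + 1 = j')
    (h' : j' + a = j'') :
    thetaPow X (a + 1) (by push_cast; omega) = theta X h ≫ thetaPow X a h' :=
  (tildeMap_comp _ _ (thetaLin_pow_isOfDegree X (a + 1)) (pow_succ _ _).symm h h' _).symm

/-- The subsheaf `Ker θ ∩ Im θ^a` of `M̃`. -/
def kerInfIm (X : Fin r → Module.End k M) (a : ℕ) :
    Subobject (trivBundle (k := k) (r := r) M 0) :=
  kernelSubobject (theta X (zero_add 1)) ⊓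
    imageSubobject (thetaPow X a (neg_add_cancel (a : ℤ)))

theorem kerInfIm_succ_le (X : Fin r → Module.End k M) (a : ℕ) :
    kerInfIm X (a + 1) ≤ kerInfIm X a := by
  have key : ∀ {A B C : (PSpace k r).Modules} (f : A ⟶ B) (f' : B ⟶ C) (f'' : A ⟶ C),
      f'' = f ≫ f' → imageSubobject f'' ≤ imageSubobject f' := by
    rintro A B C f f' _ rfl
    exact imageSubobject_comp_le _ _
  exact inf_le_inf_left _ (key _ _ _
    (thetaPow_succ X a (j' := -(a : ℤ)) (by push_cast; ring) (neg_add_cancel _)))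

/-- The sheaf `ℱ_i = (Ker θ ∩ Im θ^{i-1}) / (Ker θ ∩ Im θ^i)`, for `i = a + 1`. -/
def subquotient (X : Fin r → Module.End k M) (a : ℕ) : (PSpace k r).Modules :=
  cokernel (Subobject.ofLE _ _ (kerInfIm_succ_le X a))

end Theta

/-! ### Modules of constant Jordan type -/

section JordanType

/-- A nilpotent endomorphism has Jordan type `[p]^{a_p} … [1]^{a_1}` if in some basis it is a direct
sum of nilpotent Jordan blocks, `a_l` of them of length `l`, for `1 ≤ l ≤ p`. The index `l : Fin p`
below stands for the length `l + 1`. -/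
def HasJordanType {K : Type u} [Field K] {V : Type u} [AddCommGroup V] [Module K V] {p : ℕ}
    (T : Module.End K V) (a : Fin p → ℕ) : Prop :=
  ∃ b : Module.Basis (Σ l : Fin p, Fin (a l) × Fin (l.1 + 1)) K V,
    ∀ (l : Fin p) (s : Fin (a l)) (t : Fin (l.1 + 1)),
      T (b ⟨l, s, t⟩) = if h : t.1 + 1 < l.1 + 1 then b ⟨l, s, ⟨t.1 + 1, h⟩⟩ else 0

variable {k : Type u} [Field k] {E : Type v} {M : Type u} [AddCommGroup M] [Module k M]

/-- The action of `X_i = g_i - 1` on a `kE`-module. -/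
def groupX [Group E] {r : ℕ} (g : Fin r → E) (ρ : Representation k E M) (i : Fin r) :
    Module.End k M :=
  ρ (g i) - 1

/-- A `kE`-module `M` has constant Jordan type if the Jordan type of
`X_α = λ₁ X₁ + ⋯ + λ_r X_r` on `K ⊗ M` is the same for all field extensions `K` of `k` and all
`0 ≠ α = (λ₁, …, λ_r) ∈ K^r`. -/
def ConstantJordanType [Group E] (p : ℕ) {r : ℕ} (g : Fin r → E) (ρ : Representation k E M) :
    Prop :=
  ∃ a : Fin p → ℕ, ∀ (K : Type u) [Field K] [Algebra k K] (α : Fin r → K), α ≠ 0 →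
    HasJordanType (∑ i, α i • LinearMap.baseChange K (groupX g ρ i)) a

/-- The sheaf `ℱ_i(M)` on `ℙ^{r-1}` for `i ≥ 1`. -/
def jordanSheaf [Group E] {r : ℕ} (g : Fin r → E) (ρ : Representation k E M) (i : ℕ) :
    (PSpace k r).Modules :=
  subquotient (groupX g ρ) (i - 1)

/-- The `k`-linear dual of `M`, as a module over the commutative ring `kE`: `(x f)(m) = f(x m)`
for `x ∈ kE`. -/
def transposeDual [CommGroup E] (ρ : Representation k E M) :
    Representation k E (Module.Dual k M) where
  toFun x := Module.Dual.transpose (R := k) (ρ x)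
  map_one' := by rw [map_one]; rfl
  map_mul' x y := by rw [mul_comm, map_mul]; rfl

end JordanType

end JordanBundle

end

/-! The proof passes from sheaves to graded modules over `k[Y₁, …, Y_r]`. Write `θ` also for the
operator `∑ Yᵢ Xᵢ` on `k[Y] ⊗ M`, and let `S_a` be the graded module `(Ker θ ∩ Im θ^a) / (Ker θ ∩ Im
θ^(a+1))`. Passing to sheaves respects kernels and graded surjections, so `ℱ_(a+1)(M)` is the sheaf
of `S_a` (`nonempty_subquotient_iso`).

For the transposed action, the operator `θ'` on `k[Y] ⊗ M^*` is adjoint to `θ` under evaluation.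
Hence `(θ'^a f, n) ↦ ⟨f, n⟩` is a well-defined pairing of `S'_a` with `S_a` (`kerPairing`).
Replacing `θ'^a f` by `f` lowers the degree by `a`; this is the source of the twist by `-a = -i +
1`.

Constant Jordan type makes this pairing locally perfect. At a point `x` the Jordan type of `θ` over
the fraction field of `k[Y]/x` equals the one over `k(Y)`, so no power of `θ` drops rank at `x` and
kernel vectors lift (`exists_kernel_lift`). A Jordan basis at `x` therefore lifts to a Jordan family
in `k[Y] ⊗ M` that becomes a basis once a polynomial `Δ` not vanishing at `x` is inverted
(`exists_jordanFrame`, `exists_frame_at`). After inverting `Δ`, the last vectors of the blocks of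
length `a + 1` are a basis of `S_a`, and the reversed dual frame gives the dual basis of `S'_a`
(`exists_dual_generators`). A graded pairing with such local dual bases identifies one sheaf with a
twist of the dual of the other: `φ ⊗ s` corresponds to the unique section `t` with `B(t, v) = φ(v)
s` (`nonempty_tilde_iso_serreTwist_dual`).

The contragredient action replaces each `g_j` by its inverse. The map `Y^s ⊗ m ↦ Y^s ⊗ h^s m`, with
`h_j` the inverse of the `j`-th group element, carries `θ` to minus the operator of the inverse
elements. It is only `k`-linear, but its failure to commute with `Y_j` is a multiple of an operator
`X_j`. Differentiating `θ^(a+1) z = 0` with respect to `Y_j` shows that `X_j` acts as zero on `S_a`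
when `a + 1` is invertible in `k` (`baseChange_mem_kerInfRange_succ`). So for `i < p` the map
induces an isomorphism of graded modules. -/

noncomputable section

namespace JordanBundle

attribute [local instance] MvPolynomial.gradedAlgebra

/-! ### Lifts, epimorphisms and sheafification, tested on sections. -/

section SheafOfModules

variable {X : Scheme.{u}}

/-- A morphism of sheaves of modules from its values on sections. -/
def homOfSections {Z A : X.Modules} (l : ∀ U : X.Opens, Γ(Z, U) →+ Γ(A, U))
    (hres : ∀ (U V : X.Opens) (h : V ≤ U) (z : Γ(Z, U)),
      l V (Z.presheaf.map (homOfLE h).op z) = A.presheaf.map (homOfLE h).op (l U z))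
    (hsmul : ∀ (U : X.Opens) (s : Γ(X, U)) (z : Γ(Z, U)), l U (s • z) = s • l U z) : Z ⟶ A where
  val := PresheafOfModules.homMk
    { app := fun U => AddCommGrpCat.ofHom (l U.unop)
      naturality := fun U V i => by
        ext z
        exact hres U.unop V.unop i.unop.le z }
    fun U s z => hsmul U.unop s z

/-- Injectivity makes the chosen preimages unique, which forces additivity, linearity and
compatibility with restriction. -/
theorem exists_lift_of_injective {A F Z : X.Modules} (f : A ⟶ F) (k : Z ⟶ F)
    (hf : ∀ U, Function.Injective (f.app U)) (h : ∀ U (z : Γ(Z, U)), ∃ a, f.app U a = k.app U z) :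
    ∃ l : Z ⟶ A, l ≫ f = k := by
  choose l hl using h
  refine ⟨homOfSections (fun U => AddMonoidHom.mk' (l U) fun a b => hf _ ?_) ?_ ?_, ?_⟩
  · rw [map_add, hl, hl, hl, map_add]
  · intro U V h z
    apply hf
    have h1 := hl V (Z.presheaf.map (homOfLE h).op z)
    have h2 := ConcreteCategory.congr_hom (k.mapPresheaf.naturality (homOfLE h).op) z
    have h3 := ConcreteCategory.congr_hom (f.mapPresheaf.naturality (homOfLE h).op) (l U z)
    refine h1.trans (h2.trans (Eq.trans ?_ h3.symm))
    exact congrArg (F.presheaf.map (homOfLE h).op) (hl U z).symm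
  · intro U s z
    apply hf
    refine (hl _ _).trans ?_
    have h1 := Scheme.Modules.Hom.app_smul k s z
    have h2 := Scheme.Modules.Hom.app_smul f s (l U z)
    exact h1.trans ((congrArg (s • ·) (hl U z).symm).trans h2.symm)
  · ext U z
    exact hl U z

/-- A morphism that vanishes after composition with `f` kills every section locally, hence globally
because its target is separated. -/
theorem epi_of_locally_surjective {F G : X.Modules} (f : F ⟶ G)
    (h : ∀ (U : X.Opens) (z : Γ(G, U)) (x : X), x ∈ U → ∃ (V : X.Opens) (hV : V ≤ U), x ∈ V ∧
      ∃ y : Γ(F, V), f.app V y = G.presheaf.map (homOfLE hV).op z) : Epi f := by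
  refine Preadditive.epi_of_cancel_zero f fun {Z} k hk => ?_
  ext U z
  choose V hV hx y hy using h U z
  refine TopCat.Sheaf.eq_of_locally_eq' (F := ⟨Z.presheaf, Z.isSheaf⟩) (fun x : U => V x.1 x.2) U
    (fun x => homOfLE (hV x.1 x.2))
    (fun x hx' => Opens.mem_iSup.2 ⟨⟨x, hx'⟩, hx x hx'⟩) _ _ fun x => ?_
  have h1 := ConcreteCategory.congr_hom (k.mapPresheaf.naturality (homOfLE (hV x.1 x.2)).op) z
  refine h1.symm.trans ?_
  have h2 : k.app (V x.1 x.2) (f.app (V x.1 x.2) (y x.1 x.2)) = 0 :=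
    ConcreteCategory.congr_hom (congrArg (fun q => q.app (V x.1 x.2)) hk) (y x.1 x.2)
  refine ((congrArg (k.app (V x.1 x.2)) (hy x.1 x.2).symm).trans h2).trans ?_
  exact (map_zero (Z.presheaf.map (homOfLE (hV x.1 x.2)).op).hom).symm

/-- Sheafification inverts locally bijective maps. The adjoint of `ψ` is obtained from `ψ` by
cancelling the unit, which is itself locally bijective; isomorphisms are then detected on underlying
sheaves of abelian groups. -/
theorem nonempty_sheafification_iso (T : X.PresheafOfModules) (P : X.Modules) (ψ : T ⟶ P.val)
    (hinj : ∀ (U : X.Opens) (z : T.presheaf.obj (op U)), ψ.app (op U) z = 0 → ∀ x ∈ U,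
      ∃ (V : X.Opens) (hV : V ≤ U), x ∈ V ∧ T.presheaf.map (homOfLE hV).op z = 0)
    (hsurj : ∀ (U : X.Opens) (z : Γ(P, U)), ∀ x ∈ U,
      ∃ (V : X.Opens) (hV : V ≤ U), x ∈ V ∧ ∃ y : T.presheaf.obj (op V),
        ψ.app (op V) y = P.presheaf.map (homOfLE hV).op z) :
    Nonempty ((PresheafOfModules.sheafification (𝟙 X.ringCatSheaf.obj)).obj T ≅ P) := by
  let J := Opens.grothendieckTopology X
  let ψ' := (PresheafOfModules.toPresheaf _).map ψ
  have i1 : Presheaf.IsLocallyInjective J ψ' := by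
    constructor
    intro U x y h
    have h0 : ψ.app U (x - y) = 0 := by
      refine (map_sub (ψ.app U).hom x y).trans ?_
      exact sub_eq_zero.2 h
    intro z hz
    obtain ⟨V, hV, hzV, e⟩ := hinj U.unop (x - y) h0 z hz
    refine ⟨V, homOfLE hV, ?_, hzV⟩
    have e' := (map_sub (T.presheaf.map (homOfLE hV).op).hom x y).symm.trans e
    exact sub_eq_zero.1 e'
  have i2 : Presheaf.IsLocallySurjective J ψ' := by
    constructor
    intro U s z hz
    obtain ⟨V, hV, hzV, y, e⟩ := hsurj U s z hz
    exact ⟨V, homOfLE hV, ⟨y, e⟩, hzV⟩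
  have hW : J.W ψ' := J.W_of_isLocallyBijective ψ'
  let ψt := (PresheafOfModules.sheafificationHomEquiv (𝟙 X.ringCatSheaf.obj) (P := T) (F := P)).symm ψ
  have h1 : CategoryTheory.toSheafify J T.presheaf ≫ (PresheafOfModules.toPresheaf _).map ψt.val = ψ' := by
    refine (PresheafOfModules.toPresheaf_map_sheafificationHomEquiv_def (𝟙 X.ringCatSheaf.obj) ψt).symm.trans ?_
    exact congrArg _ ((PresheafOfModules.sheafificationHomEquiv (𝟙 X.ringCatSheaf.obj) (P := T) (F := P)).apply_symm_apply ψ)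
  have h2 : J.W ((PresheafOfModules.toPresheaf _).map ψt.val) := by
    rw [← h1] at hW
    exact J.W.of_precomp _ _ (J.W_toSheafify _) hW
  have : IsIso ((SheafOfModules.toSheaf X.ringCatSheaf).map ψt) :=
    (J.W_sheafToPresheaf_map_iff_isIso _).1 h2
  have : IsIso ψt := isIso_of_reflects_iso ψt (SheafOfModules.toSheaf X.ringCatSheaf)
  exact ⟨asIso ψt⟩

end SheafOfModules

/-! ### Intersections and quotients of subobjects in an abelian category. -/

section AbelianSubobject

variable {C : Type*} [Category* C] [Abelian C]

/-- The epi-mono factorization identifies the image of `τ` with `I`, and the intersection with `Ker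
θ` is the kernel of `m ≫ θ`, which is what `w` and `hκ` say of `κ`. -/
theorem kernelSubobject_inf_imageSubobject {N N' N₁ I A : C} (θ : N ⟶ N₁) (τ : N' ⟶ N)
    (e : N' ⟶ I) (m : I ⟶ N) (κ : A ⟶ I) [Epi e] [Mono m] [Mono κ] (hτ : e ≫ m = τ)
    (w : κ ≫ m ≫ θ = 0)
    (hκ : ∀ {Z : C} (q : Z ⟶ I), q ≫ m ≫ θ = 0 → ∃ l, l ≫ κ = q) :
    kernelSubobject θ ⊓ imageSubobject τ = Subobject.mk (κ ≫ m) := by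
  have him : imageSubobject τ = Subobject.mk m := by
    subst hτ
    rw [← imageSubobject_mono m]
    have : IsIso (Subobject.ofLE _ _ (imageSubobject_comp_le e m)) := isIso_of_mono_of_epi _
    exact le_antisymm (imageSubobject_comp_le _ _) (Subobject.le_of_comm
      (inv (Subobject.ofLE _ _ (imageSubobject_comp_le e m))) (by simp))
  rw [him]
  refine le_antisymm ?_ (le_inf ?_ ?_)
  · set K := kernelSubobject θ ⊓ Subobject.mk m
    have h1 : (Subobject.ofLEMk K m inf_le_right) ≫ m = K.arrow := Subobject.ofLEMk_comp _
    have h2 : K.arrow ≫ θ = 0 := by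
      rw [← Subobject.ofLE_arrow (inf_le_left : K ≤ kernelSubobject θ), Category.assoc,
        kernelSubobject_arrow_comp, comp_zero]
    obtain ⟨l, hl⟩ := hκ (Subobject.ofLEMk K m inf_le_right) (by rw [← Category.assoc, h1, h2])
    exact Subobject.le_mk_of_comm l (by rw [← Category.assoc, hl, h1])
  · refine le_kernelSubobject _ _ ?_
    rw [← Subobject.underlyingIso_hom_comp_eq_mk, Category.assoc, Category.assoc, w, comp_zero]
  · exact Subobject.mk_le_mk_of_comm κ rfl

/-- The hypotheses make `l` a kernel of `π`, and an epimorphism in an abelian category is the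
cokernel of its kernel. -/
theorem nonempty_cokernel_ofLE_iso {N A B Q : C} {S T : Subobject N} (h : S ≤ T)
    (i : A ⟶ N) (j : B ⟶ N) [Mono i] [Mono j] (hS : S = Subobject.mk i) (hT : T = Subobject.mk j)
    (l : A ⟶ B) (hl : l ≫ j = i) (π : B ⟶ Q) [Epi π] (w : l ≫ π = 0)
    (hπ : ∀ {Z : C} (q : Z ⟶ B), q ≫ π = 0 → ∃ l', l' ≫ l = q) :
    Nonempty (cokernel (Subobject.ofLE S T h) ≅ Q) := by
  subst hS hT
  have : Mono l := by subst hl; exact mono_of_mono l j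
  have hk : IsLimit (KernelFork.ofι l w) := KernelFork.IsLimit.ofι' l w fun q hq =>
    ⟨(hπ q hq).choose, (hπ q hq).choose_spec⟩
  have hc := Abelian.epiIsCokernelOfKernel _ hk
  refine ⟨cokernel.mapIso _ _ (Subobject.underlyingIso i) (Subobject.underlyingIso j) ?_ ≪≫
    IsColimit.coconePointUniqueUpToIso (colimit.isColimit (parallelPair l 0)) hc⟩
  rw [← cancel_mono j, Category.assoc, Category.assoc, Subobject.underlyingIso_hom_comp_eq_mk, hl,
    Subobject.underlyingIso_hom_comp_eq_mk, Subobject.ofLE_arrow]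

end AbelianSubobject

/-! ### Exactness properties of the sheaf associated to a graded module. -/

section TildeExact

variable {k : Type u} [Field k] {r : ℕ}
variable {N : Type u} [AddCommGroup N] [Module (Coord k r) N]
variable {N' : Type u} [AddCommGroup N'] [Module (Coord k r) N']
variable {A : Type u} [AddCommGroup A] [Module (Coord k r) A]
variable {G : Grading k r N} {G' : Grading k r N'} {GA : Grading k r A}

theorem mem_tildeSections_iff {j : ℤ} {U : (PSpace k r).Opens} {s : ∀ x : U, LocAt N x.1} :
    s ∈ tildeSections G j U ↔ ∀ x (_ : x ∈ U), ∃ (V : (PSpace k r).Opens) (hV : V ≤ U),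
      x ∈ V ∧ ∃ (m : ℕ) (n : N) (b : Coord k r), n ∈ G.piece (j + m) ∧
      b ∈ MvPolynomial.homogeneousSubmodule (Fin r) k m ∧
      ∀ y (hy : y ∈ V), ∃ hb : b ∈ primeCompl y,
        s ⟨y, hV hy⟩ = LocalizedModule.mk n ⟨b, hb⟩ := by
  constructor
  · intro hs x hx
    obtain ⟨V, hV, iV, m, n, b, hn, hb, h⟩ := hs ⟨x, hx⟩
    exact ⟨V, iV.le, hV, m, n, b, hn, hb, fun y hy => h ⟨y, hy⟩⟩
  · intro hs x
    obtain ⟨V, hV, hx, m, n, b, hn, hb, h⟩ := hs x.1 x.2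
    exact ⟨V, hx, homOfLE hV, m, n, b, hn, hb, fun y => h y.1 y.2⟩

/-- The open set where a polynomial does not vanish. -/
def nonVanishing (c : Coord k r) : (PSpace k r).Opens :=
  ProjectiveSpectrum.basicOpen (MvPolynomial.homogeneousSubmodule (Fin r) k) c

theorem locMap_injective {φ : N →ₗ[Coord k r] N'} (hφ : Function.Injective φ) (x : PSpace k r) :
    Function.Injective (locMap φ x) :=
  IsLocalizedModule.map_injective _ _ _ _ hφ

theorem mk_eq_zero_iff {x : PSpace k r} (n : N) (b : primeCompl x) :
    LocalizedModule.mk n b = 0 ↔ ∃ c ∈ primeCompl x, c • n = 0 := by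
  rw [← LocalizedModule.zero_mk b, LocalizedModule.mk_eq]
  constructor
  · rintro ⟨c, hc⟩
    refine ⟨c.1 * b.1, Submonoid.mul_mem _ c.2 b.2, ?_⟩
    simpa [mul_smul, Submonoid.smul_def] using hc
  · rintro ⟨c, hc, h⟩
    refine ⟨⟨c, hc⟩, ?_⟩
    simp only [smul_zero, Submonoid.smul_def]
    rw [smul_comm, h, smul_zero]

theorem mk_eq_mk_smul {x : PSpace k r} (n : N) {b c : Coord k r} (hb : b ∈ primeCompl x)
    (hc : c ∈ primeCompl x) : (LocalizedModule.mk n ⟨b, hb⟩ : LocAt N x) =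
      LocalizedModule.mk (c • n) ⟨b * c, Submonoid.mul_mem _ hb hc⟩ := by
  rw [LocalizedModule.mk_eq]
  refine ⟨1, ?_⟩
  rw [one_smul, one_smul, Submonoid.smul_def, Submonoid.smul_def, mul_smul]

/-- If `n / b` dies under `φ` at `x`, then `hex` gives a homogeneous `c` with `c n = ι a`, so `n / b
= ι a / (b c)` on the neighbourhood where `c` does not vanish. `LocAt` inverts all polynomials
outside the prime, so the homogeneity of `c` is a genuine demand of `hex`. -/
theorem exists_local_lift {φ : N →ₗ[Coord k r] N'} {ι : A →ₗ[Coord k r] N}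
    (hex : ∀ (x : PSpace k r) (d : ℤ) (n : N), n ∈ G.piece d → (∃ c ∈ primeCompl x, c • φ n = 0) →
      ∃ (m : ℕ) (c : Coord k r) (a : A), c ∈ MvPolynomial.homogeneousSubmodule (Fin r) k m ∧
        c ∈ primeCompl x ∧ a ∈ GA.piece (d + m) ∧ ι a = c • n)
    {j : ℤ} {U : (PSpace k r).Opens} {s : ∀ x : U, LocAt N x.1} (hs : s ∈ tildeSections G j U)
    (h0 : ∀ x, locMap φ x.1 (s x) = 0) (x : PSpace k r) (hx : x ∈ U) :
    ∃ (V : (PSpace k r).Opens) (hV : V ≤ U), x ∈ V ∧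
      ∃ (m : ℕ) (a : A) (b : Coord k r), a ∈ GA.piece (j + m) ∧
      b ∈ MvPolynomial.homogeneousSubmodule (Fin r) k m ∧
      ∀ y (hy : y ∈ V), ∃ hb : b ∈ primeCompl y,
        s ⟨y, hV hy⟩ = locMap ι y (LocalizedModule.mk a ⟨b, hb⟩) := by
  obtain ⟨V, hV, hxV, m, n, b, hn, hb, h⟩ := mem_tildeSections_iff.1 hs x hx
  obtain ⟨hbx, e⟩ := h x hxV
  have e0 : LocalizedModule.mk (φ n) (⟨b, hbx⟩ : primeCompl x) = 0 :=
    ((congrArg (locMap φ x) e).trans (locMap_mk ..)).symm.trans (h0 ⟨x, hx⟩)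
  obtain ⟨m', c, a, hc, hcx, ha, hac⟩ := hex x _ n hn ((mk_eq_zero_iff _ _).1 e0)
  refine ⟨V ⊓ nonVanishing c, inf_le_left.trans hV, ⟨hxV, hcx⟩, m + m', a, b * c, ?_,
    MvPolynomial.IsHomogeneous.mul hb hc, fun y hy => ?_⟩
  · rwa [add_assoc, ← Nat.cast_add] at ha
  · obtain ⟨hby, e⟩ := h y hy.1
    have hcy : c ∈ primeCompl y := hy.2
    refine ⟨Submonoid.mul_mem _ hby hcy, e.trans ?_⟩
    rw [locMap_mk, hac]
    exact mk_eq_mk_smul n hby hcy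

/-- Localizing keeps `ι` injective, so pointwise lifts are unique and agree with the local fractions
of `exists_local_lift`. -/
theorem exists_tildeSections_lift {φ : N →ₗ[Coord k r] N'} {ι : A →ₗ[Coord k r] N}
    (hι : Function.Injective ι)
    (hex : ∀ (x : PSpace k r) (d : ℤ) (n : N), n ∈ G.piece d → (∃ c ∈ primeCompl x, c • φ n = 0) →
      ∃ (m : ℕ) (c : Coord k r) (a : A), c ∈ MvPolynomial.homogeneousSubmodule (Fin r) k m ∧
        c ∈ primeCompl x ∧ a ∈ GA.piece (d + m) ∧ ι a = c • n)
    {j : ℤ} {U : (PSpace k r).Opens} {s : ∀ x : U, LocAt N x.1} (hs : s ∈ tildeSections G j U)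
    (h0 : ∀ x, locMap φ x.1 (s x) = 0) :
    ∃ t ∈ tildeSections GA j U, ∀ x, locMap ι x.1 (t x) = s x := by
  have hex' : ∀ x : U, ∃ t : LocAt A x.1, locMap ι x.1 t = s x := by
    intro x
    obtain ⟨V, hV, hxV, m, a, b, -, -, h⟩ := exists_local_lift hex hs h0 x.1 x.2
    obtain ⟨hb, e⟩ := h x.1 hxV
    exact ⟨_, e.symm⟩
  have ht : ∀ x : U, locMap ι x.1 (hex' x).choose = s x := fun x => (hex' x).choose_spec
  refine ⟨fun x => (hex' x).choose, mem_tildeSections_iff.2 fun x hx => ?_, ht⟩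
  obtain ⟨V, hV, hxV, m, a, b, ha, hb, h⟩ := exists_local_lift hex hs h0 x hx
  refine ⟨V, hV, hxV, m, a, b, ha, hb, fun y hy => ?_⟩
  obtain ⟨hby, e⟩ := h y hy
  have hi := locMap_injective hι y
  have e2 := (ht ⟨y, hV hy⟩).trans e
  exact ⟨hby, hi e2⟩

theorem tildeMap_app_injective {e j j' : ℤ} {φ : N →ₗ[Coord k r] N'} (hφ : IsOfDegree G G' e φ)
    (h : j + e = j') (hinj : Function.Injective φ) (U : (PSpace k r).Opens) :
    Function.Injective ((tildeMap φ hφ h).app U) := by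
  intro s t hst
  refine Subtype.ext (funext fun x => locMap_injective hinj x.1 ?_)
  exact congrFun (congrArg Subtype.val hst) x

theorem mono_tildeMap {e j j' : ℤ} {φ : N →ₗ[Coord k r] N'} (hφ : IsOfDegree G G' e φ)
    (h : j + e = j') (hinj : Function.Injective φ) : Mono (tildeMap φ hφ h) := by
  refine Preadditive.mono_of_cancel_zero _ fun {Z} q hq => ?_
  ext U z
  refine tildeMap_app_injective hφ h hinj U ?_
  exact (ConcreteCategory.congr_hom (congrArg (fun f => f.app U) hq) z).trans
    (map_zero ((tildeMap φ hφ h).app U).hom).symm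

/-- Left exactness of `tilde`, in the form of the lifting property that a kernel must have. -/
theorem exists_tildeMap_lift {φ : N →ₗ[Coord k r] N'} {ι : A →ₗ[Coord k r] N}
    (hι : Function.Injective ι) (hι' : IsOfDegree GA G 0 ι) {e : ℤ} (hφ : IsOfDegree G G' e φ)
    (hex : ∀ (x : PSpace k r) (d : ℤ) (n : N), n ∈ G.piece d → (∃ c ∈ primeCompl x, c • φ n = 0) →
      ∃ (m : ℕ) (c : Coord k r) (a : A), c ∈ MvPolynomial.homogeneousSubmodule (Fin r) k m ∧
        c ∈ primeCompl x ∧ a ∈ GA.piece (d + m) ∧ ι a = c • n)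
    {j j' : ℤ} (h : j + e = j') {Z : (PSpace k r).Modules} (q : Z ⟶ tilde G j)
    (hq : q ≫ tildeMap φ hφ h = 0) : ∃ l, l ≫ tildeMap ι hι' (add_zero j) = q := by
  refine exists_lift_of_injective _ _ (tildeMap_app_injective hι' _ hι) fun U z => ?_
  obtain ⟨t, ht, e⟩ := exists_tildeSections_lift (GA := GA) hι hex (q.app U z).2 fun x => by
    have := ConcreteCategory.congr_hom (congrArg (fun f => f.app U) hq) z
    exact congrFun (congrArg Subtype.val this) x
  exact ⟨⟨t, ht⟩, Subtype.ext (funext e)⟩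

/-- A local fraction lifts by lifting its numerator in the right degree and keeping the denominator.
-/
theorem epi_tildeMap {e j j' : ℤ} {φ : N →ₗ[Coord k r] N'} (hφ : IsOfDegree G G' e φ)
    (h : j + e = j') (hsurj : ∀ d, ∀ n' ∈ G'.piece (d + e), ∃ n ∈ G.piece d, φ n = n') :
    Epi (tildeMap φ hφ h) := by
  refine epi_of_locally_surjective _ fun U z x hx => ?_
  obtain ⟨V, hV, hxV, m, n', b, hn, hb, h'⟩ := mem_tildeSections_iff.1 z.2 x hx
  obtain ⟨n, hn', rfl⟩ := hsurj (j + m) n' (by rwa [add_right_comm, h])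
  refine ⟨V, hV, hxV, ⟨fun y => LocalizedModule.mk n ⟨b, (h' y.1 y.2).choose⟩,
    mem_tildeSections_iff.2 fun y hy => ⟨V, le_rfl, hy, m, n, b, hn', hb, fun w hw =>
      ⟨(h' w hw).choose, rfl⟩⟩⟩, Subtype.ext (funext fun y => ?_)⟩
  exact (locMap_mk ..).trans (h' y.1 y.2).choose_spec.symm

theorem tildeMap_comp_eq_zero {φ : N →ₗ[Coord k r] N'} {ι : A →ₗ[Coord k r] N} {e e' : ℤ}
    (hι : IsOfDegree GA G e' ι) (hφ : IsOfDegree G G' e φ)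
    {j j' j'' : ℤ} (h' : j + e' = j') (h : j' + e = j'') (hc : φ ∘ₗ ι = 0) :
    tildeMap ι hι h' ≫ tildeMap φ hφ h = 0 := by
  ext U s
  refine Subtype.ext (funext fun x => ?_)
  change locMap φ x.1 (locMap ι x.1 (s.1 x)) = 0
  induction s.1 x using LocalizedModule.induction_on with
  | _ n b =>
    rw [locMap_mk, locMap_mk, ← LinearMap.comp_apply, hc, LinearMap.zero_apply,
      LocalizedModule.zero_mk]

theorem nonempty_tilde_iso (f : N ≃ₗ[Coord k r] N')
    (hf : ∀ d n, n ∈ G.piece d → f n ∈ G'.piece d)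
    (hf' : ∀ d n, n ∈ G'.piece d → f.symm n ∈ G.piece d) (j : ℤ) :
    Nonempty (tilde G j ≅ tilde G' j) := by
  have h1 : IsOfDegree G G' 0 f.toLinearMap := fun d n hn => by simpa using hf d n hn
  have h2 : IsOfDegree G' G 0 f.symm.toLinearMap := fun d n hn => by simpa using hf' d n hn
  have hid : ∀ {P : Type u} [AddCommGroup P] [Module (Coord k r) P] (H : Grading k r P)
      (h : IsOfDegree H H 0 LinearMap.id), tildeMap LinearMap.id h (add_zero j) = 𝟙 (tilde H j) := by
    intro P _ _ H h
    ext U s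
    refine Subtype.ext (funext fun x => ?_)
    change locMap LinearMap.id x.1 (s.1 x) = s.1 x
    induction s.1 x using LocalizedModule.induction_on with
    | _ n b => rw [locMap_mk]; rfl
  have h0 : ∀ {P : Type u} [AddCommGroup P] [Module (Coord k r) P] (H : Grading k r P),
    IsOfDegree H H 0 LinearMap.id := fun H d n hn => by simpa using hn
  refine ⟨⟨tildeMap _ h1 (add_zero j), tildeMap _ h2 (add_zero j), ?_, ?_⟩⟩
  · rw [tildeMap_comp h1 h2 (h0 G) (by ext; simp) _ _ (add_zero j), hid]
  · rw [tildeMap_comp h2 h1 (h0 G') (by ext; simp) _ _ (add_zero j), hid]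

end TildeExact

/-! ### Gradings on submodules and quotients. -/

section GradedModules

variable {k : Type u} [Field k] {r : ℕ}
variable {N : Type u} [AddCommGroup N] [Module (Coord k r) N]

/-- The induced grading on a submodule. -/
def Grading.sub (G : Grading k r N) (A : Submodule (Coord k r) N) : Grading k r A where
  piece d := (G.piece d).comap A.subtype.toAddMonoidHom
  smul_mem ha hn := G.smul_mem ha hn

/-- The induced grading on a quotient module. -/
def Grading.quot (G : Grading k r N) (A : Submodule (Coord k r) N) : Grading k r (N ⧸ A) where
  piece d := (G.piece d).map A.mkQ.toAddMonoidHom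
  smul_mem := by
    rintro m d a _ ha ⟨n, hn, rfl⟩
    exact ⟨a • n, G.smul_mem ha hn, map_smul A.mkQ a n⟩

theorem isOfDegree_subtype (G : Grading k r N) (A : Submodule (Coord k r) N) :
    IsOfDegree (G.sub A) G 0 A.subtype := fun d n hn => by rwa [add_zero]

theorem isOfDegree_inclusion (G : Grading k r N) {A B : Submodule (Coord k r) N} (h : A ≤ B) :
    IsOfDegree (G.sub A) (G.sub B) 0 (Submodule.inclusion h) := fun d n hn => by rwa [add_zero]

theorem isOfDegree_mkQ (G : Grading k r N) (A : Submodule (Coord k r) N) :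
    IsOfDegree G (G.quot A) 0 A.mkQ := fun d n hn => by rw [add_zero]; exact ⟨n, hn, rfl⟩

/-- The subsheaf of `Ñ` associated to a submodule of `N`. -/
def tildeSub (G : Grading k r N) (A : Submodule (Coord k r) N) : Subobject (tilde G 0) :=
  @Subobject.mk _ _ _ _ (tildeMap A.subtype (isOfDegree_subtype G A) (add_zero 0))
    (mono_tildeMap _ _ (Submodule.subtype_injective _))

end GradedModules

/-! ### Homogeneous components in `k[Y] ⊗ M`. -/

section Components

variable {k : Type u} [Field k] {r : ℕ} {M : Type u} [AddCommGroup M] [Module k M]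
variable {M' : Type u} [AddCommGroup M'] [Module k M']

theorem homogeneous_tmul_induction {motive : Coord k r ⊗[k] M → Prop} (zero : motive 0)
    (add : ∀ y z, motive y → motive z → motive (y + z))
    (tmul : ∀ (n : ℕ) (f : Coord k r) (m : M), f.IsHomogeneous n → motive (f ⊗ₜ m)) (z) :
    motive z := by
  induction z using TensorProduct.induction_on with
  | zero => exact zero
  | add y z hy hz => exact add y z hy hz
  | tmul f m =>
    induction f using MvPolynomial.induction_on' with
    | monomial s c => exact tmul _ _ _ (MvPolynomial.isHomogeneous_monomial c rfl)
    | add f g hf hg => rw [TensorProduct.add_tmul]; exact add _ _ hf hg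

/-- The homogeneous component of degree `d` of an element of `k[Y₁, …, Y_r] ⊗ M`. -/
def zcomp (d : ℤ) : Coord k r ⊗[k] M →ₗ[k] Coord k r ⊗[k] M :=
  if 0 ≤ d then (MvPolynomial.homogeneousComponent d.toNat).rTensor M else 0

theorem tmul_mem_piece {n : ℕ} {f : Coord k r} (hf : f.IsHomogeneous n) (m : M) :
    f ⊗ₜ[k] m ∈ (tensorGrading M).piece n :=
  AddSubgroup.subset_closure ⟨n, f, m, rfl, hf, rfl⟩

theorem zcomp_tmul (d : ℤ) {n : ℕ} {f : Coord k r} (hf : f.IsHomogeneous n) (m : M) :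
    zcomp d (f ⊗ₜ[k] m) = if (n : ℤ) = d then f ⊗ₜ m else 0 := by
  unfold zcomp
  split_ifs with h h' h'
  · subst h'
    rw [LinearMap.rTensor_tmul, Int.toNat_natCast,
      MvPolynomial.homogeneousComponent_of_mem hf, if_pos rfl]
  · rw [LinearMap.rTensor_tmul, MvPolynomial.homogeneousComponent_of_mem hf, if_neg (by omega),
      TensorProduct.zero_tmul]
  · omega
  · rfl

theorem zcomp_mem (d : ℤ) (z : Coord k r ⊗[k] M) : zcomp d z ∈ (tensorGrading M).piece d := by
  induction z using homogeneous_tmul_induction with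
  | zero => rw [map_zero]; exact zero_mem _
  | add y z hy hz => rw [map_add]; exact add_mem hy hz
  | tmul n f m hf =>
    rw [zcomp_tmul d hf]
    split_ifs with h
    · exact h ▸ tmul_mem_piece hf m
    · exact zero_mem _

theorem zcomp_of_mem {d e : ℤ} {z : Coord k r ⊗[k] M} (hz : z ∈ (tensorGrading M).piece e) :
    zcomp d z = if e = d then z else 0 := by
  induction hz using AddSubgroup.closure_induction with
  | mem z hz =>
    obtain ⟨n, f, m, rfl, hf, rfl⟩ := hz
    exact zcomp_tmul d hf m
  | zero => simp
  | add y z _ _ hy hz => rw [map_add, hy, hz]; split_ifs <;> simp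
  | neg y _ hy => rw [map_neg, hy]; split_ifs <;> simp

theorem zcomp_self {d : ℤ} {z : Coord k r ⊗[k] M} (hz : z ∈ (tensorGrading M).piece d) :
    zcomp d z = z := by rw [zcomp_of_mem hz, if_pos rfl]

theorem zcomp_map {e : ℤ} {φ : Coord k r ⊗[k] M →ₗ[Coord k r] Coord k r ⊗[k] M'}
    (hφ : IsOfDegree (tensorGrading M) (tensorGrading M') e φ) (d : ℤ) (z : Coord k r ⊗[k] M) :
    zcomp (d + e) (φ z) = φ (zcomp d z) := by
  induction z using homogeneous_tmul_induction with
  | zero => simp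
  | add y z hy hz => simp [hy, hz]
  | tmul n f m hf =>
    have h := tmul_mem_piece hf m
    rw [zcomp_of_mem h, zcomp_of_mem (hφ _ _ h)]
    by_cases h' : (n : ℤ) = d
    · rw [if_pos h', if_pos (by omega)]
    · rw [if_neg h', if_neg (by omega), map_zero]

theorem exists_eq_sum_zcomp (z : Coord k r ⊗[k] M) :
    ∃ n : ℕ, ∀ m ≥ n, z = ∑ d ∈ Finset.range m, zcomp d z := by
  induction z using homogeneous_tmul_induction with
  | zero => exact ⟨0, fun m _ => by simp⟩
  | add y z hy hz =>
    obtain ⟨n, hn⟩ := hy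
    obtain ⟨n', hn'⟩ := hz
    refine ⟨max n n', fun m hm => ?_⟩
    simp only [map_add, Finset.sum_add_distrib]
    rw [← hn m (le_trans (le_max_left _ _) hm), ← hn' m (le_trans (le_max_right _ _) hm)]
  | tmul n f x hf =>
    refine ⟨n + 1, fun m hm => ?_⟩
    simp only [zcomp_tmul _ hf, Nat.cast_inj]
    rw [Finset.sum_ite_eq, if_pos (Finset.mem_range.2 hm)]

theorem exists_homogeneousComponent_mem_primeCompl {x : PSpace k r} {c : Coord k r}
    (hc : c ∈ primeCompl x) : ∃ n, MvPolynomial.homogeneousComponent n c ∈ primeCompl x := by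
  by_contra! h
  refine hc ?_
  rw [← MvPolynomial.sum_homogeneousComponent c]
  exact sum_mem fun n _ => by_contra fun hn => h n hn

/-- A submodule of `k[Y₁, …, Y_r] ⊗ M` which contains the components of its elements. -/
def IsHomogeneousSub (A : Submodule (Coord k r) (Coord k r ⊗[k] M)) : Prop :=
  ∀ d z, z ∈ A → zcomp d z ∈ A

/-- Because `z` is homogeneous of degree `d`, the component of `c • z` in degree `d + n` is the
`n`-th component of `c` times `z`. -/
theorem IsHomogeneousSub.homogeneousComponent_smul_mem
    {A : Submodule (Coord k r) (Coord k r ⊗[k] M)} (hA : IsHomogeneousSub A) {d : ℤ}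
    {z : Coord k r ⊗[k] M} (hz : z ∈ (tensorGrading M).piece d) {c : Coord k r} (hc : c • z ∈ A)
    (n : ℕ) : MvPolynomial.homogeneousComponent n c • z ∈ A := by
  have : zcomp (d + n) (c • z) = MvPolynomial.homogeneousComponent n c • z := by
    conv_lhs => rw [← MvPolynomial.sum_homogeneousComponent c]
    rw [Finset.sum_smul, map_sum]
    have h : ∀ i, zcomp (d + n) (MvPolynomial.homogeneousComponent i c • z) =
        if i = n then MvPolynomial.homogeneousComponent i c • z else 0 := fun i => by
      rw [zcomp_of_mem ((tensorGrading M).smul_mem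
        (MvPolynomial.homogeneousComponent_isHomogeneous i c) hz)]
      by_cases h : i = n
      · rw [if_pos h, if_pos (by omega)]
      · rw [if_neg h, if_neg (by omega)]
    simp only [h]
    rw [Finset.sum_ite_eq']
    split_ifs with h'
    · rfl
    · rw [MvPolynomial.homogeneousComponent_eq_zero _ _ (by simpa using h'), zero_smul]
  rw [← this]
  exact hA _ _ hc

theorem isHomogeneousSub_bot : IsHomogeneousSub (⊥ : Submodule (Coord k r) (Coord k r ⊗[k] M)) := by
  intro d z hz
  rw [(Submodule.mem_bot _).1 hz, map_zero]
  exact zero_mem _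

theorem IsHomogeneousSub.exists_homogeneous_smul_mem
    {A : Submodule (Coord k r) (Coord k r ⊗[k] M)} (hA : IsHomogeneousSub A) {x : PSpace k r}
    {d : ℤ} {z : Coord k r ⊗[k] M} (hz : z ∈ (tensorGrading M).piece d)
    (h : ∃ c ∈ primeCompl x, c • z ∈ A) :
    ∃ (m : ℕ) (c : Coord k r), c ∈ MvPolynomial.homogeneousSubmodule (Fin r) k m ∧
      c ∈ primeCompl x ∧ c • z ∈ A := by
  obtain ⟨c, hc, hcz⟩ := h
  obtain ⟨n, hn⟩ := exists_homogeneousComponent_mem_primeCompl hc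
  exact ⟨n, _, MvPolynomial.homogeneousComponent_isHomogeneous n c, hn,
    hA.homogeneousComponent_smul_mem hz hcz n⟩

end Components

/-! ### From `Ker θ ∩ Im θ^a` as a graded submodule to the subsheaf. -/

section KerInfRange

variable {k : Type u} [Field k] {r : ℕ}
variable {N : Type u} [AddCommGroup N] [Module (Coord k r) N]

/-- The submodule `Ker θ ∩ Im θ^a`. -/
def kerInfRange (θ : Module.End (Coord k r) N) (a : ℕ) : Submodule (Coord k r) N :=
  LinearMap.ker θ ⊓ LinearMap.range (θ ^ a)

theorem kerInfRange_succ_le (θ : Module.End (Coord k r) N) (a : ℕ) :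
    kerInfRange θ (a + 1) ≤ kerInfRange θ a := by
  refine inf_le_inf_left _ ?_
  rintro _ ⟨z, rfl⟩
  exact ⟨θ z, by rw [pow_succ]; rfl⟩

/-- The module `(Ker θ ∩ Im θ^a) / (Ker θ ∩ Im θ^(a+1))`. -/
abbrev Subquot (θ : Module.End (Coord k r) N) (a : ℕ) : Type u :=
  kerInfRange θ a ⧸ (kerInfRange θ (a + 1)).comap (kerInfRange θ a).subtype

/-- The projection of `Ker θ ∩ Im θ^a` to the subquotient. -/
abbrev subquotMk (θ : Module.End (Coord k r) N) (a : ℕ) :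
    kerInfRange θ a →ₗ[Coord k r] Subquot θ a :=
  Submodule.mkQ _

/-- The grading of the subquotient. -/
def subquotGrading (G : Grading k r N) (θ : Module.End (Coord k r) N) (a : ℕ) :
    Grading k r (Subquot θ a) :=
  (G.sub (kerInfRange θ a)).quot _

theorem isOfDegree_subquotMk (G : Grading k r N) (θ : Module.End (Coord k r) N) (a : ℕ) :
    IsOfDegree (G.sub (kerInfRange θ a)) (subquotGrading G θ a) 0 (subquotMk θ a) :=
  isOfDegree_mkQ _ _

theorem subquotMk_eq_zero {θ : Module.End (Coord k r) N} {a : ℕ} {n : kerInfRange θ a} :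
    subquotMk θ a n = 0 ↔ n.1 ∈ kerInfRange θ (a + 1) :=
  Submodule.Quotient.mk_eq_zero _

/-- A homogeneous element which is carried into `A` by some polynomial not vanishing at `x` is
carried into `A` by a homogeneous one. -/
def HasHomogeneousAnnihilators (G : Grading k r N) (A : Submodule (Coord k r) N) : Prop :=
  ∀ (x : PSpace k r) (d : ℤ) (n : N), n ∈ G.piece d → (∃ c ∈ primeCompl x, c • n ∈ A) →
    ∃ (m : ℕ) (c : Coord k r), c ∈ MvPolynomial.homogeneousSubmodule (Fin r) k m ∧
      c ∈ primeCompl x ∧ c • n ∈ A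

/-- Factor `θ^b` through its range with the grading induced from `N`. By `hrange`, a homogeneous
element of the range has a homogeneous preimage, so the first factor is an epimorphism of sheaves.
-/
theorem kernelSubobject_inf_imageSubobject_tilde {G : Grading k r N}
    {θ : Module.End (Coord k r) N} (hθ : IsOfDegree G G 1 θ) {b : ℕ}
    (hb : IsOfDegree G G b (θ ^ b))
    (hrange : ∀ d n, (θ ^ b) n ∈ G.piece (d + b) → ∃ n' ∈ G.piece d, (θ ^ b) n' = (θ ^ b) n)
    (hbot : HasHomogeneousAnnihilators G (⊥ : Submodule (Coord k r) N)) :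
    kernelSubobject (tildeMap θ hθ (zero_add 1)) ⊓
      imageSubobject (tildeMap (θ ^ b) hb (neg_add_cancel (b : ℤ))) = tildeSub G (kerInfRange θ b) := by
  have hAR : kerInfRange θ b ≤ LinearMap.range (θ ^ b) := inf_le_right
  have he : IsOfDegree G (G.sub (LinearMap.range (θ ^ b))) b (θ ^ b).rangeRestrict := hb
  have h1 : Epi (tildeMap _ he (neg_add_cancel (b : ℤ))) := by
    refine epi_tildeMap _ _ ?_
    rintro d ⟨_, z, rfl⟩ hz
    obtain ⟨n', hn', e⟩ := hrange d z hz
    exact ⟨n', hn', Subtype.ext e⟩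
  have h2 : Mono (tildeMap _ (isOfDegree_subtype G (LinearMap.range (θ ^ b))) (add_zero 0)) :=
    mono_tildeMap _ _ (Submodule.subtype_injective _)
  have h3 : Mono (tildeMap _ (isOfDegree_inclusion G hAR) (add_zero 0)) :=
    mono_tildeMap _ _ (Submodule.inclusion_injective _)
  have h4 := mono_tildeMap (isOfDegree_subtype G (kerInfRange θ b)) (add_zero 0)
    (Submodule.subtype_injective _)
  have hd : IsOfDegree (G.sub (LinearMap.range (θ ^ b))) G 1
      (θ ∘ₗ (LinearMap.range (θ ^ b)).subtype) := fun d n hn => hθ d n.1 hn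
  have hm : tildeMap _ (isOfDegree_subtype G (LinearMap.range (θ ^ b))) (add_zero 0) ≫
      tildeMap θ hθ (zero_add 1) = tildeMap _ hd (zero_add 1) :=
    tildeMap_comp _ _ _ rfl _ _ _
  have := kernelSubobject_inf_imageSubobject (tildeMap θ hθ (zero_add 1))
    (tildeMap (θ ^ b) hb (neg_add_cancel (b : ℤ))) (tildeMap _ he (neg_add_cancel (b : ℤ)))
    (tildeMap _ (isOfDegree_subtype G (LinearMap.range (θ ^ b))) (add_zero 0))
    (tildeMap _ (isOfDegree_inclusion G hAR) (add_zero 0))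
    (tildeMap_comp _ _ _ rfl _ _ _)
    (by
      rw [hm]
      refine tildeMap_comp_eq_zero _ _ _ _ ?_
      ext n
      exact n.2.1)
    (fun q hq => by
      rw [hm] at hq
      refine exists_tildeMap_lift (Submodule.inclusion_injective _) _ _ ?_ _ q hq
      rintro x d n hn ⟨c, hc, h0⟩
      obtain ⟨m, c', hc', hcx, h⟩ := hbot x _ _ (hd _ _ hn) ⟨c, hc, (Submodule.mem_bot _).2 h0⟩
      refine ⟨m, c', ⟨c' • n.1, ?_, (c' • n).2⟩, hc', hcx, G.smul_mem hc' hn, rfl⟩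
      rw [SetLike.mem_coe, LinearMap.mem_ker, map_smul]
      exact (Submodule.mem_bot _).1 h)
  refine this.trans ?_
  unfold tildeSub
  congr 1
  exact tildeMap_comp _ _ _ rfl _ _ _

theorem nonempty_cokernel_iso_tilde {G : Grading k r N} {θ : Module.End (Coord k r) N} {a : ℕ}
    {S T : Subobject (tilde G 0)} (h : S ≤ T)
    (hS : S = tildeSub G (kerInfRange θ (a + 1)))
    (hT : T = tildeSub G (kerInfRange θ a))
    (hA : HasHomogeneousAnnihilators G (kerInfRange θ (a + 1))) :
    Nonempty (cokernel (Subobject.ofLE S T h) ≅ tilde (subquotGrading G θ a) 0) := by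
  have i1 := mono_tildeMap (isOfDegree_subtype G (kerInfRange θ (a + 1))) (add_zero 0)
      (Submodule.subtype_injective _)
  have i2 := mono_tildeMap (isOfDegree_subtype G (kerInfRange θ a)) (add_zero 0)
      (Submodule.subtype_injective _)
  have i3 : Epi (tildeMap _ (isOfDegree_subquotMk G θ a) (add_zero 0)) := by
    refine epi_tildeMap _ _ ?_
    rintro d n ⟨n', hn', rfl⟩
    exact ⟨n', by rwa [add_zero] at hn', rfl⟩
  refine nonempty_cokernel_ofLE_iso h _ _ hS hT
    (tildeMap _ (isOfDegree_inclusion G (kerInfRange_succ_le θ a)) (add_zero 0))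
    (tildeMap_comp _ _ _ rfl _ _ _) (tildeMap _ (isOfDegree_subquotMk G θ a) (add_zero 0)) ?_ ?_
  · refine tildeMap_comp_eq_zero _ _ _ _ ?_
    ext n
    exact subquotMk_eq_zero.2 n.2
  · intro Z q hq
    refine exists_tildeMap_lift (Submodule.inclusion_injective _) _ _ ?_ _ q hq
    rintro x d n hn ⟨c, hc, h0⟩
    rw [← map_smul] at h0
    obtain ⟨m, c', hc', hcx, h⟩ := hA x d n.1 hn ⟨c, hc, subquotMk_eq_zero.1 h0⟩
    exact ⟨m, c', ⟨c' • n.1, h⟩, hc', hcx, G.smul_mem hc' hn, rfl⟩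

end KerInfRange

/-! ### The sheaf `ℱ_i` as the sheaf of a graded subquotient. -/

section Subquotient

variable {k : Type u} [Field k] {r : ℕ} {M : Type u} [AddCommGroup M] [Module k M]
variable (X : Fin r → Module.End k M)

theorem isHomogeneousSub_range (a : ℕ) :
    IsHomogeneousSub (LinearMap.range (thetaLin X ^ a)) := by
  rintro d _ ⟨z, rfl⟩
  refine ⟨zcomp (d - a) z, ?_⟩
  rw [← zcomp_map (thetaLin_pow_isOfDegree X a), sub_add_cancel]

theorem isHomogeneousSub_kerInfRange (a : ℕ) : IsHomogeneousSub (kerInfRange (thetaLin X) a) := by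
  rintro d z ⟨h1, h2⟩
  refine ⟨?_, isHomogeneousSub_range X a d z h2⟩
  rw [SetLike.mem_coe, LinearMap.mem_ker] at h1 ⊢
  rw [← zcomp_map (thetaLin_isOfDegree X), h1, map_zero]

theorem IsHomogeneousSub.hasHomogeneousAnnihilators
    {A : Submodule (Coord k r) (Coord k r ⊗[k] M)} (hA : IsHomogeneousSub A) :
    HasHomogeneousAnnihilators (tensorGrading M) A :=
  fun _ _ _ hn h => hA.exists_homogeneous_smul_mem hn h

theorem kerInfIm_eq (b : ℕ) : kerInfIm X b = tildeSub (tensorGrading M) (kerInfRange (thetaLin X) b) := by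
  refine kernelSubobject_inf_imageSubobject_tilde (thetaLin_isOfDegree X)
    (thetaLin_pow_isOfDegree X b) (fun d n hn => ⟨zcomp d n, zcomp_mem d n, ?_⟩)
    isHomogeneousSub_bot.hasHomogeneousAnnihilators
  rw [← zcomp_map (thetaLin_pow_isOfDegree X b)]
  exact zcomp_self hn

theorem nonempty_subquotient_iso (a : ℕ) : Nonempty (subquotient X a ≅
    tilde (subquotGrading (tensorGrading M) (thetaLin X) a) 0) :=
  nonempty_cokernel_iso_tilde (kerInfIm_succ_le X a) (kerInfIm_eq X (a + 1)) (kerInfIm_eq X a)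
    (isHomogeneousSub_kerInfRange X (a + 1)).hasHomogeneousAnnihilators

end Subquotient

/-! ### Pairings of graded modules on stalks and on sections. -/

section Pairing

variable {k : Type u} [Field k] {r : ℕ}
variable {P : Type u} [AddCommGroup P] [Module (Coord k r) P]
variable {Q : Type u} [AddCommGroup Q] [Module (Coord k r) Q]
variable {GP : Grading k r P} {GQ : Grading k r Q}

/-- A prime containing every variable would contain the irrelevant ideal: a polynomial without
constant term has a variable in each of its monomials. -/
theorem exists_X_mem_primeCompl (x : PSpace k r) :
    ∃ l, (MvPolynomial.X l : Coord k r) ∈ primeCompl x := by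
  by_contra! h
  have hx := x.not_irrelevant_le
  refine hx fun f hf => ?_
  have h' : f ∈ Ideal.span ((MvPolynomial.X : Fin r → Coord k r) '' Set.univ) := by
    rw [MvPolynomial.mem_ideal_span_X_image]
    intro m hm
    by_contra! h0
    have hm0 : m = 0 := by ext i; exact h0 i trivial
    subst hm0
    have : MvPolynomial.homogeneousComponent 0 f = 0 := by
      have := (HomogeneousIdeal.mem_irrelevant_iff _ f).1 hf
      exact (MvPolynomial.decomposition.decompose'_apply f 0).symm.trans this
    rw [MvPolynomial.homogeneousComponent_zero, MvPolynomial.C_eq_zero] at this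
    exact (MvPolynomial.mem_support_iff.1 hm) this
  refine (Ideal.span_le.2 ?_) h'
  rintro _ ⟨l, -, rfl⟩
  exact not_not.1 (h l)

section LocalizedPairing

variable {R : Type*} [CommRing R] (C : Submonoid R) {P Q : Type*} [AddCommGroup P] [Module R P]
  [AddCommGroup Q] [Module R Q]

theorem isUnit_algebraMap_end (W : Type*) [AddCommGroup W] [Module R W]
    [Module (Localization C) W] [IsScalarTower R (Localization C) W] (c : C) :
    IsUnit (algebraMap R (Module.End R W) c) := by
  obtain ⟨u, hu⟩ := IsLocalization.map_units (Localization C) c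
  rw [Module.End.isUnit_iff]
  have : ∀ w : W, algebraMap R (Module.End R W) c w =
      algebraMap _ (Localization C) c.1 • w := fun w => by
    rw [Module.algebraMap_end_apply, algebraMap_smul]
  constructor
  · intro w w' h
    rw [this, this, ← hu] at h
    exact smul_left_cancel u h
  · intro w
    exact ⟨(u⁻¹ : (Localization C)ˣ) • w, by rw [this, ← hu]; exact smul_inv_smul u w⟩

/-- The pairing on localizations induced by a bilinear pairing. -/
def localizedPairing (B : P →ₗ[R] Q →ₗ[R] R) :
    LocalizedModule C P →ₗ[Localization C] LocalizedModule C Q →ₗ[Localization C]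
      LocalizedModule C R :=
  LinearMap.extendScalarsOfIsLocalization C (Localization C)
    (LocalizedModule.lift C (LocalizedModule.map C ∘ₗ B) (isUnit_algebraMap_end C _))

theorem localizedPairing_mk (B : P →ₗ[R] Q →ₗ[R] R) (p : P) (q : Q) (b c : C) :
    localizedPairing C B (LocalizedModule.mk p b) (LocalizedModule.mk q c) =
      LocalizedModule.mk (B p q) (b * c) := by
  have h0 := isUnit_algebraMap_end C (LocalizedModule C Q →ₗ[Localization C] LocalizedModule C R)
  have h1 : LocalizedModule.map C (B p) = b.1 • localizedPairing C B (LocalizedModule.mk p b) :=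
    (Module.End.algebraMap_isUnit_inv_apply_eq_iff (h := h0 b) _ _ _).1 rfl
  have h2 := LinearMap.congr_fun h1 (LocalizedModule.mk q c)
  have h3 := IsLocalizedModule.map_LocalizedModules (S := C) (B p) q c
  refine IsLocalizedModule.smul_injective (LocalizedModule.mkLinearMap C R) b ?_
  refine (h2.symm.trans h3).trans ?_
  change _ = b.1 • LocalizedModule.mk (B p q) (b * c)
  rw [LocalizedModule.smul'_mk, LocalizedModule.mk_eq]
  exact ⟨1, by simp only [one_smul, Submonoid.smul_def, Submonoid.coe_mul, smul_smul, mul_comm]⟩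

end LocalizedPairing

/-- The pairing on the localizations at a point induced by a bilinear pairing. -/
def locPairing (B : P →ₗ[Coord k r] Q →ₗ[Coord k r] Coord k r) (x : PSpace k r) :
    LocAt P x →ₗ[Localization (primeCompl x)] LocAt Q x →ₗ[Localization (primeCompl x)]
      LocAt (Coord k r) x :=
  localizedPairing (primeCompl x) B

theorem locPairing_mk (B : P →ₗ[Coord k r] Q →ₗ[Coord k r] Coord k r) (x : PSpace k r)
    (p : P) (q : Q) (b c : primeCompl x) :
    locPairing B x (LocalizedModule.mk p b) (LocalizedModule.mk q c) =
      LocalizedModule.mk (B p q) (b * c) :=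
  localizedPairing_mk ..

/-- The section of `Ñ(j)` given by a global fraction. -/
def fracSection {N : Type u} [AddCommGroup N] [Module (Coord k r) N] (G : Grading k r N) (j : ℤ)
    {V : (PSpace k r).Opens} {m : ℕ} (n : N) (b : Coord k r) (hn : n ∈ G.piece (j + m))
    (hb : b ∈ MvPolynomial.homogeneousSubmodule (Fin r) k m) (hV : ∀ y : V, b ∈ primeCompl y.1) :
    tildeSections G j V :=
  ⟨fun y => LocalizedModule.mk n ⟨b, hV y⟩, mem_tildeSections_iff.2 fun _ hx =>
    ⟨V, le_rfl, hx, m, n, b, hn, hb, fun y hy => ⟨hV ⟨y, hy⟩, rfl⟩⟩⟩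

theorem mem_coordGrading_piece {m : ℕ} {f : Coord k r} :
    f ∈ (coordGrading k r).piece m ↔ f.IsHomogeneous m := by
  constructor
  · rintro (rfl | ⟨n, h, hf⟩)
    · exact MvPolynomial.isHomogeneous_zero ..
    · rwa [Nat.cast_inj.1 h] at hf
  · exact fun h => Or.inr ⟨m, rfl, h⟩

/-- A pairing of degree `-a` of graded modules. -/
def IsGradedPairing (GP : Grading k r P) (GQ : Grading k r Q)
    (B : P →ₗ[Coord k r] Q →ₗ[Coord k r] Coord k r) (a : ℕ) : Prop :=
  ∀ (d e : ℤ) (p : P) (q : Q), p ∈ GP.piece d → q ∈ GQ.piece e →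
    B p q ∈ (coordGrading k r).piece (d + e - a)

theorem locPairing_mem_tildeSections {B : P →ₗ[Coord k r] Q →ₗ[Coord k r] Coord k r} {a : ℕ}
    (hB : IsGradedPairing GP GQ B a) {i j l : ℤ} (h : i + j - a = l) {V : (PSpace k r).Opens}
    (s : tildeSections GP i V) (t : tildeSections GQ j V) :
    (fun x : V => locPairing B x.1 (s.1 x) (t.1 x)) ∈ tildeSections (coordGrading k r) l V := by
  refine mem_tildeSections_iff.2 fun x hx => ?_
  obtain ⟨V₁, h₁, hx₁, m₁, p, b, hp, hb, e₁⟩ := mem_tildeSections_iff.1 s.2 x hx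
  obtain ⟨V₂, h₂, hx₂, m₂, q, c, hq, hc, e₂⟩ := mem_tildeSections_iff.1 t.2 x hx
  refine ⟨V₁ ⊓ V₂, inf_le_left.trans h₁, ⟨hx₁, hx₂⟩, m₁ + m₂, B p q, b * c, ?_,
    MvPolynomial.IsHomogeneous.mul hb hc, fun y hy => ?_⟩
  · have := hB _ _ _ _ hp hq
    rwa [show i + m₁ + (j + m₂) - a = l + (m₁ + m₂ : ℕ) by push_cast; omega] at this
  · obtain ⟨hb', e₁⟩ := e₁ y hy.1
    obtain ⟨hc', e₂⟩ := e₂ y hy.2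
    refine ⟨Submonoid.mul_mem _ hb' hc', ?_⟩
    exact (congrArg₂ (fun u v => locPairing B y u v) e₁ e₂).trans (locPairing_mk ..)

theorem smul_mem_tildeSections {N : Type u} [AddCommGroup N] [Module (Coord k r) N]
    {G : Grading k r N} {i j l : ℤ} (h : i + j = l) {V : (PSpace k r).Opens}
    (s : tildeSections (coordGrading k r) i V) (t : tildeSections G j V) :
    (fun x : V => (s.1 x : Localization (primeCompl x.1)) • t.1 x) ∈ tildeSections G l V := by
  refine mem_tildeSections_iff.2 fun x hx => ?_
  obtain ⟨V₁, h₁, hx₁, m₁, f, b, hf, hb, e₁⟩ := mem_tildeSections_iff.1 s.2 x hx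
  obtain ⟨V₂, h₂, hx₂, m₂, q, c, hq, hc, e₂⟩ := mem_tildeSections_iff.1 t.2 x hx
  refine ⟨V₁ ⊓ V₂, inf_le_left.trans h₁, ⟨hx₁, hx₂⟩, m₁ + m₂, f • q, b * c, ?_,
    MvPolynomial.IsHomogeneous.mul hb hc, fun y hy => ?_⟩
  · rcases hf with rfl | ⟨n, hn, hf⟩
    · rw [zero_smul]; exact zero_mem _
    · have := G.smul_mem hf hq
      rwa [show j + m₂ + n = l + (m₁ + m₂ : ℕ) by push_cast; omega] at this
  · obtain ⟨hb', e₁⟩ := e₁ y hy.1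
    obtain ⟨hc', e₂⟩ := e₂ y hy.2
    refine ⟨Submonoid.mul_mem _ hb' hc', ?_⟩
    exact (congrArg₂ (fun (u : Localization (primeCompl y)) v => u • v) e₁ e₂).trans
      (LocalizedModule.mk_smul_mk ..)

theorem evalAt_injective {V : (PSpace k r).Opens} {f g : Γ(PSpace k r, V)}
    (h : ∀ y : V, evalAt f y = evalAt g y) : f = g :=
  Subtype.ext (funext fun y => HomogeneousLocalization.val_injective _ (h y))

theorem evalAt_add {V : (PSpace k r).Opens} (f g : Γ(PSpace k r, V)) (y : V) :
    evalAt (f + g) y = evalAt f y + evalAt g y := HomogeneousLocalization.val_add _ _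

theorem evalAt_mul {V : (PSpace k r).Opens} (f g : Γ(PSpace k r, V)) (y : V) :
    evalAt (f * g) y = evalAt f y * evalAt g y := HomogeneousLocalization.val_mul _ _

theorem evalAt_zero {V : (PSpace k r).Opens} (y : V) :
    evalAt (0 : Γ(PSpace k r, V)) y = 0 := HomogeneousLocalization.val_zero

theorem evalAt_sum {ι : Type*} (s : Finset ι) {V : (PSpace k r).Opens} (f : ι → Γ(PSpace k r, V))
    (y : V) : evalAt (∑ i ∈ s, f i) y = ∑ i ∈ s, evalAt (f i) y := by
  classical
  induction s using Finset.induction_on with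
  | empty => simp [evalAt_zero]
  | insert i s hi ih => rw [Finset.sum_insert hi, Finset.sum_insert hi, evalAt_add, ih]

/-- This identifies `𝒪(0)` with the structure sheaf: locally `s` is a quotient of two polynomials of
equal degree, and such values determine elements of the homogeneous localization since `val` is
injective. -/
theorem exists_evalAt_eq {V : (PSpace k r).Opens} (s : tildeSections (coordGrading k r) 0 V) :
    ∃ f : Γ(PSpace k r, V), ∀ y, evalAt f y = s.1 y := by
  have key : ∀ x (hx : x ∈ V), ∃ (V' : (PSpace k r).Opens) (hV : V' ≤ V), x ∈ V' ∧
      ∃ (m : ℕ) (n b : MvPolynomial.homogeneousSubmodule (Fin r) k m),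
      ∀ y (hy : y ∈ V'), ∃ hb : b.1 ∈ primeCompl y, HomogeneousLocalization.val
        (HomogeneousLocalization.mk (x := primeCompl y) ⟨m, n, b, hb⟩) = s.1 ⟨y, hV hy⟩ := by
    intro x hx
    obtain ⟨V₁, h₁, hx₁, m, f, b, hf, hb, e⟩ := mem_tildeSections_iff.1 s.2 x hx
    rw [zero_add, mem_coordGrading_piece] at hf
    refine ⟨V₁, h₁, hx₁, m, ⟨f, hf⟩, ⟨b, hb⟩, fun y hy => ?_⟩
    obtain ⟨hb', e⟩ := e y hy
    exact ⟨hb', (HomogeneousLocalization.val_mk _).trans e.symm⟩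
  have hex : ∀ x : V, ∃ u : HomogeneousLocalization
      (MvPolynomial.homogeneousSubmodule (Fin r) k) (primeCompl x.1),
      u.val = s.1 x := by
    intro x
    obtain ⟨V', hV, hx, m, n, b, h⟩ := key x.1 x.2
    obtain ⟨hb, e⟩ := h x.1 hx
    exact ⟨_, e⟩
  have hex' : ∀ x : V, (hex x).choose.val = s.1 x := fun x => (hex x).choose_spec
  refine ⟨⟨fun x => (hex x).choose, fun x => ?_⟩, hex'⟩
  obtain ⟨V', hV, hx, m, n, b, h⟩ := key x.1 x.2
  refine ⟨V', hx, homOfLE hV, m, n, b, fun y => (h y.1 y.2).choose, fun y => ?_⟩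
  refine HomogeneousLocalization.val_injective _ ?_
  exact (hex' ⟨y.1, hV y.2⟩).trans (h y.1 y.2).choose_spec.symm

end Pairing

/-! ### Local dual bases and the sections representing functionals. -/

section DualTwist

variable {k : Type u} [Field k] {r : ℕ}
variable {P : Type u} [AddCommGroup P] [Module (Coord k r) P]
variable {Q : Type u} [AddCommGroup Q] [Module (Coord k r) Q]
variable {GP : Grading k r P} {GQ : Grading k r Q}
variable {B : P →ₗ[Coord k r] Q →ₗ[Coord k r] Coord k r} {a : ℕ}

/-- Locally on projective space, the pairing `B` admits homogeneous dual bases. -/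
def HasDualBases (GP : Grading k r P) (GQ : Grading k r Q)
    (B : P →ₗ[Coord k r] Q →ₗ[Coord k r] Coord k r) (a : ℕ) : Prop :=
  ∀ x : PSpace k r, ∃ (β : ℕ) (b : Coord k r) (ι : Type) (_ : Fintype ι) (p : ι → P) (q : ι → Q)
    (e : ι → ℕ), b ∈ MvPolynomial.homogeneousSubmodule (Fin r) k β ∧ b ∈ primeCompl x ∧
    (∀ i, p i ∈ GP.piece (β + a - e i)) ∧ (∀ i, q i ∈ GQ.piece (e i)) ∧
    (∀ z, b • z = ∑ i, B (p i) z • q i) ∧ ∀ z, b • z = ∑ i, B z (q i) • p i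

/-- The value at `x` of a functional on `Q̃` defined near `x`, applied to a section. -/
def evalDual {U : (PSpace k r).Opens} (φ : dualSections (tilde GQ 0) U) {V : (PSpace k r).Opens}
    (hV : V ≤ U) (v : tildeSections GQ 0 V) (x : V) : Localization (primeCompl x.1) :=
  evalAt (φ.1 ⟨V, hV⟩ v) x

/-- Restriction of sections of `Ñ(j)`. -/
def resSection {N : Type u} [AddCommGroup N] [Module (Coord k r) N] {G : Grading k r N} {j : ℤ}
    {U V : (PSpace k r).Opens} (h : V ≤ U) (s : tildeSections G j U) : tildeSections G j V :=
  ⟨fun x => s.1 ⟨x.1, h x.2⟩, (isLocFrac G j).res (homOfLE h) _ s.2⟩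

theorem evalDual_res {U : (PSpace k r).Opens} (φ : dualSections (tilde GQ 0) U)
    {V W : (PSpace k r).Opens} (hV : V ≤ U) (h : W ≤ V) (v : tildeSections GQ 0 V) (x : W) :
    evalDual φ (h.trans hV) (resSection h v) x = evalDual φ hV v ⟨x.1, h x.2⟩ :=
  congrArg (fun f => evalAt f x) (φ.2 ⟨V, hV⟩ ⟨W, h.trans hV⟩ h v)

theorem evalDual_sum_smul {U : (PSpace k r).Opens} (φ : dualSections (tilde GQ 0) U)
    {V : (PSpace k r).Opens} (hV : V ≤ U) {ι : Type} [Fintype ι] (f : ι → Γ(PSpace k r, V))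
    (v : ι → tildeSections GQ 0 V) (x : V) :
    evalDual φ hV (∑ i, f i • v i) x = ∑ i, evalAt (f i) x * evalDual φ hV (v i) x := by
  have h : φ.1 ⟨V, hV⟩ (∑ i, f i • v i : tildeSections GQ 0 V) =
      ∑ i, f i * φ.1 ⟨V, hV⟩ (v i) := by
    refine (map_sum (φ.1 ⟨V, hV⟩) (fun i => f i • v i) Finset.univ).trans ?_
    exact Finset.sum_congr rfl fun i _ => map_smul (φ.1 ⟨V, hV⟩) (f i) (v i)
  refine (congrArg (fun f => evalAt f x) h).trans ?_
  rw [evalAt_sum]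
  exact Finset.sum_congr rfl fun i _ => evalAt_mul _ _ _

/-- `t` represents the functional `v ↦ φ(v) s` at the point `x`. -/
def Represents (B : P →ₗ[Coord k r] Q →ₗ[Coord k r] Coord k r) {j : ℤ} {U : (PSpace k r).Opens}
    (φ : dualSections (tilde GQ 0) U) (s : tildeSections (coordGrading k r) j U) (x : U)
    (t : LocAt P x.1) : Prop :=
  ∀ (V : (PSpace k r).Opens) (hV : V ≤ U) (hx : x.1 ∈ V) (v : tildeSections GQ 0 V),
    locPairing B x.1 t (v.1 ⟨x.1, hx⟩) =
      (evalDual φ hV v ⟨x.1, hx⟩ • (s.1 x : Localization (primeCompl x.1)))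

/-- Testing the difference `z / c` on the local sections `q i / X_l ^ e i` shows that each `B z (q
i)` dies at `x`. Then `b • z = ∑ B z (q i) • p i` dies too, with `b` invertible at `x`. -/
theorem locAt_ext (hD : HasDualBases GP GQ B a) {U : (PSpace k r).Opens} (x : U)
    {t t' : LocAt P x.1} (h : ∀ (V : (PSpace k r).Opens) (_ : V ≤ U) (hx : x.1 ∈ V)
      (v : tildeSections GQ 0 V), locPairing B x.1 t (v.1 ⟨x.1, hx⟩) =
        locPairing B x.1 t' (v.1 ⟨x.1, hx⟩)) : t = t' := by
  rw [← sub_eq_zero]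
  have h0 : ∀ (V : (PSpace k r).Opens) (_ : V ≤ U) (hx : x.1 ∈ V)
      (v : tildeSections GQ 0 V), locPairing B x.1 (t - t') (v.1 ⟨x.1, hx⟩) = 0 := by
    intro V hV hx v
    rw [map_sub, LinearMap.sub_apply, h V hV hx v, sub_self]
  generalize t - t' = w at h0
  obtain ⟨β, b, ι, _, p, q, e, hb, hbx, hp, hq, -, hz⟩ := hD x.1
  obtain ⟨l, hl⟩ := exists_X_mem_primeCompl x.1
  induction w using LocalizedModule.induction_on with
  | _ z c =>
  have h1 : ∀ i, LocalizedModule.mk (B z (q i)) c = (0 : LocAt (Coord k r) x.1) := by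
    intro i
    have hle : U ⊓ nonVanishing (MvPolynomial.X l) ≤ U := inf_le_left
    have hX : ∀ y : (U ⊓ nonVanishing (MvPolynomial.X l) : (PSpace k r).Opens),
        (MvPolynomial.X l : Coord k r) ^ e i ∈ primeCompl y.1 :=
      fun y => Submonoid.pow_mem _ y.2.2 _
    have := h0 _ hle ⟨x.2, hl⟩ (fracSection GQ 0 (m := e i) (q i) (MvPolynomial.X l ^ e i)
      (by rw [zero_add]; exact hq i) (MvPolynomial.isHomogeneous_X_pow _ _) hX)
    have h2 := (locPairing_mk B x.1 z (q i) c ⟨_, Submonoid.pow_mem _ hl (e i)⟩).symm.trans this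
    obtain ⟨d, hd, h3⟩ := (mk_eq_zero_iff _ _).1 h2
    exact (mk_eq_zero_iff _ _).2 ⟨d, hd, h3⟩
  have h2 : ∀ i, ∃ d ∈ primeCompl x.1, d • B z (q i) = 0 := fun i => (mk_eq_zero_iff _ _).1 (h1 i)
  choose d hd hd' using h2
  refine (mk_eq_zero_iff _ _).2 ⟨(∏ i, d i) * b, Submonoid.mul_mem _
    (Submonoid.prod_mem _ fun i _ => hd i) hbx, ?_⟩
  classical
  rw [mul_smul, hz, Finset.smul_sum]
  refine Finset.sum_eq_zero fun i _ => ?_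
  rw [← Finset.prod_erase_mul _ _ (Finset.mem_univ i), ← smul_assoc, mul_smul, hd', smul_zero,
    zero_smul]

theorem Represents.unique (hD : HasDualBases GP GQ B a) {j : ℤ} {U : (PSpace k r).Opens}
    {φ : dualSections (tilde GQ 0) U} {s : tildeSections (coordGrading k r) j U} {x : U}
    {t t' : LocAt P x.1} (h : Represents B φ s x t) (h' : Represents B φ s x t') : t = t' :=
  locAt_ext hD x fun V hV hx v => (h V hV hx v).trans (h' V hV hx v).symm

/-- The functional commutes with restriction, so arbitrarily small neighbourhoods suffice for
testing. -/
theorem represents_of_le {j : ℤ} {U V₀ : (PSpace k r).Opens} (hV₀ : V₀ ≤ U)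
    {φ : dualSections (tilde GQ 0) U} {s : tildeSections (coordGrading k r) j U} {x : U}
    (hx₀ : x.1 ∈ V₀) {t : LocAt P x.1}
    (h : ∀ (V : (PSpace k r).Opens) (hV : V ≤ V₀) (hx : x.1 ∈ V) (v : tildeSections GQ 0 V),
    locPairing B x.1 t (v.1 ⟨x.1, hx⟩) =
      (evalDual φ (hV.trans hV₀) v ⟨x.1, hx⟩ • (s.1 x : Localization (primeCompl x.1)))) :
    Represents B φ s x t := by
  intro V hV hx v
  have := h (V ⊓ V₀) inf_le_right ⟨hx, hx₀⟩ (resSection inf_le_left v)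
  rw [← evalDual_res φ hV inf_le_left v ⟨x.1, ⟨hx, hx₀⟩⟩]
  exact this

theorem coe_sum_apply {N : Type u} [AddCommGroup N] [Module (Coord k r) N] {G : Grading k r N}
    {j : ℤ} {V : (PSpace k r).Opens} {ι : Type} [Fintype ι] (s : ι → tildeSections G j V) (y : V) :
    (∑ i, s i : tildeSections G j V).1 y = ∑ i, (s i).1 y :=
  (congrFun (AddSubmonoidClass.coe_finsetSum _ _) y).trans (Finset.sum_apply ..)

theorem mk_sum {x : PSpace k r} {N : Type u} [AddCommGroup N] [Module (Coord k r) N] {ι : Type}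
    [Fintype ι] (n : ι → N) (c : primeCompl x) :
    (LocalizedModule.mk (∑ i, n i) c : LocAt N x) = ∑ i, LocalizedModule.mk (n i) c :=
  map_sum (⟨⟨fun n => LocalizedModule.mk n c, LocalizedModule.zero_mk c⟩,
    fun _ _ => OreLocalization.add_oreDiv.symm⟩ : N →+ LocAt N x) n Finset.univ

theorem eq_sum_locPairing_smul {ι : Type} [Fintype ι] {p : ι → P} {q : ι → Q} {b : Coord k r}
    (hz : ∀ z, b • z = ∑ i, B (p i) z • q i) (x : PSpace k r) (z : LocAt Q x) (c : ι → Coord k r)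
    (hc : ∀ i, c i ∈ primeCompl x) (hb : b ∈ primeCompl x) :
    z = ∑ i, (locPairing B x (LocalizedModule.mk (c i • p i) ⟨b, hb⟩) z :
      Localization (primeCompl x)) • (LocalizedModule.mk (q i) ⟨c i, hc i⟩ : LocAt Q x) := by
  induction z using LocalizedModule.induction_on with
  | _ n d =>
  have h : ∀ i, (locPairing B x (LocalizedModule.mk (c i • p i) ⟨b, hb⟩) (LocalizedModule.mk n d) :
      Localization (primeCompl x)) • (LocalizedModule.mk (q i) ⟨c i, hc i⟩ : LocAt Q x) =
      LocalizedModule.mk (B (p i) n • q i) (d * ⟨b, hb⟩) := by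
    intro i
    rw [locPairing_mk]
    refine (LocalizedModule.mk_smul_mk ..).trans ?_
    rw [map_smul, LinearMap.smul_apply, smul_eq_mul, mul_smul, LocalizedModule.mk_eq]
    refine ⟨1, ?_⟩
    simp only [one_smul, Submonoid.smul_def, Submonoid.coe_mul, smul_smul]
    congr 1
    ring
  rw [Finset.sum_congr rfl fun i _ => h i, ← mk_sum, ← hz]
  obtain ⟨d, hd⟩ := d
  exact mk_eq_mk_smul n hd hb

/-- Near `x` the sections `v i = q i / X_l ^ e i` of `Q̃` and `w i = X_l ^ e i p i / b` of `P̃(a)`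
are dual in the sense that `z = ∑ B(w i, z) v i`. Hence `t = ∑ φ(v i) s w i` satisfies `B(t, z) =
φ(z) s`. -/
theorem exists_represents (hB : IsGradedPairing GP GQ B a) (hD : HasDualBases GP GQ B a)
    {U : (PSpace k r).Opens} (φ : dualSections (tilde GQ 0) U)
    (s : tildeSections (coordGrading k r) (-a) U) (x : PSpace k r) (hx : x ∈ U) :
    ∃ (V : (PSpace k r).Opens) (hV : V ≤ U), x ∈ V ∧ ∃ t : tildeSections GP 0 V,
      ∀ y : V, Represents B φ s ⟨y.1, hV y.2⟩ (t.1 y) := by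
  obtain ⟨β, b, ι, _, p, q, e, hb, hbx, hp, hq, hz, -⟩ := hD x
  obtain ⟨l, hl⟩ := exists_X_mem_primeCompl x
  let V₀ : (PSpace k r).Opens := U ⊓ (nonVanishing b ⊓ nonVanishing (MvPolynomial.X l))
  have hV₀ : V₀ ≤ U := inf_le_left
  have hX : ∀ i, ∀ y : V₀, (MvPolynomial.X l : Coord k r) ^ e i ∈ primeCompl y.1 :=
    fun i y => Submonoid.pow_mem _ y.2.2.2 _
  have hb' : ∀ y : V₀, b ∈ primeCompl y.1 := fun y => y.2.2.1
  let v : ι → tildeSections GQ 0 V₀ := fun i =>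
    fracSection GQ 0 (m := e i) (q i) (MvPolynomial.X l ^ e i)
      (by rw [zero_add]; exact hq i) (MvPolynomial.isHomogeneous_X_pow _ _) (hX i)
  let w : ι → tildeSections GP a V₀ := fun i =>
    fracSection GP a (m := β) ((MvPolynomial.X l ^ e i : Coord k r) • p i) b (by
      -- The numerator has degree `e i + (β + a - e i) = β + a`, so the fraction has degree `a`,
      -- which the factor `s` of degree `-a` brings back to `0`.
      have := GP.smul_mem (MvPolynomial.isHomogeneous_X_pow l (e i)) (hp i)
      rwa [show (β : ℤ) + a - e i + e i = a + β by ring] at this) hb hb'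
  let t : tildeSections GP 0 V₀ := ∑ i, φ.1 ⟨V₀, hV₀⟩ (v i) •
    (⟨_, smul_mem_tildeSections (neg_add_cancel (a : ℤ)) (resSection hV₀ s) (w i)⟩ :
      tildeSections GP 0 V₀)
  have ht : ∀ y : V₀, t.1 y = ∑ i, evalDual φ hV₀ (v i) y •
      (s.1 ⟨y.1, hV₀ y.2⟩ : Localization (primeCompl y.1)) • (w i).1 y := by
    intro y
    exact coe_sum_apply _ y
  refine ⟨V₀, hV₀, ⟨hx, hbx, hl⟩, t, fun y => represents_of_le hV₀ y.2 fun V hV hy z => ?_⟩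
  have hg : ∀ i, ∃ g : Γ(PSpace k r, V), ∀ y' : V, evalAt g y' =
      locPairing B y'.1 ((w i).1 ⟨y'.1, hV y'.2⟩) (z.1 y') := fun i =>
    exists_evalAt_eq ⟨_, locPairing_mem_tildeSections hB (by ring : (a : ℤ) + 0 - a = 0)
      (resSection hV (w i)) z⟩
  choose g hg using hg
  have hsum : z = ∑ i, g i • resSection hV (v i) := by
    refine Subtype.ext (funext fun y => ?_)
    rw [coe_sum_apply]
    change z.1 y = ∑ i, evalAt (g i) y • (v i).1 ⟨y.1, hV y.2⟩
    simp only [hg]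
    exact eq_sum_locPairing_smul hz y.1 (z.1 y) _ (fun i => hX i ⟨y.1, hV y.2⟩) _
  have h1 := evalDual_sum_smul φ (hV.trans hV₀) g (fun i => resSection hV (v i)) ⟨y.1, hy⟩
  rw [← hsum] at h1
  rw [ht, map_sum, LinearMap.sum_apply, h1, Finset.sum_smul]
  refine Finset.sum_congr rfl fun i _ => ?_
  rw [evalDual_res φ hV₀ hV, hg, map_smul, map_smul, LinearMap.smul_apply, LinearMap.smul_apply]
  have hc : ∀ u v w : Localization (primeCompl y.1), u * (v * w) = (w * u) * v := fun u v w => by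
    ring
  exact hc _ _ _

end DualTwist

/-! ### The isomorphism with the twisted dual. -/

section DualTwist

variable {k : Type u} [Field k] {r : ℕ}
variable {P : Type u} [AddCommGroup P] [Module (Coord k r) P]
variable {Q : Type u} [AddCommGroup Q] [Module (Coord k r) Q]
variable {GP : Grading k r P} {GQ : Grading k r Q}
variable {B : P →ₗ[Coord k r] Q →ₗ[Coord k r] Coord k r} {a : ℕ}

theorem Represents.res {j : ℤ} {U V : (PSpace k r).Opens} (h : V ≤ U)
    {φ : dualSections (tilde GQ 0) U} {s : tildeSections (coordGrading k r) j U} {x : V}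
    {t : LocAt P x.1} (ht : Represents B φ s ⟨x.1, h x.2⟩ t) :
    Represents B (j := j) ((dualAb (tilde GQ 0)).map (homOfLE h).op φ) (resSection h s) x t :=
  fun W hW hx v => ht W (hW.trans h) hx v

/-- Uniqueness of the representing germ lets the local solutions glue. -/
theorem exists_section_represents (hB : IsGradedPairing GP GQ B a) (hD : HasDualBases GP GQ B a)
    {U : (PSpace k r).Opens} (φ : dualSections (tilde GQ 0) U)
    (s : tildeSections (coordGrading k r) (-a) U) :
    ∃ t : tildeSections GP 0 U, ∀ x : U, Represents B φ s x (t.1 x) := by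
  have hex : ∀ x : U, ∃ t : LocAt P x.1, Represents B φ s x t := fun x => by
    obtain ⟨V, hV, hx, t, ht⟩ := exists_represents hB hD φ s x.1 x.2
    exact ⟨t.1 ⟨x.1, hx⟩, ht ⟨x.1, hx⟩⟩
  have hex' : ∀ x : U, Represents B φ s x (hex x).choose := fun x => (hex x).choose_spec
  refine ⟨⟨fun x => (hex x).choose, mem_tildeSections_iff.2 fun x hx => ?_⟩, hex'⟩
  obtain ⟨V, hV, hxV, t, ht⟩ := exists_represents hB hD φ s x hx
  obtain ⟨W, hW, hxW, m, n, b, hn, hb, h⟩ := mem_tildeSections_iff.1 t.2 x hxV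
  refine ⟨W, hW.trans hV, hxW, m, n, b, hn, hb, fun y hy => ?_⟩
  obtain ⟨hb', e⟩ := h y hy
  have h1 := ht ⟨y, hW hy⟩
  exact ⟨hb', ((hex' ⟨y, hV (hW hy)⟩).unique hD h1).trans e⟩

/-- The section of `P̃` representing `v ↦ φ(v) s`. -/
def dualMulFun (hB : IsGradedPairing GP GQ B a) (hD : HasDualBases GP GQ B a)
    {U : (PSpace k r).Opens} (φ : dualSections (tilde GQ 0) U)
    (s : tildeSections (coordGrading k r) (-a) U) : tildeSections GP 0 U :=
  (exists_section_represents hB hD φ s).choose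

theorem dualMulFun_represents (hB : IsGradedPairing GP GQ B a) (hD : HasDualBases GP GQ B a)
    {U : (PSpace k r).Opens} (φ : dualSections (tilde GQ 0) U)
    (s : tildeSections (coordGrading k r) (-a) U) (x : U) :
    Represents B φ s x ((dualMulFun hB hD φ s).1 x) :=
  (exists_section_represents hB hD φ s).choose_spec x

theorem dualMulFun_eq (hB : IsGradedPairing GP GQ B a) (hD : HasDualBases GP GQ B a)
    {U : (PSpace k r).Opens} {φ : dualSections (tilde GQ 0) U}
    {s : tildeSections (coordGrading k r) (-a) U} {t : tildeSections GP 0 U}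
    (h : ∀ x : U, Represents B φ s x (t.1 x)) : dualMulFun hB hD φ s = t :=
  Subtype.ext (funext fun x => (dualMulFun_represents hB hD φ s x).unique hD (h x))

theorem evalDual_add {U : (PSpace k r).Opens} (φ φ' : dualSections (tilde GQ 0) U)
    {V : (PSpace k r).Opens} (hV : V ≤ U) (v : tildeSections GQ 0 V) (x : V) :
    evalDual (φ + φ') hV v x = evalDual φ hV v x + evalDual φ' hV v x := evalAt_add _ _ _

theorem evalDual_smul {U : (PSpace k r).Opens} (f : Γ(PSpace k r, U))
    (φ : dualSections (tilde GQ 0) U)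
    {V : (PSpace k r).Opens} (hV : V ≤ U) (v : tildeSections GQ 0 V) (x : V) :
    evalDual (f • φ) hV v x = evalAt f ⟨x.1, hV x.2⟩ * evalDual φ hV v x := evalAt_mul _ _ _

/-- The section of `P̃` representing `v ↦ φ(v) s`, as a bilinear map. -/
def dualMul (hB : IsGradedPairing GP GQ B a) (hD : HasDualBases GP GQ B a)
    (U : (PSpace k r).Opens) :
    dualSections (tilde GQ 0) U →ₗ[Γ(PSpace k r, U)] tildeSections (coordGrading k r) (-a) U
      →ₗ[Γ(PSpace k r, U)] tildeSections GP 0 U :=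
  LinearMap.mk₂ _ (dualMulFun hB hD)
    (fun φ φ' s => dualMulFun_eq hB hD fun x V hV hx v => by
      have h1 := dualMulFun_represents hB hD φ s x V hV hx v
      have h2 := dualMulFun_represents hB hD φ' s x V hV hx v
      rw [evalDual_add, add_smul, ← h1, ← h2, ← LinearMap.add_apply, ← map_add]
      rfl)
    (fun f φ s => dualMulFun_eq hB hD fun x V hV hx v => by
      have h1 := dualMulFun_represents hB hD φ s x V hV hx v
      rw [evalDual_smul, mul_smul, ← h1, ← LinearMap.smul_apply, ← map_smul]
      rfl)
    (fun φ s s' => dualMulFun_eq hB hD fun x V hV hx v => by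
      have h1 := dualMulFun_represents hB hD φ s x V hV hx v
      have h2 := dualMulFun_represents hB hD φ s' x V hV hx v
      refine Eq.trans ?_ (smul_add _ _ _).symm
      rw [← h1, ← h2, ← LinearMap.add_apply, ← map_add]
      rfl)
    (fun f φ s => dualMulFun_eq hB hD fun x V hV hx v => by
      have h1 := dualMulFun_represents hB hD φ s x V hV hx v
      refine Eq.trans ?_ (smul_comm (evalAt f x) (evalDual φ hV v ⟨x.1, hx⟩)
        (s.1 x : Localization (primeCompl x.1)))
      rw [← h1, ← LinearMap.smul_apply, ← map_smul]
      rfl)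

theorem dualMul_smul_right (hB : IsGradedPairing GP GQ B a) (hD : HasDualBases GP GQ B a)
    {U : (PSpace k r).Opens} (f : Γ(PSpace k r, U)) (φ : dualSections (tilde GQ 0) U)
    (s : tildeSections (coordGrading k r) (-a) U) :
    dualMul hB hD U φ (f • s) = f • dualMul hB hD U φ s :=
  map_smul (dualMul hB hD U φ) f s

theorem dualMul_res (hB : IsGradedPairing GP GQ B a) (hD : HasDualBases GP GQ B a)
    {U V : (PSpace k r).Opens} (h : V ≤ U) (φ : dualSections (tilde GQ 0) U)
    (s : tildeSections (coordGrading k r) (-a) U) :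
    dualMul hB hD V ((dualAb (tilde GQ 0)).map (homOfLE h).op φ) (resSection h s) =
      resSection h (dualMul hB hD U φ s) :=
  dualMulFun_eq hB hD fun x => (dualMulFun_represents hB hD φ s ⟨x.1, h x.2⟩).res h

/-- The morphism of presheaves of modules from the presheaf tensor product to `P̃`. -/
def dualMulHom (hB : IsGradedPairing GP GQ B a) (hD : HasDualBases GP GQ B a) :
    PresheafOfModules.Monoidal.tensorObj (R := (PSpace k r).presheaf)
      (dualSheaf (tilde GQ 0)).val (serreSheaf k r (-a)).val ⟶ (tilde GP 0).val where
  app U := ModuleCat.MonoidalCategory.tensorLift (R := (PSpace k r).presheaf.obj U)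
    (M₁ := (dualSheaf (tilde GQ 0)).val.obj U) (M₂ := (serreSheaf k r (-a)).val.obj U)
    (M₃ := (tilde GP 0).val.obj U) (fun φ s => dualMul hB hD U.unop φ s)
    (fun φ φ' s => LinearMap.map_add₂ (dualMul hB hD U.unop) φ φ' s)
    (fun f φ s => LinearMap.map_smul₂ (dualMul hB hD U.unop) f φ s)
    (fun φ s s' => map_add (dualMul hB hD U.unop φ) s s')
    (fun f φ s => dualMul_smul_right hB hD f φ s)
  naturality {U V} i := ModuleCat.MonoidalCategory.tensor_ext fun φ s => by
    exact dualMul_res hB hD i.unop.le φ s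

/-- Restriction of sections of the presheaf tensor product. -/
def tensorRes (U V : (PSpace k r).Opens) (h : V ≤ U) :
    TensorProduct Γ(PSpace k r, U) (dualSections (tilde GQ 0) U)
      (tildeSections (coordGrading k r) (-a) U) →+
    TensorProduct Γ(PSpace k r, V) (dualSections (tilde GQ 0) V)
      (tildeSections (coordGrading k r) (-a) V) :=
  ((PresheafOfModules.Monoidal.tensorObj (R := (PSpace k r).presheaf)
    (dualSheaf (tilde GQ 0)).val (serreSheaf k r (-a)).val).presheaf.map (homOfLE h).op).hom

/-- Where `𝒪(-a)` is generated by `σ`, coefficients can be moved across the tensor sign, so every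
tensor collapses to a pure one. -/
theorem exists_res_eq_tmul (U V : (PSpace k r).Opens) (h : V ≤ U)
    (σ : tildeSections (coordGrading k r) (-a) V)
    (hσ : ∀ s : tildeSections (coordGrading k r) (-a) V, ∃ f : Γ(PSpace k r, V), s = f • σ)
    (τ : TensorProduct Γ(PSpace k r, U) (dualSections (tilde GQ 0) U)
      (tildeSections (coordGrading k r) (-a) U)) :
    ∃ φ : dualSections (tilde GQ 0) V,
      tensorRes U V h τ = (φ ⊗ₜ[Γ(PSpace k r, V)] σ : TensorProduct Γ(PSpace k r, V) (dualSections (tilde GQ 0) V)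
        (tildeSections (coordGrading k r) (-a) V)) := by
  induction τ using TensorProduct.induction_on with
  | zero =>
    refine ⟨0, ?_⟩
    exact (AddMonoidHom.map_zero (tensorRes U V h)).trans (TensorProduct.zero_tmul _ _).symm
  | add y z hy hz =>
    obtain ⟨φ, hφ⟩ := hy
    obtain ⟨φ', hφ'⟩ := hz
    refine ⟨φ + φ', ?_⟩
    exact (AddMonoidHom.map_add (tensorRes U V h) y z).trans
      ((congrArg₂ (· + ·) hφ hφ').trans (TensorProduct.add_tmul _ _ _).symm)
  | tmul φ s =>
    obtain ⟨f, hf⟩ := hσ (resSection h s)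
    let φ' : dualSections (tilde GQ 0) V := (dualAb (tilde GQ 0)).map (homOfLE h).op φ
    refine ⟨f • φ', ?_⟩
    rw [TensorProduct.smul_tmul, ← hf]
    rfl

/-- Where `X_l` does not vanish, `σ = 1 / X_l ^ a` trivializes `𝒪(-a)`, with inverse the section
`X_l ^ a` of `𝒪(a)`. -/
theorem exists_generator (l : Fin r) (a : ℕ) (V : (PSpace k r).Opens)
    (hV : V ≤ nonVanishing (MvPolynomial.X l)) :
    ∃ σ : tildeSections (coordGrading k r) (-a) V,
      (∀ x : V, IsUnit (σ.1 x : Localization (primeCompl x.1))) ∧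
      ∀ (N : Type u) [AddCommGroup N] [Module (Coord k r) N] (G : Grading k r N)
        (W : (PSpace k r).Opens) (_ : W ≤ V) (t : tildeSections G (-a) W),
        ∃ f : tildeSections G 0 W, ∀ x (hx : x ∈ W) (hx' : x ∈ V),
        t.1 ⟨x, hx⟩ = (σ.1 ⟨x, hx'⟩ : Localization (primeCompl x)) • f.1 ⟨x, hx⟩ := by
  have hX : ∀ x : V, (MvPolynomial.X l : Coord k r) ^ a ∈ primeCompl x.1 :=
    fun x => Submonoid.pow_mem _ (hV x.2) _
  let σ : tildeSections (coordGrading k r) (-a) V :=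
    fracSection (coordGrading k r) (-a) (m := a) 1 (MvPolynomial.X l ^ a)
      (Or.inr ⟨0, by simp, MvPolynomial.isHomogeneous_one _ _⟩)
      (MvPolynomial.isHomogeneous_X_pow _ _) hX
  let σ' : tildeSections (coordGrading k r) a V :=
    fracSection (coordGrading k r) a (m := 0) (MvPolynomial.X l ^ a) 1
      (Or.inr ⟨a, by simp, MvPolynomial.isHomogeneous_X_pow _ _⟩)
      (MvPolynomial.isHomogeneous_one _ _) fun _ => Submonoid.one_mem _
  have h1 : ∀ x : V, (σ.1 x : Localization (primeCompl x.1)) * σ'.1 x = 1 := fun x => by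
    refine (LocalizedModule.mk_smul_mk (1 : Coord k r) _ _ _).trans ?_
    refine Eq.trans ?_ OreLocalization.one_def.symm
    rw [LocalizedModule.mk_eq]
    exact ⟨1, by simp [Submonoid.smul_def]⟩
  refine ⟨σ, fun x => IsUnit.of_mul_eq_one _ (h1 x), fun N _ _ G W hW t =>
    ⟨⟨_, smul_mem_tildeSections (add_neg_cancel (a : ℤ)) (resSection hW σ') t⟩,
      fun x hx hx' => ?_⟩⟩
  change t.1 ⟨x, hx⟩ = (σ.1 ⟨x, hx'⟩ : Localization (primeCompl x)) •
    (σ'.1 ⟨x, hx'⟩ : Localization (primeCompl x)) • t.1 ⟨x, hx⟩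
  rw [smul_smul, h1, one_smul]

/-- The functional is `v ↦ B(t, v) / σ`; since `σ` is a unit at each point, the quotient is unique,
hence linear and compatible with restriction. -/
theorem exists_functional (hB : IsGradedPairing GP GQ B a) (V : (PSpace k r).Opens)
    (σ : tildeSections (coordGrading k r) (-a) V)
    (hσ : ∀ x : V, IsUnit (σ.1 x : Localization (primeCompl x.1)))
    (hσ' : ∀ W ≤ V, ∀ s : tildeSections (coordGrading k r) (-a) W,
      ∃ f : tildeSections (coordGrading k r) 0 W,
      ∀ x (hx : x ∈ W) (hx' : x ∈ V), s.1 ⟨x, hx⟩ =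
        (σ.1 ⟨x, hx'⟩ : Localization (primeCompl x)) • f.1 ⟨x, hx⟩)
    (t : tildeSections GP 0 V) :
    ∃ φ : dualSections (tilde GQ 0) V, ∀ x, Represents B φ σ x (t.1 x) := by
  have key : ∀ (W : (PSpace k r).Opens) (hW : W ≤ V) (v : tildeSections GQ 0 W),
      ∃ f : Γ(PSpace k r, W), ∀ x : W, locPairing B x.1 (t.1 ⟨x.1, hW x.2⟩) (v.1 x) =
        evalAt f x • (σ.1 ⟨x.1, hW x.2⟩ : Localization (primeCompl x.1)) := by
    intro W hW v
    obtain ⟨s, hs⟩ := hσ' W hW ⟨_, locPairing_mem_tildeSections hB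
      (by ring : (0 : ℤ) + 0 - a = -a) (resSection hW t) v⟩
    obtain ⟨f, hf⟩ := exists_evalAt_eq s
    refine ⟨f, fun x => (hs x.1 x.2 (hW x.2)).trans ?_⟩
    rw [hf]
    exact mul_comm (σ.1 ⟨x.1, hW x.2⟩ : Localization (primeCompl x.1)) _
  choose f hf using key
  have huniq : ∀ (W : (PSpace k r).Opens) (hW : W ≤ V) (v : tildeSections GQ 0 W)
      (g : Γ(PSpace k r, W)), (∀ x : W, locPairing B x.1 (t.1 ⟨x.1, hW x.2⟩) (v.1 x) =
        evalAt g x • (σ.1 ⟨x.1, hW x.2⟩ : Localization (primeCompl x.1))) → f W hW v = g := by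
    intro W hW v g hg
    refine evalAt_injective fun y => ?_
    exact (hσ ⟨y.1, hW y.2⟩).mul_left_injective ((hf W hW v y).symm.trans (hg y))
  refine ⟨⟨fun W => { toFun := f W.1 W.2, map_add' := fun v v' => ?_, map_smul' := fun c v => ?_ },
    fun W W' h v => ?_⟩, fun x W hW hx v => hf W hW v ⟨x.1, hx⟩⟩
  · refine huniq _ _ _ _ fun x => ?_
    rw [evalAt_add, add_smul]
    exact (map_add (locPairing B x.1 (t.1 ⟨x.1, W.2 x.2⟩)) _ _).trans
      (congrArg₂ (· + ·) (hf W.1 W.2 v x) (hf W.1 W.2 v' x))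
  · refine huniq _ _ _ _ fun x => ?_
    refine Eq.trans ?_ (congrArg (· • (σ.1 ⟨x.1, W.2 x.2⟩ : Localization (primeCompl x.1)))
      (evalAt_mul c (f W.1 W.2 v) x).symm)
    rw [mul_smul]
    exact (map_smul (locPairing B x.1 (t.1 ⟨x.1, W.2 x.2⟩)) _ _).trans
      (congrArg (evalAt c x • ·) (hf W.1 W.2 v x))
  · exact huniq _ _ _ _ fun x => hf W.1 W.2 v ⟨x.1, h x.2⟩

/-- Both checks are local, on an open set where some `X_l` is invertible. There a tensor is `φ ⊗ σ`;
if its image vanishes then `φ(v) σ = 0` for all `v`, so `φ = 0`. Conversely, any `t` is the image of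
the functional `B(t, ·) / σ` tensored with `σ`. -/
theorem nonempty_tilde_iso_serreTwist_dual (hB : IsGradedPairing GP GQ B a)
    (hD : HasDualBases GP GQ B a) :
    Nonempty (tilde GP 0 ≅ serreTwist (dualSheaf (tilde GQ 0)) (-a)) := by
  refine (nonempty_sheafification_iso _ _ (dualMulHom hB hD) ?_ ?_).map Iso.symm
  · intro U z hz x hx
    obtain ⟨l, hl⟩ := exists_X_mem_primeCompl x
    have hV : U ⊓ nonVanishing (MvPolynomial.X l) ≤ U := inf_le_left
    obtain ⟨σ, hσ, hσ'⟩ := exists_generator (k := k) l a (U ⊓ nonVanishing (MvPolynomial.X l))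
      inf_le_right
    refine ⟨_, hV, ⟨hx, hl⟩, ?_⟩
    obtain ⟨φ, hφ⟩ := exists_res_eq_tmul (GQ := GQ) U _ hV σ (fun s => by
      obtain ⟨f, hf⟩ := hσ' _ _ _ le_rfl s
      obtain ⟨g, hg⟩ := exists_evalAt_eq f
      refine ⟨g, Subtype.ext (funext fun y => (hf y.1 y.2 y.2).trans ?_)⟩
      rw [← hg]
      exact mul_comm _ _) z
    have h1 : dualMul hB hD _ φ σ = 0 := by
      have h1 := PresheafOfModules.naturality_apply (dualMulHom hB hD) (homOfLE hV).op z
      refine Eq.trans (congrArg ((dualMulHom hB hD).app (op (U ⊓ nonVanishing (MvPolynomial.X l))))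
        hφ.symm) (h1.trans ?_)
      exact (congrArg ((tilde GP 0).val.map (homOfLE hV).op) hz).trans (Subtype.ext rfl)
    have h2 : φ = 0 := by
      refine Subtype.ext (funext fun W => LinearMap.ext fun v => evalAt_injective fun y => ?_)
      have h3 := dualMulFun_represents hB hD φ σ ⟨y.1, W.2 y.2⟩ W.1 W.2 y.2 v
      have h4 : (dualMulFun hB hD φ σ).1 ⟨y.1, W.2 y.2⟩ = 0 :=
        congrFun (congrArg Subtype.val h1) ⟨y.1, W.2 y.2⟩
      rw [h4, map_zero, LinearMap.zero_apply] at h3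
      refine Eq.trans ?_ (evalAt_zero y).symm
      exact (hσ ⟨y.1, W.2 y.2⟩).mul_left_eq_zero.1 h3.symm
    rw [h2] at hφ
    exact hφ.trans (TensorProduct.zero_tmul _ _)
  · intro U z x hx
    obtain ⟨l, hl⟩ := exists_X_mem_primeCompl x
    have hV : U ⊓ nonVanishing (MvPolynomial.X l) ≤ U := inf_le_left
    obtain ⟨σ, hσ, hσ'⟩ := exists_generator (k := k) l a (U ⊓ nonVanishing (MvPolynomial.X l))
      inf_le_right
    obtain ⟨φ, hφ⟩ := exists_functional hB _ σ hσ
      (fun W hW s => hσ' _ _ W hW s) (resSection hV z)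
    exact ⟨_, hV, ⟨hx, hl⟩, (φ ⊗ₜ[Γ(PSpace k r, U ⊓ nonVanishing (MvPolynomial.X l))] σ :
      TensorProduct _ (dualSections (tilde GQ 0) _) (tildeSections (coordGrading k r) (-a) _)),
      dualMulFun_eq hB hD hφ⟩

end DualTwist

/-! ### Lifting a Jordan basis from the fibre at a point. -/

section Frames

/-- The index set of a Jordan basis with `μ l` blocks of length `l + 1`. -/
abbrev JordanIndex {p : ℕ} (μ : Fin p → ℕ) : Type := Σ l : Fin p, Fin (μ l) × Fin (l.1 + 1)

variable {R : Type*} [CommRing R] {N : Type*} [AddCommGroup N] [Module R N]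
variable {p : ℕ} {μ : Fin p → ℕ}

/-- The family `b` is permuted by `T` like a Jordan basis. -/
def IsJordanFamily (T : Module.End R N) (b : JordanIndex μ → N) : Prop :=
  ∀ (l : Fin p) (s : Fin (μ l)) (t : Fin (l.1 + 1)),
    T (b ⟨l, s, t⟩) = if h : t.1 + 1 < l.1 + 1 then b ⟨l, s, ⟨t.1 + 1, h⟩⟩ else 0

theorem IsJordanFamily.pow_apply {T : Module.End R N} {b : JordanIndex μ → N}
    (hb : IsJordanFamily T b) (m : ℕ) (l : Fin p) (s : Fin (μ l)) (t : Fin (l.1 + 1)) :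
    (T ^ m) (b ⟨l, s, t⟩) = if h : t.1 + m < l.1 + 1 then b ⟨l, s, ⟨t.1 + m, h⟩⟩ else 0 := by
  induction m with
  | zero => rw [dif_pos (by simpa using t.2)]; rfl
  | succ m ih =>
    rw [pow_succ', Module.End.mul_apply, ih]
    by_cases h : t.1 + m < l.1 + 1
    · rw [dif_pos h, hb]
      rfl
    · rw [dif_neg h, map_zero, dif_neg (by omega)]

theorem IsJordanFamily.pow_apply_sub {T : Module.End R N} {b : JordanIndex μ → N}
    (hb : IsJordanFamily T b) {m : ℕ} (i : JordanIndex μ) (h : m ≤ i.2.2.1) :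
    (T ^ m) (b ⟨i.1, i.2.1, ⟨i.2.2.1 - m, by omega⟩⟩) = b i := by
  rw [hb.pow_apply, dif_pos (by have := i.2.2.2; simp; omega)]
  congr 4
  exact Nat.sub_add_cancel h

/-- Over the fraction field the image of `T ^ m` lies in the span of the basis vectors in position
at least `m` of their block, since `T ^ m` shifts positions by `m`. This bounds the generic rank of
`θ ^ m`. -/
theorem card_le_of_linearIndependent_pow [IsDomain R] {F W : Type*} [Field F] [Algebra R F]
    [IsFractionRing R F] [AddCommGroup W] [Module F W] [Module R W] [IsScalarTower R F W]
    {red : N →ₗ[R] W} (hinj : Function.Injective red) {θ : Module.End R N} {T : Module.End F W}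
    (hT : ∀ n, red (θ n) = T (red n)) (b : Module.Basis (JordanIndex μ) F W)
    (hb : IsJordanFamily T b) (m : ℕ) {J : Type*} [Fintype J] {w : J → N}
    (hw : LinearIndependent R fun j => (θ ^ m) (w j)) :
    Fintype.card J ≤ Fintype.card {i : JordanIndex μ // m ≤ i.2.2.1} := by
  have hTm : ∀ m n, red ((θ ^ m) n) = (T ^ m) (red n) := fun m => by
    induction m with
    | zero => simp
    | succ m ih => intro n; simp only [pow_succ', Module.End.mul_apply, hT, ih]
  have h1 : LinearIndependent F fun j => (T ^ m) (red (w j)) := by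
    rw [← LinearIndependent.iff_fractionRing R F]
    have := hw.map' red (LinearMap.ker_eq_bot.2 hinj)
    simpa only [Function.comp_def, hTm] using this
  let S : Submodule F W := Submodule.span F (Set.range fun i : {i : JordanIndex μ // m ≤ i.2.2.1} => b i)
  have hS : ∀ z, (T ^ m) z ∈ S := fun z => by
    rw [← b.sum_repr z, map_sum]
    refine sum_mem fun i _ => ?_
    rw [map_smul]
    refine S.smul_mem _ ?_
    obtain ⟨l, s, t⟩ := i
    rw [hb.pow_apply]
    split_ifs with h
    · exact Submodule.subset_span ⟨⟨⟨l, s, ⟨t.1 + m, h⟩⟩, Nat.le_add_left _ _⟩, rfl⟩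
    · exact zero_mem _
  have h2 : LinearIndependent F fun j => (⟨_, hS (red (w j))⟩ : S) :=
    LinearIndependent.of_comp S.subtype h1
  have : Module.Finite F S := Module.Finite.span_of_finite F (Set.finite_range _)
  exact h2.fintype_card_le_finrank.trans (finrank_range_le_card _)

variable {κ V : Type*} [Field κ] [Algebra R κ] [AddCommGroup V] [Module κ V] [Module R V]
  [IsScalarTower R κ V]

/-- Cramer's rule: `Δ` is the determinant of the family `w`, and its dual family is given by the
adjugate matrix. The determinant survives in `κ` because `w` reduces to a rescaled basis. -/
theorem exists_dual_family {ι I : Type*} [Fintype ι] [Fintype I] [DecidableEq I]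
    (ε : Module.Basis ι R N) (ε' : Module.Basis ι κ V) {red : N →ₗ[R] V}
    (hred : ∀ i, red (ε i) = ε' i) (b : Module.Basis I κ V) {c : I → κ} (hc : ∀ i, c i ≠ 0)
    {w : I → N} (hw : ∀ i, red (w i) = c i • b i) :
    ∃ (Δ : R) (w' : I → N →ₗ[R] R), algebraMap R κ Δ ≠ 0 ∧
      (∀ i j, w' i (w j) = if i = j then Δ else 0) ∧ ∀ n, Δ • n = ∑ i, w' i n • w i := by
  let e : ι ≃ I := ε'.indexEquiv b
  let η := ε.reindex e
  let η' := ε'.reindex e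
  have hη : ∀ i, red (η i) = η' i := fun i => by simp [η, η', hred]
  have hrepr : ∀ n i, η'.repr (red n) i = algebraMap R κ (η.repr n i) := fun n i => by
    conv_lhs => rw [← η.sum_repr n]
    simp only [map_sum, map_smul, hη, Finsupp.coe_finsetSum, Finset.sum_apply]
    rw [Finset.sum_eq_single i]
    · rw [← IsScalarTower.algebraMap_smul κ (η.repr n i) (η' i), map_smul,
        Module.Basis.repr_self, Finsupp.smul_apply, Finsupp.single_eq_same, smul_eq_mul, mul_one]
    · intro j _ hj
      rw [← IsScalarTower.algebraMap_smul κ (η.repr n j) (η' j), map_smul,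
        Module.Basis.repr_self, Finsupp.smul_apply, Finsupp.single_eq_of_ne hj.symm, smul_zero]
    · simp
  let A : Matrix I I R := η.toMatrix w
  have hA : ∀ n, η.repr (∑ i, n i • w i) = A.mulVec n := fun n => by
    ext j
    simp [A, Matrix.mulVec, dotProduct, Module.Basis.toMatrix_apply, mul_comm]
  refine ⟨A.det, fun i => LinearMap.proj i ∘ₗ A.adjugate.mulVecLin ∘ₗ η.equivFun.toLinearMap,
    ?_, fun i j => ?_, fun n => ?_⟩
  · let b' := b.isUnitSMul fun i => (hc i).isUnit
    have h : (algebraMap R κ).mapMatrix A = η'.toMatrix b' := by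
      ext i j
      simp [A, b', Module.Basis.toMatrix_apply, ← hrepr, hw, Module.Basis.isUnitSMul_apply]
    rw [RingHom.map_det, h]
    have := η'.isUnit_det b'
    rw [Module.Basis.det_apply] at this
    exact this.ne_zero
  · have h : (η.repr (w j) : I → R) = A.mulVec (Pi.single j 1) := by
      ext i
      simp [A, Module.Basis.toMatrix_apply]
    change (A.adjugate.mulVec (η.repr (w j))) i = _
    rw [h, Matrix.mulVec_mulVec, Matrix.adjugate_mul, Matrix.smul_mulVec, Matrix.one_mulVec]
    simp [Pi.single_apply]
  · apply η.repr.injective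
    ext j
    have := congrFun (hA (A.adjugate.mulVec (η.repr n))) j
    refine Eq.trans ?_ this.symm
    rw [Matrix.mulVec_mulVec, Matrix.mul_adjugate, Matrix.smul_mulVec, Matrix.one_mulVec]
    simp

/-- Clear the denominators of the coordinates of `v`. -/
theorem exists_lift_smul {ι : Type*} [Fintype ι] (ε : Module.Basis ι R N)
    (ε' : Module.Basis ι κ V) {red : N →ₗ[R] V} (hred : ∀ i, red (ε i) = ε' i)
    (hfrac : ∀ z : ι → κ, ∃ (c : R) (y : ι → R), algebraMap R κ c ≠ 0 ∧
      ∀ i, algebraMap R κ (y i) = algebraMap R κ c * z i) (v : V) :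
    ∃ (c : R) (n : N), algebraMap R κ c ≠ 0 ∧ red n = algebraMap R κ c • v := by
  obtain ⟨c, y, hc, hy⟩ := hfrac (ε'.repr v)
  refine ⟨c, ∑ i, y i • ε i, hc, ?_⟩
  conv_rhs => rw [← ε'.sum_repr v]
  simp only [map_sum, map_smul, hred, Finset.smul_sum, smul_smul, ← hy]
  exact Finset.sum_congr rfl fun i _ => (IsScalarTower.algebraMap_smul κ _ _).symm

/-- A kernel vector of `T ^ m` lifts, up to a scalar, to a kernel vector of `θ ^ m`, provided the
rank of `θ ^ m` is that of `T ^ m`. -/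
theorem exists_kernel_lift [IsDomain R] {ι : Type*} [Fintype ι] (ε : Module.Basis ι R N)
    (ε' : Module.Basis ι κ V) {red : N →ₗ[R] V} (hred : ∀ i, red (ε i) = ε' i)
    (hfrac : ∀ z : ι → κ, ∃ (c : R) (y : ι → R), algebraMap R κ c ≠ 0 ∧
      ∀ i, algebraMap R κ (y i) = algebraMap R κ c * z i)
    {θ : Module.End R N} {T : Module.End κ V} (hT : ∀ n, red (θ n) = T (red n))
    (b : Module.Basis (JordanIndex μ) κ V) (hb : IsJordanFamily T b) (m : ℕ)
    (hrank : ∀ (w : Option {i : JordanIndex μ // m ≤ i.2.2.1} → N),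
      ¬ LinearIndependent R fun j => (θ ^ m) (w j)) {v : V} (hv : (T ^ m) v = 0) :
    ∃ (c : R) (n : N), algebraMap R κ c ≠ 0 ∧ red n = algebraMap R κ c • v ∧ (θ ^ m) n = 0 := by
  classical
  have hTm : ∀ n, red ((θ ^ m) n) = (T ^ m) (red n) := by
    clear hrank hv
    induction m with
    | zero => simp
    | succ m ih => intro n; simp only [pow_succ', Module.End.mul_apply, hT, ih]
  choose c n hc hn using fun i => exists_lift_smul ε ε' hred hfrac (b i)
  let sh : JordanIndex μ → JordanIndex μ := fun i => ⟨i.1, i.2.1, ⟨i.2.2.1 - m, by omega⟩⟩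
  -- Each Jordan vector in the image of `T ^ m` is lifted inside the image of `θ ^ m`, the others
  -- arbitrarily; `sh` moves back `m` positions and matters only where the truncated subtraction is
  -- exact.
  let w : JordanIndex μ → N := fun i => if m ≤ i.2.2.1 then (θ ^ m) (n (sh i)) else n i
  let d : JordanIndex μ → κ := fun i => if m ≤ i.2.2.1 then algebraMap R κ (c (sh i))
    else algebraMap R κ (c i)
  have hd : ∀ i, d i ≠ 0 := fun i => by
    by_cases h : m ≤ i.2.2.1
    · simp only [d, if_pos h]; exact hc _
    · simp only [d, if_neg h]; exact hc _
  have hw : ∀ i, red (w i) = d i • b i := fun i => by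
    by_cases h : m ≤ i.2.2.1
    · simp only [w, d, if_pos h]
      rw [hTm, hn, map_smul, hb.pow_apply_sub i h]
    · simp only [w, d, if_neg h]
      exact hn i
  obtain ⟨Δ, w', hΔ, hw', hex⟩ := exists_dual_family ε ε' hred b hd hw
  have hΔ0 : Δ ≠ 0 := fun h => hΔ (by rw [h, map_zero])
  obtain ⟨c₀, n₀, hc₀, hn₀⟩ := exists_lift_smul ε ε' hred hfrac v
  -- The lifts in the image of `θ ^ m` already attain the maximal rank. A nonzero coordinate outside
  -- them would make `θ ^ m n₀` one more independent vector.
  have hz : ∀ i, ¬ m ≤ i.2.2.1 → w' i ((θ ^ m) n₀) = 0 := fun i hi => by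
    by_contra hne
    refine hrank (fun j => j.elim n₀ fun j => n (sh j.1)) (Fintype.linearIndependent_iff.2 ?_)
    intro g hg
    rw [Fintype.sum_option] at hg
    have hwj : ∀ j : {i : JordanIndex μ // m ≤ i.2.2.1}, (θ ^ m) (n (sh j.1)) = w j.1 := fun j => by
      simp only [w, if_pos j.2]
    simp only [Option.elim_none, Option.elim_some, hwj] at hg
    have h0 : g none = 0 := by
      have h1 := congrArg (w' i) hg
      rw [map_add, map_sum, map_smul, Finset.sum_eq_zero, add_zero, map_zero, smul_eq_mul] at h1
      · exact (mul_eq_zero.1 h1).resolve_right hne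
      · intro j _
        rw [map_smul, hw', if_neg (by rintro rfl; exact hi j.2), smul_zero]
    rintro (_ | j)
    · exact h0
    · rw [h0, zero_smul, zero_add] at hg
      have h1 := congrArg (w' j.1) hg
      rw [map_sum, Finset.sum_eq_single j, map_smul, hw', if_pos rfl, map_zero, smul_eq_mul] at h1
      · exact (mul_eq_zero.1 h1).resolve_right hΔ0
      · intro j' _ hj
        rw [map_smul, hw', if_neg fun h => hj (Subtype.ext h.symm), smul_zero]
      · simp
  have hz' : ∀ i, algebraMap R κ (w' i ((θ ^ m) n₀)) = 0 := by
    have h1 := congrArg red (hex ((θ ^ m) n₀))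
    rw [map_smul, hTm, hn₀, map_smul, hv, smul_zero, smul_zero, map_sum] at h1
    have h2 : ∑ i, (algebraMap R κ (w' i ((θ ^ m) n₀)) * d i) • b i = 0 := by
      rw [h1]
      refine Finset.sum_congr rfl fun i _ => ?_
      rw [map_smul, hw, mul_smul, IsScalarTower.algebraMap_smul]
    intro i
    exact (mul_eq_zero.1 (Fintype.linearIndependent_iff.1 b.linearIndependent _ h2 i)).resolve_right
      (hd i)
  -- The correction has the same image under `θ ^ m` as `Δ • n₀`, and by `hz'` its coefficients
  -- vanish in `κ`, so it does not change the reduction.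
  refine ⟨Δ * c₀, Δ • n₀ - ∑ i, if m ≤ i.2.2.1 then w' i ((θ ^ m) n₀) • n (sh i) else 0, ?_, ?_, ?_⟩
  · rw [map_mul]; exact mul_ne_zero hΔ hc₀
  · rw [map_sub, map_smul, map_sum, Finset.sum_eq_zero, sub_zero, hn₀, map_mul, mul_smul,
      IsScalarTower.algebraMap_smul κ Δ]
    intro i _
    split_ifs
    · rw [map_smul, ← IsScalarTower.algebraMap_smul κ, hz', zero_smul]
    · exact map_zero _
  · rw [map_sub, map_smul, hex, map_sum, ← Finset.sum_sub_distrib]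
    refine Finset.sum_eq_zero fun i _ => ?_
    by_cases h : m ≤ i.2.2.1
    · simp only [w, if_pos h, map_smul, sub_self]
    · rw [hz i h, if_neg h, zero_smul, map_zero, sub_zero]

/-- A Jordan basis of `N` up to the scalar `Δ`, with its dual family `co`. -/
structure JordanFrame (μ : Fin p → ℕ) (θ : Module.End R N) (Δ : R) where
  /-- the Jordan family -/
  vec : JordanIndex μ → N
  /-- the dual family -/
  co : JordanIndex μ → N →ₗ[R] R
  jordan : IsJordanFamily θ vec
  co_vec : ∀ i j, co i (vec j) = if i = j then Δ else 0
  smul_eq : ∀ n, Δ • n = ∑ i, co i n • vec i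

/-- Only the first vector of each block is lifted, to an element killed by `θ ^ (l + 1)`; its images
under powers of `θ` then form a block exactly, not just modulo the prime. -/
theorem exists_jordanFrame [IsDomain R] {ι : Type*} [Fintype ι] (ε : Module.Basis ι R N)
    (ε' : Module.Basis ι κ V) {red : N →ₗ[R] V} (hred : ∀ i, red (ε i) = ε' i)
    (hfrac : ∀ z : ι → κ, ∃ (c : R) (y : ι → R), algebraMap R κ c ≠ 0 ∧
      ∀ i, algebraMap R κ (y i) = algebraMap R κ c * z i)
    {θ : Module.End R N} {T : Module.End κ V} (hT : ∀ n, red (θ n) = T (red n))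
    (b : Module.Basis (JordanIndex μ) κ V) (hb : IsJordanFamily T b)
    (hrank : ∀ m (w : Option {i : JordanIndex μ // m ≤ i.2.2.1} → N),
      ¬ LinearIndependent R fun j => (θ ^ m) (w j)) :
    ∃ Δ, algebraMap R κ Δ ≠ 0 ∧ Nonempty (JordanFrame μ θ Δ) := by
  have hTm : ∀ m n, red ((θ ^ m) n) = (T ^ m) (red n) := fun m => by
    induction m with
    | zero => simp
    | succ m ih => intro n; simp only [pow_succ', Module.End.mul_apply, hT, ih]
  have key : ∀ (l : Fin p) (s : Fin (μ l)), ∃ (c : R) (n : N), algebraMap R κ c ≠ 0 ∧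
      red n = algebraMap R κ c • b ⟨l, s, 0⟩ ∧ (θ ^ (l.1 + 1)) n = 0 := fun l s =>
    exists_kernel_lift ε ε' hred hfrac hT b hb _ (hrank _) (by
      rw [hb.pow_apply, dif_neg (by simp)])
  choose c n hc hn hn' using key
  obtain ⟨Δ, w', hΔ, hw', hex⟩ := exists_dual_family ε ε' hred b
    (c := fun i => algebraMap R κ (c i.1 i.2.1)) (fun i => hc _ _)
    (w := fun i => (θ ^ i.2.2.1) (n i.1 i.2.1)) (fun i => by
      obtain ⟨l, s, t⟩ := i
      rw [hTm, hn, map_smul, hb.pow_apply, dif_pos (by simpa using t.2)]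
      simp)
  refine ⟨Δ, hΔ, ⟨_, w', fun l s t => ?_, hw', hex⟩⟩
  rw [← Module.End.mul_apply, ← pow_succ']
  split_ifs with h
  · rfl
  · have : t.1 = l.1 := by omega
    rw [this, hn']

end Frames

/-! ### Dual frames and coordinates in a Jordan frame. -/

section FrameDual

variable {R : Type*} [CommRing R] {N : Type*} [AddCommGroup N] [Module R N]
variable {N' : Type*} [AddCommGroup N'] [Module R N']
variable {p : ℕ} {μ : Fin p → ℕ} {θ : Module.End R N} {θ' : Module.End R N'} {Δ : R}

theorem jordanIndex_ext_iff {i j : JordanIndex μ} :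
    i = j ↔ i.1 = j.1 ∧ i.2.1.1 = j.2.1.1 ∧ i.2.2.1 = j.2.2.1 := by
  refine ⟨fun h => by subst h; simp, ?_⟩
  obtain ⟨l, s, t⟩ := i
  obtain ⟨l', s', t'⟩ := j
  rintro ⟨h, h1, h2⟩
  dsimp only at h h1 h2
  subst h
  rw [Fin.ext h1, Fin.ext h2]

namespace JordanFrame

theorem hom_ext [IsDomain R] (hΔ : Δ ≠ 0) (F : JordanFrame μ θ Δ) {f g : N →ₗ[R] R}
    (h : ∀ i, f (F.vec i) = g (F.vec i)) : f = g := by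
  ext n
  refine mul_left_cancel₀ hΔ ?_
  rw [← smul_eq_mul, ← smul_eq_mul, ← map_smul, ← map_smul, F.smul_eq, map_sum, map_sum]
  simp only [map_smul, h]

/-- Composition with `θ` shifts the dual family backwards; it suffices to compare both sides on the
frame vectors. -/
theorem co_apply [IsDomain R] (hΔ : Δ ≠ 0) (F : JordanFrame μ θ Δ) (l : Fin p) (s : Fin (μ l))
    (t : Fin (l.1 + 1)) (n : N) : F.co ⟨l, s, t⟩ (θ n) =
      if 1 ≤ t.1 then F.co ⟨l, s, ⟨t.1 - 1, by omega⟩⟩ n else 0 := by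
  have h : F.co ⟨l, s, t⟩ ∘ₗ θ =
      if 1 ≤ t.1 then F.co ⟨l, s, ⟨t.1 - 1, by omega⟩⟩ else 0 := by
    refine F.hom_ext hΔ ?_
    rintro ⟨l', s', t'⟩
    rw [LinearMap.comp_apply, F.jordan]
    split_ifs with h1 h2 h2
    · rw [F.co_vec, F.co_vec]
      refine if_congr ?_ rfl rfl
      simp only [jordanIndex_ext_iff]
      omega
    · rw [F.co_vec, if_neg, LinearMap.zero_apply]
      simp only [jordanIndex_ext_iff]
      omega
    · rw [F.co_vec, if_neg, map_zero]
      simp only [jordanIndex_ext_iff, not_and]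
      rintro rfl
      omega
    · rw [map_zero, LinearMap.zero_apply]
  rw [← LinearMap.comp_apply, h]
  split_ifs <;> simp

theorem co_pow_apply [IsDomain R] (hΔ : Δ ≠ 0) (F : JordanFrame μ θ Δ) (m : ℕ) (l : Fin p)
    (s : Fin (μ l)) (t : Fin (l.1 + 1)) (n : N) : F.co ⟨l, s, t⟩ ((θ ^ m) n) =
      if m ≤ t.1 then F.co ⟨l, s, ⟨t.1 - m, by omega⟩⟩ n else 0 := by
  induction m generalizing n with
  | zero => simp
  | succ m ih =>
    rw [pow_succ, Module.End.mul_apply, ih]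
    by_cases h : m ≤ t.1
    · rw [if_pos h, co_apply hΔ]
      simp only [Nat.sub_sub]
      refine if_congr ?_ rfl rfl
      omega
    · rw [if_neg h, if_neg (by omega)]

theorem vec_last (F : JordanFrame μ θ Δ) (l : Fin p) (s : Fin (μ l)) :
    F.vec ⟨l, s, Fin.last l.1⟩ = (θ ^ l.1) (F.vec ⟨l, s, 0⟩) := by
  rw [F.jordan.pow_apply, dif_pos (by simp)]
  congr 4
  exact Fin.ext (by simp)

/-- Expand `Δ • n` in the frame. Being in `Ker θ` leaves only last vectors of blocks, being in `Im
θ^l` removes the blocks shorter than `l + 1`, and the last vectors of longer blocks lie in `Im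
θ^(l+1)`. -/
theorem smul_sub_sum_mem_range [IsDomain R] (hΔ : Δ ≠ 0) (F : JordanFrame μ θ Δ) (l : Fin p)
    {n : N} (hn : θ n = 0) (hn' : n ∈ LinearMap.range (θ ^ l.1)) :
    Δ • n - ∑ s, F.co ⟨l, s, Fin.last l.1⟩ n • F.vec ⟨l, s, Fin.last l.1⟩ ∈
      LinearMap.range (θ ^ (l.1 + 1)) := by
  rw [← Submodule.Quotient.eq, F.smul_eq]
  simp only [← Submodule.mkQ_apply, map_sum]
  symm
  refine Fintype.sum_of_injective (fun s => (⟨l, s, Fin.last l.1⟩ : JordanIndex μ)) ?_ _ _ ?_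
    fun _ => rfl
  · intro s s' h
    simpa using h
  · rintro ⟨l', s, t⟩ hi
    -- Away from the end of a block, the coordinate of `n` at `t` is the coordinate of `θ n = 0` at
    -- `t + 1`.
    by_cases ht : t.1 < l'.1
    · have h := F.co_apply hΔ l' s ⟨t.1 + 1, by omega⟩ n
      rw [hn, map_zero, if_pos (by simp)] at h
      simp only [Nat.add_sub_cancel, Fin.eta] at h
      rw [← h, zero_smul, map_zero]
    obtain rfl : t = Fin.last l'.1 := Fin.ext (by simp; omega)
    rcases lt_trichotomy l'.1 l.1 with h | h | h
    · obtain ⟨z, rfl⟩ := hn'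
      rw [F.co_pow_apply hΔ, if_neg (by simpa using h), zero_smul, map_zero]
    · obtain rfl : l' = l := Fin.ext h
      exact absurd ⟨s, rfl⟩ hi
    · rw [map_smul, F.vec_last, Submodule.mkQ_apply, (Submodule.Quotient.mk_eq_zero _).2, smul_zero]
      obtain ⟨d, hd⟩ := Nat.exists_eq_add_of_le (Nat.succ_le_of_lt h)
      exact ⟨(θ ^ d) (F.vec ⟨l', s, 0⟩), by
        rw [← Module.End.mul_apply, ← pow_add, ← Nat.succ_eq_add_one, ← hd]⟩

/-- The reversal of Jordan blocks. -/
def rev (i : JordanIndex μ) : JordanIndex μ := ⟨i.1, i.2.1, i.2.2.rev⟩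

theorem rev_inj {i j : JordanIndex μ} : rev i = rev j ↔ j = i := by
  obtain ⟨l, s, t⟩ := i
  obtain ⟨l', s', t'⟩ := j
  simp only [rev, jordanIndex_ext_iff, Fin.val_rev]
  constructor
  · rintro ⟨rfl, h1, h2⟩; omega
  · rintro ⟨rfl, h1, h2⟩; omega

theorem rev_rev (i : JordanIndex μ) : rev (rev i) = i := by
  simp [rev]

/-- The frame of the dual module. -/
def dual [IsDomain R] (hΔ : Δ ≠ 0) (F : JordanFrame μ θ Δ) (e : N' ≃ₗ[R] (N →ₗ[R] R))
    (he : ∀ f n, e (θ' f) n = e f (θ n)) : JordanFrame μ θ' Δ where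
  vec i := e.symm (F.co (rev i))
  co i := LinearMap.applyₗ (F.vec (rev i)) ∘ₗ e.toLinearMap
  jordan l s t := by
    apply e.injective
    ext n
    rw [he, e.apply_symm_apply]
    refine (F.co_apply hΔ _ _ _ _).trans ?_
    split_ifs with h1 h2 h2
    · rw [e.apply_symm_apply]
      congr 5
    · simp only [Fin.val_rev] at h1
      omega
    · simp only [Fin.val_rev] at h1
      omega
    · simp
  co_vec i j := by
    simp only [LinearMap.comp_apply, LinearEquiv.coe_coe, e.apply_symm_apply,
      LinearMap.applyₗ_apply_apply, F.co_vec, rev_inj]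
  smul_eq f := by
    apply e.injective
    ext n
    have h := congrArg (e f) (F.smul_eq n)
    rw [map_smul, map_sum] at h
    rw [map_smul, map_sum, LinearMap.smul_apply, h, LinearMap.sum_apply]
    refine Fintype.sum_equiv ⟨rev, rev, rev_rev, rev_rev⟩ _ _ fun i => ?_
    simp [rev_rev, mul_comm]

end JordanFrame

end FrameDual

/-! ### The pairing of the two subquotients. -/

section KerPairing

variable {k : Type u} [Field k] {r : ℕ}
variable {N : Type u} [AddCommGroup N] [Module (Coord k r) N]
variable {N' : Type u} [AddCommGroup N'] [Module (Coord k r) N']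
variable {θ : Module.End (Coord k r) N} {θ' : Module.End (Coord k r) N'}
variable {e : N' →ₗ[Coord k r] N →ₗ[Coord k r] Coord k r}

theorem pairing_pow (he : ∀ f n, e (θ' f) n = e f (θ n)) (a : ℕ) (f : N') (n : N) :
    e ((θ' ^ a) f) n = e f ((θ ^ a) n) := by
  induction a generalizing n with
  | zero => simp
  | succ a ih => rw [pow_succ', pow_succ, Module.End.mul_apply, Module.End.mul_apply, he, ih]

/-- Writing `n = θ^a z` turns `⟨f, n⟩` into `⟨θ'^a f, z⟩`, so the pairing depends on `f` only
through `θ'^a f`. -/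
theorem pairing_eq_of_pow_eq (he : ∀ f n, e (θ' f) n = e f (θ n)) {a : ℕ} {f f' : N'}
    (h : (θ' ^ a) f = (θ' ^ a) f') {n : N} (hn : n ∈ kerInfRange θ a) : e f n = e f' n := by
  obtain ⟨z, rfl⟩ := hn.2
  rw [← pairing_pow he, ← pairing_pow he, h]

/-- The pairing `(θ'^a f, n) ↦ ⟨f, n⟩` on `(Ker θ' ∩ Im θ'^a) × (Ker θ ∩ Im θ^a)`. -/
def kerPairingAux (he : ∀ f n, e (θ' f) n = e f (θ n)) (a : ℕ) :
    kerInfRange θ' a →ₗ[Coord k r] kerInfRange θ a →ₗ[Coord k r] Coord k r :=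
  LinearMap.mk₂ _ (fun f n => e f.2.2.choose n)
    (fun f f' n => by
      rw [← LinearMap.add_apply, ← map_add]
      refine pairing_eq_of_pow_eq he ?_ n.2
      rw [map_add, (f + f').2.2.choose_spec, f.2.2.choose_spec, f'.2.2.choose_spec]
      rfl)
    (fun c f n => by
      rw [← LinearMap.smul_apply, ← map_smul]
      refine pairing_eq_of_pow_eq he ?_ n.2
      rw [map_smul, (c • f).2.2.choose_spec, f.2.2.choose_spec]
      rfl)
    (fun f n n' => map_add _ _ _) (fun c f n => map_smul _ _ _)

theorem kerPairingAux_apply (he : ∀ f n, e (θ' f) n = e f (θ n)) {a : ℕ} (f : kerInfRange θ' a)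
    (n : kerInfRange θ a) {f' : N'} (hf : (θ' ^ a) f' = f) :
    kerPairingAux he a f n = e f' n :=
  pairing_eq_of_pow_eq he (f.2.2.choose_spec.trans hf.symm) n.2

/-- The pairing of the subquotients of `θ'` and `θ`. -/
def kerPairing (he : ∀ f n, e (θ' f) n = e f (θ n)) (a : ℕ) :
    Subquot θ' a →ₗ[Coord k r] Subquot θ a →ₗ[Coord k r] Coord k r :=
  ((Submodule.liftQ _ ((Submodule.liftQ _ (kerPairingAux he a) (by
    -- Here `f = θ'^a (θ' f')`, so the value is `⟨θ' f', n⟩ = ⟨f', θ n⟩ = 0`.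
    rintro f ⟨hf, f', hf'⟩
    refine LinearMap.ext fun n => ?_
    rw [kerPairingAux_apply he f n (f' := θ' f') (by rw [← Module.End.mul_apply, ← pow_succ, hf']; rfl),
      he, LinearMap.mem_ker.1 n.2.1, map_zero, LinearMap.zero_apply])).flip) (by
    -- Here `n = θ^a (θ z)` and `f = θ'^a f'`, so `⟨f', n⟩ = ⟨f, θ z⟩ = ⟨θ' f, z⟩ = 0`.
    rintro n ⟨hn, z, hz⟩
    refine LinearMap.ext fun f => ?_
    obtain ⟨f, rfl⟩ := Submodule.mkQ_surjective _ f
    obtain ⟨f', hf'⟩ := f.2.2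
    refine (kerPairingAux_apply he f n hf').trans ?_
    have hz' : (θ ^ a) (θ z) = n := by rw [← Module.End.mul_apply, ← pow_succ, hz]; rfl
    rw [← hz', ← pairing_pow he, hf', ← he, LinearMap.mem_ker.1 f.2.1, map_zero,
      LinearMap.zero_apply, LinearMap.zero_apply]))).flip

theorem kerPairing_mk (he : ∀ f n, e (θ' f) n = e f (θ n)) {a : ℕ} (f : kerInfRange θ' a)
    (n : kerInfRange θ a) {f' : N'} (hf : (θ' ^ a) f' = f) :
    kerPairing he a (subquotMk θ' a f) (subquotMk θ a n) = e f' n :=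
  kerPairingAux_apply he f n hf

variable {p : ℕ} {μ : Fin p → ℕ} {Δ : Coord k r}

theorem JordanFrame.vec_last_mem (F : JordanFrame μ θ Δ) (l : Fin p) (s : Fin (μ l)) :
    F.vec ⟨l, s, Fin.last l.1⟩ ∈ kerInfRange θ l.1 := by
  refine ⟨?_, _, (F.vec_last l s).symm⟩
  refine (F.jordan _ _ _).trans ?_
  rw [dif_neg (by simp)]

/-- The class of the last vector of a Jordan block of length `l + 1`. -/
def JordanFrame.last (F : JordanFrame μ θ Δ) (l : Fin p) (s : Fin (μ l)) : Subquot θ l.1 :=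
  subquotMk θ l.1 ⟨_, F.vec_last_mem l s⟩

theorem JordanFrame.smul_mk_eq (hΔ : Δ ≠ 0) (F : JordanFrame μ θ Δ) (l : Fin p)
    (n : kerInfRange θ l.1) : Δ • subquotMk θ l.1 n =
      ∑ s, F.co ⟨l, s, Fin.last l.1⟩ n • F.last l s := by
  unfold JordanFrame.last
  simp only [← map_smul, ← map_sum]
  rw [← sub_eq_zero, ← map_sub, subquotMk_eq_zero]
  have h : (Δ • n - ∑ s, F.co ⟨l, s, Fin.last l.1⟩ n.1 • (⟨_, F.vec_last_mem l s⟩ :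
      kerInfRange θ l.1) : kerInfRange θ l.1).1 =
      Δ • n.1 - ∑ s, F.co ⟨l, s, Fin.last l.1⟩ n.1 • F.vec ⟨l, s, Fin.last l.1⟩ := by
    simp
  refine ⟨(Δ • n - ∑ s, F.co ⟨l, s, Fin.last l.1⟩ n.1 • (⟨_, F.vec_last_mem l s⟩ :
      kerInfRange θ l.1) : kerInfRange θ l.1).2.1, ?_⟩
  rw [SetLike.mem_coe, h]
  exact F.smul_sub_sum_mem_range hΔ l n.2.1 n.2.2

/-- The last vector of a dual block is `θ'^l` of its first vector, and by reversal that first vector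
is the coordinate functional of the last position in the original block. Pairing with it thus reads
off the coefficients of `JordanFrame.smul_mk_eq`; the second identity is the same argument for the
dual frame. -/
theorem exists_dual_generators (hΔ : Δ ≠ 0) (F : JordanFrame μ θ Δ)
    (he : ∀ f n, e (θ' f) n = e f (θ n)) (hbij : Function.Bijective e) (l : Fin p) :
    ∃ (P : Fin (μ l) → Subquot θ' l.1) (Q : Fin (μ l) → Subquot θ l.1),
      (∀ z, Δ • z = ∑ s, kerPairing he l.1 (P s) z • Q s) ∧
      ∀ z, Δ • z = ∑ s, kerPairing he l.1 z (Q s) • P s := by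
  let ε : N' ≃ₗ[Coord k r] (N →ₗ[Coord k r] Coord k r) := LinearEquiv.ofBijective e hbij
  let F' : JordanFrame μ θ' Δ := F.dual hΔ ε he
  refine ⟨fun s => F'.last l s, fun s => F.last l s, fun z => ?_, fun z => ?_⟩
  · obtain ⟨n, rfl⟩ := Submodule.mkQ_surjective _ z
    rw [F.smul_mk_eq hΔ]
    refine Finset.sum_congr rfl fun s _ => congrArg (· • _) ?_
    refine Eq.trans ?_ (kerPairing_mk he ⟨_, F'.vec_last_mem l s⟩ n (F'.vec_last l s).symm).symm
    change _ = ε (ε.symm _) n.1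
    rw [ε.apply_symm_apply, JordanFrame.rev, Fin.rev_zero]
  · obtain ⟨f, rfl⟩ := Submodule.mkQ_surjective _ z
    rw [F'.smul_mk_eq hΔ]
    refine Finset.sum_congr rfl fun s _ => congrArg (· • _) ?_
    obtain ⟨f', hf'⟩ := f.2.2
    refine Eq.trans ?_ (kerPairing_mk he f ⟨_, F.vec_last_mem l s⟩ hf').symm
    change _ = e f' (F.vec _)
    rw [F.vec_last, ← pairing_pow he, hf']
    change e f.1 (F.vec (JordanFrame.rev _)) = _
    rw [JordanFrame.rev, Fin.rev_last]

end KerPairing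

/-! ### Making the dual generators homogeneous. -/

section Decomposition

variable {k : Type u} [Field k] {r : ℕ}
variable {N : Type u} [AddCommGroup N] [Module (Coord k r) N]
variable {N' : Type u} [AddCommGroup N'] [Module (Coord k r) N']

/-- `π d` is the projection to the component of degree `d`, and there are no components of
negative degree. -/
structure IsDecomposition (G : Grading k r N) (π : ℤ → N →+ N) : Prop where
  mem : ∀ d n, π d n ∈ G.piece d
  of_mem : ∀ d e n, n ∈ G.piece e → π d n = if e = d then n else 0
  of_neg : ∀ d n, d < 0 → π d n = 0
  exists_eq_sum : ∀ n, ∃ m₀ : ℕ, ∀ m ≥ m₀, n = ∑ d ∈ Finset.range m, π d n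

theorem IsDecomposition.map {G : Grading k r N} {π : ℤ → N →+ N} (h : IsDecomposition G π)
    {G' : Grading k r N'} {π' : ℤ → N' →+ N'} (h' : IsDecomposition G' π') {e : ℤ} (φ : N →+ N')
    (hφ : ∀ d n, n ∈ G.piece d → φ n ∈ G'.piece (d + e)) (d : ℤ) (n : N) :
    π' (d + e) (φ n) = φ (π d n) := by
  obtain ⟨m, hm⟩ := h.exists_eq_sum n
  -- The bound is enlarged so that the summation range contains degree `d`.
  have h1 := hm (max m (d.toNat + 1)) (le_max_left _ _)
  conv_lhs => rw [h1]
  rw [map_sum, map_sum]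
  have h2 : ∀ i : ℕ, π' (d + e) (φ (π i n)) = if (i : ℤ) = d then φ (π i n) else 0 := fun i => by
    rw [h'.of_mem _ _ _ (hφ _ _ (h.mem i n))]
    exact if_congr (by omega) rfl rfl
  simp only [h2]
  rcases lt_or_ge d 0 with hd | hd
  · rw [h.of_neg _ _ hd, map_zero]
    exact Finset.sum_eq_zero fun i _ => if_neg (by omega)
  · rw [Finset.sum_eq_single d.toNat]
    · rw [if_pos (by omega), Int.toNat_of_nonneg hd]
    · exact fun i _ hi => if_neg (by omega)
    · intro hi
      exact absurd (Finset.mem_range.2 (lt_of_lt_of_le (Nat.lt_succ_self _) (le_max_right _ _))) hi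

/-- The homogeneous component of degree `d` of a polynomial, for `d : ℤ`. -/
def coordComp (d : ℤ) : Coord k r →+ Coord k r :=
  if 0 ≤ d then (MvPolynomial.homogeneousComponent d.toNat).toAddMonoidHom else 0

theorem coordComp_natCast (n : ℕ) (f : Coord k r) :
    coordComp n f = MvPolynomial.homogeneousComponent n f := by
  rw [coordComp, if_pos (by omega)]
  rfl

theorem coordComp_of_neg {d : ℤ} (hd : d < 0) (f : Coord k r) : coordComp d f = 0 := by
  rw [coordComp, if_neg (by omega)]
  rfl

theorem isDecomposition_coordComp : IsDecomposition (coordGrading k r) coordComp where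
  mem d f := by
    rcases lt_or_ge d 0 with hd | hd
    · rw [coordComp_of_neg hd]
      exact zero_mem _
    · lift d to ℕ using hd
      rw [coordComp_natCast]
      exact Or.inr ⟨d, rfl, MvPolynomial.homogeneousComponent_isHomogeneous d f⟩
  of_mem := by
    rintro d _ f (rfl | ⟨n, rfl, hf⟩)
    · simp
    · rcases lt_or_ge d 0 with hd | hd
      · rw [coordComp_of_neg hd, if_neg (by omega)]
      · lift d to ℕ using hd
        rw [coordComp_natCast, MvPolynomial.homogeneousComponent_of_mem hf]
        exact if_congr (by norm_cast; exact eq_comm) rfl rfl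
  of_neg d f hd := coordComp_of_neg hd f
  exists_eq_sum f := ⟨f.totalDegree + 1, fun m hm => by
    simp only [coordComp_natCast]
    conv_lhs => rw [← MvPolynomial.sum_homogeneousComponent f]
    refine Finset.sum_subset (Finset.range_subset_range.2 hm) fun i _ hi => ?_
    exact MvPolynomial.homogeneousComponent_eq_zero _ _ (by simpa using hi)⟩

/-- For `z` of degree `d`, compare the components of degree `β + d` in the identity `h`. The part of
`q i` in degree `e` then meets only the part of `p i` in degree `β + a - e`; since degrees are
nonnegative, `e` runs up to `β + a`. -/
theorem smul_component_eq_sum {P Q : Type u} [AddCommGroup P] [Module (Coord k r) P]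
    [AddCommGroup Q] [Module (Coord k r) Q] {GP : Grading k r P} {GQ : Grading k r Q}
    {B : P →ₗ[Coord k r] Q →ₗ[Coord k r] Coord k r} {a : ℕ} (hB : IsGradedPairing GP GQ B a)
    {πP : ℤ → P →+ P} {πQ : ℤ → Q →+ Q} (hP : IsDecomposition GP πP) (hQ : IsDecomposition GQ πQ)
    {Δ : Coord k r} {I : Type} [Fintype I] {p : I → P} {q : I → Q}
    (h : ∀ z, Δ • z = ∑ i, B (p i) z • q i) (β : ℕ) (z : Q) :
    MvPolynomial.homogeneousComponent β Δ • z =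
      ∑ i, ∑ e ∈ Finset.range (β + a + 1), B (πP (β + a - e) (p i)) z • πQ e (q i) := by
  suffices key : ∀ d z, z ∈ GQ.piece d → MvPolynomial.homogeneousComponent β Δ • z =
      ∑ i, ∑ e ∈ Finset.range (β + a + 1), B (πP (β + a - e) (p i)) z • πQ e (q i) by
    obtain ⟨m, hm⟩ := hQ.exists_eq_sum z
    rw [hm m le_rfl, Finset.smul_sum, Finset.sum_congr rfl fun (i : ℕ) _ => key i _ (hQ.mem i z),
      Finset.sum_comm]
    refine Finset.sum_congr rfl fun i _ => ?_
    rw [Finset.sum_comm]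
    refine Finset.sum_congr rfl fun i _ => ?_
    rw [map_sum, Finset.sum_smul]
  intro d z hz
  have h1 := congrArg (πQ (β + d)) (h z)
  have h2 : πQ (β + d) (Δ • z) = MvPolynomial.homogeneousComponent β Δ • z := by
    rw [← coordComp_natCast]
    refine isDecomposition_coordComp.map hQ (LinearMap.toSpanSingleton (Coord k r) Q z).toAddMonoidHom
      ?_ (β : ℤ) Δ
    rintro _ f (rfl | ⟨n, rfl, hf⟩)
    · simp
    · rw [add_comm]
      exact GQ.smul_mem hf hz
  rw [← h2, h1, map_sum]
  refine Finset.sum_congr rfl fun i _ => ?_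
  have h3 : ∀ e : ℕ, πQ (β + d) (B (p i) z • πQ e (q i)) =
      B (πP (β + a - e) (p i)) z • πQ e (q i) := fun e => by
    have h4 := isDecomposition_coordComp.map hQ
      (LinearMap.toSpanSingleton (Coord k r) Q (πQ e (q i))).toAddMonoidHom (e := e) (by
        rintro _ f (rfl | ⟨n, rfl, hf⟩)
        · simp
        · rw [add_comm]
          exact GQ.smul_mem hf (hQ.mem _ _)) (β + d - e) (B (p i) z)
    have h5 := hP.map isDecomposition_coordComp (B.flip z).toAddMonoidHom (e := d - a) (by
      intro d' p' hp'
      rw [← add_sub_assoc]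
      exact hB _ _ _ _ hp' hz) (β + a - e) (p i)
    rw [show (β + a - e + (d - a) : ℤ) = β + d - e by ring] at h5
    rw [sub_add_cancel] at h4
    refine h4.trans ?_
    exact congrArg (· • πQ e (q i)) h5
  obtain ⟨m, hm⟩ := hQ.exists_eq_sum (q i)
  have h6 := hm (max m (β + a + 1)) (le_max_left _ _)
  conv_lhs => rw [h6]
  rw [Finset.smul_sum, map_sum]
  simp only [h3]
  symm
  refine Finset.sum_subset (Finset.range_subset_range.2 (le_max_right _ _)) fun e _ he => ?_
  rw [hP.of_neg _ _ (by rw [Finset.mem_range] at he; omega), map_zero, LinearMap.zero_apply, zero_smul]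

/-- Some homogeneous component of `Δ` is nonzero at `x`; it replaces `Δ`, and the generators are
replaced by all their components of complementary degrees. -/
theorem hasDualBases_of_generators {P Q : Type u} [AddCommGroup P] [Module (Coord k r) P]
    [AddCommGroup Q] [Module (Coord k r) Q] {GP : Grading k r P} {GQ : Grading k r Q}
    {B : P →ₗ[Coord k r] Q →ₗ[Coord k r] Coord k r} {a : ℕ} (hB : IsGradedPairing GP GQ B a)
    {πP : ℤ → P →+ P} {πQ : ℤ → Q →+ Q} (hP : IsDecomposition GP πP) (hQ : IsDecomposition GQ πQ)
    (h : ∀ x : PSpace k r, ∃ Δ ∈ primeCompl x, ∃ (n : ℕ) (p : Fin n → P) (q : Fin n → Q),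
      (∀ z, Δ • z = ∑ i, B (p i) z • q i) ∧ ∀ z, Δ • z = ∑ i, B z (q i) • p i) :
    HasDualBases GP GQ B a := by
  intro x
  obtain ⟨Δ, hΔ, n, p, q, h1, h2⟩ := h x
  obtain ⟨β, hβ⟩ := exists_homogeneousComponent_mem_primeCompl hΔ
  refine ⟨β, _, Fin n × Fin (β + a + 1), inferInstance, fun i => πP (β + a - i.2.1) (p i.1),
    fun i => πQ i.2.1 (q i.1), fun i => i.2.1,
    MvPolynomial.homogeneousComponent_isHomogeneous β Δ, hβ, fun i => hP.mem _ _,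
    fun i => hQ.mem _ _, fun z => ?_, fun z => ?_⟩
  · rw [smul_component_eq_sum hB hP hQ h1, Fintype.sum_prod_type]
    refine Finset.sum_congr rfl fun i _ => ?_
    rw [Finset.sum_range]
  · have hB' : IsGradedPairing GQ GP B.flip a := fun d e q p hq hp => by
      rw [add_comm d e]
      exact hB _ _ _ _ hp hq
    rw [smul_component_eq_sum hB' hQ hP h2, Fintype.sum_prod_type]
    refine Finset.sum_congr rfl fun i _ => ?_
    -- With the roles of `P` and `Q` exchanged, the summation index is the degree on the `P` side,
    -- hence the substitution `e ↦ β + a - e`.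
    rw [← Finset.sum_range_reflect, Finset.sum_range]
    refine Finset.sum_congr rfl fun e _ => ?_
    have h3 : ((β + a + 1 - 1 - e.1 : ℕ) : ℤ) = β + a - e.1 := by omega
    rw [h3, sub_sub_cancel]
    rfl

variable {M : Type u} [AddCommGroup M] [Module k M]

theorem isDecomposition_zcomp :
    IsDecomposition (tensorGrading (k := k) (r := r) M) fun d => (zcomp d).toAddMonoidHom where
  mem := zcomp_mem
  of_mem _ _ _ hn := zcomp_of_mem hn
  of_neg d n hd := by
    change zcomp d n = 0
    rw [zcomp, if_neg (by omega)]
    rfl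
  exists_eq_sum := exists_eq_sum_zcomp

theorem IsHomogeneousSub.exists_isDecomposition_sub {A : Submodule (Coord k r) (Coord k r ⊗[k] M)}
    (hA : IsHomogeneousSub A) :
    ∃ π : ℤ → A →+ A, IsDecomposition ((tensorGrading M).sub A) π ∧ ∀ d z, (π d z).1 = zcomp d z.1 := by
  refine ⟨fun d => ((zcomp d).toAddMonoidHom.comp A.subtype.toAddMonoidHom).codRestrict
    A.toAddSubgroup fun z => hA d z.1 z.2, ⟨fun d z => zcomp_mem d z.1, fun d e z hz => ?_,
    fun d z hd => Subtype.ext (isDecomposition_zcomp.of_neg d z.1 hd), fun z => ?_⟩, fun d z => rfl⟩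
  · refine Subtype.ext ((zcomp_of_mem hz).trans ?_)
    split_ifs <;> rfl
  · obtain ⟨m, hm⟩ := exists_eq_sum_zcomp z.1
    refine ⟨m, fun m' h => Subtype.ext ((hm m' h).trans ?_)⟩
    rw [AddSubmonoidClass.coe_finsetSum]
    rfl

theorem IsDecomposition.quot {G : Grading k r N} {π : ℤ → N →+ N} (h : IsDecomposition G π)
    {A : Submodule (Coord k r) N} (hA : ∀ d n, n ∈ A → π d n ∈ A) :
    ∃ π' : ℤ → N ⧸ A →+ N ⧸ A, IsDecomposition (G.quot A) π' := by
  refine ⟨fun d => QuotientAddGroup.map A.toAddSubgroup A.toAddSubgroup (π d) (hA d), ⟨?_, ?_, ?_, ?_⟩⟩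
  · intro d n
    obtain ⟨n, rfl⟩ := A.mkQ_surjective n
    exact ⟨π d n, h.mem d n, rfl⟩
  · rintro d e _ ⟨n, hn, rfl⟩
    refine (congrArg A.mkQ (h.of_mem d e n hn)).trans ?_
    split_ifs
    · rfl
    · exact map_zero _
  · intro d n hd
    obtain ⟨n, rfl⟩ := A.mkQ_surjective n
    exact (congrArg A.mkQ (h.of_neg d n hd)).trans (map_zero _)
  · intro n
    obtain ⟨n, rfl⟩ := A.mkQ_surjective n
    obtain ⟨m, hm⟩ := h.exists_eq_sum n
    refine ⟨m, fun m' hm' => (congrArg A.mkQ (hm m' hm')).trans ?_⟩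
    rw [map_sum]
    rfl

theorem exists_isDecomposition_subquotGrading (X : Fin r → Module.End k M) (a : ℕ) :
    ∃ π, IsDecomposition (subquotGrading (tensorGrading M) (thetaLin X) a) π := by
  obtain ⟨π, hπ, h⟩ := (isHomogeneousSub_kerInfRange X a).exists_isDecomposition_sub
  refine hπ.quot fun d n hn => ?_
  change (π d n).1 ∈ kerInfRange (thetaLin X) (a + 1)
  rw [h]
  exact isHomogeneousSub_kerInfRange X (a + 1) d _ hn

end Decomposition

/-! ### Evaluation between `k[Y] ⊗ M^*` and `k[Y] ⊗ M`. -/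

section DualPairing

variable {k : Type u} [Field k] {r : ℕ} {M : Type u} [AddCommGroup M] [Module k M]

/-- The pairing of `k[Y₁, …, Y_r] ⊗ M^*` with `k[Y₁, …, Y_r] ⊗ M`. -/
def dualPairing (k : Type u) [Field k] (r : ℕ) (M : Type u) [AddCommGroup M] [Module k M] :
    Coord k r ⊗[k] Module.Dual k M →ₗ[Coord k r] Coord k r ⊗[k] M →ₗ[Coord k r] Coord k r :=
  LinearMap.liftBaseChange (Coord k r)
    (((LinearMap.liftBaseChangeEquiv (Coord k r)).toLinearMap.restrictScalars k).comp
      ((Algebra.linearMap k (Coord k r)).compRight k))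

theorem dualPairing_tmul (f g : Coord k r) (φ : Module.Dual k M) (m : M) :
    dualPairing k r M (f ⊗ₜ φ) (g ⊗ₜ m) = f * g * algebraMap k (Coord k r) (φ m) := by
  simp [dualPairing, mul_assoc]

theorem dualPairing_bijective [Module.Finite k M] : Function.Bijective (dualPairing k r M) := by
  classical
  let b := Module.finBasis k M
  let e := (b.dualBasis.baseChange (Coord k r)).equiv (b.baseChange (Coord k r)).dualBasis (Equiv.refl _)
  have h : dualPairing k r M = e.toLinearMap := by
    refine (b.dualBasis.baseChange (Coord k r)).ext fun i => ?_
    refine (b.baseChange (Coord k r)).ext fun j => ?_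
    simp only [e, LinearEquiv.coe_coe, Module.Basis.equiv_apply, Equiv.refl_apply,
      Module.Basis.dualBasis_apply_self]
    rw [Module.Basis.baseChange_apply, Module.Basis.baseChange_apply, dualPairing_tmul,
      Module.Basis.dualBasis_apply_self]
    split_ifs <;> simp
  rw [h]
  exact e.bijective

theorem dualPairing_thetaLin (X : Fin r → Module.End k M)
    (f : Coord k r ⊗[k] Module.Dual k M) (n : Coord k r ⊗[k] M) :
    dualPairing k r M (thetaLin (fun i => Module.Dual.transpose (R := k) (X i)) f) n =
      dualPairing k r M f (thetaLin X n) := by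
  induction f using TensorProduct.induction_on with
  | zero => simp
  | add f f' hf hf' => simp only [map_add, LinearMap.add_apply, hf, hf']
  | tmul f φ =>
    induction n using TensorProduct.induction_on with
    | zero => simp
    | add n n' hn hn' => simp only [map_add, hn, hn']
    | tmul g m =>
      simp only [thetaLin, LinearMap.sum_apply, LinearMap.smul_apply, LinearMap.baseChange_tmul,
        map_sum, map_smul, dualPairing_tmul, Module.Dual.transpose_apply, LinearMap.comp_apply]

theorem dualPairing_mem {d e : ℤ} {f : Coord k r ⊗[k] Module.Dual k M} {n : Coord k r ⊗[k] M}
    (hf : f ∈ (tensorGrading _).piece d) (hn : n ∈ (tensorGrading _).piece e) :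
    dualPairing k r M f n ∈ (coordGrading k r).piece (d + e) := by
  induction hf using AddSubgroup.closure_induction with
  | mem f hf =>
    obtain ⟨i, f, φ, rfl, hf, rfl⟩ := hf
    induction hn using AddSubgroup.closure_induction with
    | mem n hn =>
      obtain ⟨j, g, m, rfl, hg, rfl⟩ := hn
      rw [dualPairing_tmul]
      refine Or.inr ⟨i + j + 0, by push_cast; ring, (hf.mul hg).mul ?_⟩
      exact MvPolynomial.isHomogeneous_C _ _
    | zero => rw [map_zero]; exact zero_mem _
    | add y z _ _ hy hz => rw [map_add]; exact add_mem hy hz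
    | neg y _ hy => rw [map_neg]; exact neg_mem hy
  | zero => rw [map_zero]; exact zero_mem _
  | add y z _ _ hy hz => rw [map_add]; exact add_mem hy hz
  | neg y _ hy => rw [map_neg]; exact neg_mem hy

/-- An element of degree `d` in `Im θ'^a` has a preimage of degree `d - a`, and evaluation itself
has degree `0`. -/
theorem isGradedPairing_kerPairing (X : Fin r → Module.End k M) (a : ℕ) :
    IsGradedPairing (subquotGrading (tensorGrading _)
      (thetaLin fun i => Module.Dual.transpose (R := k) (X i)) a)
      (subquotGrading (tensorGrading M) (thetaLin X) a)
      (kerPairing (dualPairing_thetaLin X) a) a := by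
  rintro d e _ _ ⟨f, hf, rfl⟩ ⟨n, hn, rfl⟩
  obtain ⟨f', hf'⟩ := f.2.2
  have h : (thetaLin (fun i => Module.Dual.transpose (R := k) (X i)) ^ a) (zcomp (d - a) f') = f := by
    rw [← zcomp_map (thetaLin_pow_isOfDegree _ a), sub_add_cancel, hf']
    exact zcomp_self hf
  have h1 := dualPairing_mem (zcomp_mem (d - a) f') hn
  rw [show d + e - a = d - a + e by ring]
  have h2 := kerPairing_mk (dualPairing_thetaLin X) f n h
  exact h2 ▸ h1

end DualPairing

/-! ### Constant Jordan type gives frames at every point. -/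

section GenericFrames

variable {k : Type u} [Field k] {r : ℕ} {M : Type u} [AddCommGroup M] [Module k M]

/-- The reduction map `k[Y₁, …, Y_r] ⊗ M → K ⊗ M`. -/
def tensorRed (K : Type u) [Field K] [Algebra k K] [Algebra (Coord k r) K]
    [IsScalarTower k (Coord k r) K] : Coord k r ⊗[k] M →ₗ[Coord k r] K ⊗[k] M :=
  TensorProduct.AlgebraTensorModule.map (Algebra.linearMap (Coord k r) K) LinearMap.id

theorem tensorRed_thetaLin (K : Type u) [Field K] [Algebra k K] [Algebra (Coord k r) K]
    [IsScalarTower k (Coord k r) K] (X : Fin r → Module.End k M) (n : Coord k r ⊗[k] M) :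
    tensorRed K (thetaLin X n) = (∑ i, algebraMap (Coord k r) K (MvPolynomial.X i) •
      LinearMap.baseChange K (X i)) (tensorRed K n) := by
  induction n using TensorProduct.induction_on with
  | zero => simp
  | add n n' h h' => simp only [map_add, h, h']
  | tmul f m =>
    simp only [thetaLin, tensorRed, LinearMap.sum_apply, LinearMap.smul_apply,
      LinearMap.baseChange_tmul, map_sum, map_smul, TensorProduct.AlgebraTensorModule.map_tmul,
      LinearMap.id_apply]
    refine Finset.sum_congr rfl fun i _ => ?_
    rw [TensorProduct.smul_tmul', TensorProduct.smul_tmul', Algebra.smul_def, smul_eq_mul]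

variable {p : ℕ} {μ : Fin p → ℕ}

/-- The Jordan hypothesis is used for two fields, with `α` the images of the variables: the fraction
field `κ` of `k[Y]/x`, where it supplies the basis to lift, and `F = k(Y)`, where it bounds the
ranks of the powers of `θ`. -/
theorem exists_frame_at [Module.Finite k M] (X : Fin r → Module.End k M)
    (hμ : ∀ (K : Type u) [Field K] [Algebra k K] (α : Fin r → K), α ≠ 0 →
      HasJordanType (∑ i, α i • LinearMap.baseChange K (X i)) μ) (x : PSpace k r) :
    ∃ Δ ∈ primeCompl x, Nonempty (JordanFrame μ (thetaLin X) Δ) := by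
  classical
  let I : Ideal (Coord k r) := x.asHomogeneousIdeal.toIdeal
  have hI : I.IsPrime := x.isPrime
  let κ : Type u := FractionRing (Coord k r ⧸ I)
  let F : Type u := FractionRing (Coord k r)
  obtain ⟨l, hl⟩ := exists_X_mem_primeCompl x
  have hker : ∀ c, algebraMap (Coord k r) κ c ≠ 0 ↔ c ∈ primeCompl x := fun c => by
    rw [IsScalarTower.algebraMap_apply (Coord k r) (Coord k r ⧸ I) κ, Ne,
      IsFractionRing.to_map_eq_zero_iff]
    exact not_congr Ideal.Quotient.eq_zero_iff_mem
  obtain ⟨b, hb⟩ := hμ κ (fun i => algebraMap (Coord k r) κ (MvPolynomial.X i))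
    fun h => (hker _).2 hl (congrFun h l)
  obtain ⟨b', hb'⟩ := hμ F (fun i => algebraMap (Coord k r) F (MvPolynomial.X i)) fun h => by
    have h1 := congrFun h l
    exact MvPolynomial.X_ne_zero l ((IsFractionRing.to_map_eq_zero_iff (K := F)).1 h1)
  let ε := Module.finBasis k M
  obtain ⟨Δ, hΔ, hF⟩ := exists_jordanFrame (ε.baseChange (Coord k r)) (ε.baseChange κ)
    (red := tensorRed κ) (fun i => by simp [tensorRed]) (fun z => by
      obtain ⟨c, hc⟩ := IsLocalization.exist_integer_multiples_of_finite
        (nonZeroDivisors (Coord k r ⧸ I)) z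
      obtain ⟨c', hc'⟩ := Ideal.Quotient.mk_surjective c.1
      choose y hy using hc
      choose y' hy' using fun i => Ideal.Quotient.mk_surjective (y i)
      refine ⟨c', y', ?_, fun i => ?_⟩
      · rw [IsScalarTower.algebraMap_apply (Coord k r) (Coord k r ⧸ I) κ, Ne,
          IsFractionRing.to_map_eq_zero_iff]
        exact fun h => nonZeroDivisors.ne_zero c.2 (hc'.symm.trans h)
      · rw [IsScalarTower.algebraMap_apply (Coord k r) (Coord k r ⧸ I) κ,
          IsScalarTower.algebraMap_apply (Coord k r) (Coord k r ⧸ I) κ]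
        refine (congrArg _ (hy' i)).trans ((hy i).trans ?_)
        exact (Algebra.smul_def c.1 (z i)).trans
          (congrArg (fun t => algebraMap (Coord k r ⧸ I) κ t * z i) hc'.symm))
    -- `w` has one member more than the generic rank of `θ ^ m`, which depends only on the common
    -- Jordan type `μ`.
    (θ := thetaLin X) (tensorRed_thetaLin κ X) b hb (fun m w hw => by
      have h := card_le_of_linearIndependent_pow (R := Coord k r) (F := F) (red := tensorRed F) ?_
        (tensorRed_thetaLin F X) b' hb' m hw
      · rw [Fintype.card_option] at h
        omega
      · refine LinearMap.ker_eq_bot.1 (LinearMap.ker_eq_bot'.2 fun n hn => ?_)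
        refine (ε.baseChange (Coord k r)).repr.injective (Finsupp.ext fun i => ?_)
        refine IsFractionRing.injective (Coord k r) F ?_
        have h : ∀ n : Coord k r ⊗[k] M, algebraMap (Coord k r) F ((ε.baseChange (Coord k r)).repr n i) =
            (ε.baseChange F).repr (tensorRed F n) i := fun n => by
          induction n using TensorProduct.induction_on with
          | zero => simp
          | add n n' h h' => simp only [map_add, Finsupp.add_apply, h, h']
          | tmul f m =>
            simp only [tensorRed, Module.Basis.baseChange_repr_tmul, Algebra.smul_def, map_mul,
              TensorProduct.AlgebraTensorModule.map_tmul, Algebra.linearMap_apply,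
              LinearMap.id_apply]
            rw [← IsScalarTower.algebraMap_apply k (Coord k r) F]
        rw [h, hn]
        simp)
  exact ⟨Δ, (hker Δ).1 hΔ, hF⟩

theorem nonempty_subquotient_transpose_iso [Module.Finite k M] (X : Fin r → Module.End k M)
    (hμ : ∀ (K : Type u) [Field K] [Algebra k K] (α : Fin r → K), α ≠ 0 →
      HasJordanType (∑ i, α i • LinearMap.baseChange K (X i)) μ) (a : ℕ) (ha : a < p) :
    Nonempty (subquotient (fun i => Module.Dual.transpose (R := k) (X i)) a ≅
      serreTwist (dualSheaf (tilde (subquotGrading (tensorGrading M) (thetaLin X) a) 0)) (-a)) := by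
  obtain ⟨e⟩ := nonempty_subquotient_iso (fun i => Module.Dual.transpose (R := k) (X i)) a
  obtain ⟨π, hπ⟩ := exists_isDecomposition_subquotGrading X a
  obtain ⟨π', hπ'⟩ := exists_isDecomposition_subquotGrading
    (fun i => Module.Dual.transpose (R := k) (X i)) a
  have hB := isGradedPairing_kerPairing X a
  obtain ⟨e'⟩ := nonempty_tilde_iso_serreTwist_dual hB
    (hasDualBases_of_generators hB hπ' hπ fun x => by
      obtain ⟨Δ, hΔ, ⟨F⟩⟩ := exists_frame_at X hμ x
      obtain ⟨P, Q, h⟩ := exists_dual_generators (fun h => hΔ (by rw [h]; exact zero_mem _)) F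
        (dualPairing_thetaLin X) dualPairing_bijective ⟨a, ha⟩
      exact ⟨Δ, hΔ, _, P, Q, h⟩)
  exact ⟨e ≪≫ e'⟩

end GenericFrames

/-! ### Functoriality of the dual and of the tensor product. -/

section DualFunctor

variable {X : Scheme.{u}}

/-- The map on sections over an open set, as a linear map. -/
def appLin {F G : X.Modules} (f : F ⟶ G) (U : X.Opens) : Γ(F, U) →ₗ[Γ(X, U)] Γ(G, U) where
  toFun := f.app U
  map_add' := map_add _
  map_smul' := Scheme.Modules.Hom.app_smul f

/-- The transpose of a morphism of sheaves of modules. -/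
def dualMap {F G : X.Modules} (f : F ⟶ G) : dualSheaf G ⟶ dualSheaf F :=
  homOfSections (Z := dualSheaf G) (A := dualSheaf F)
    (fun U =>
      { toFun := fun φ : dualSections G U => (⟨fun V => φ.1 V ∘ₗ appLin f V.1, fun V W h s => by
          refine Eq.trans ?_ (φ.2 V W h (f.app V.1 s))
          exact congrArg (φ.1 W)
            (ConcreteCategory.congr_hom (f.mapPresheaf.naturality (homOfLE h).op) s)⟩ :
              dualSections F U)
        map_zero' := rfl
        map_add' := fun _ _ => rfl })
    (fun _ _ _ _ => rfl) (fun _ _ _ => rfl)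

/-- Isomorphic sheaves of modules have isomorphic duals. -/
def dualIso {F G : X.Modules} (e : F ≅ G) : dualSheaf F ≅ dualSheaf G where
  hom := dualMap e.inv
  inv := dualMap e.hom
  hom_inv_id := by
    ext U φ
    refine Subtype.ext (funext fun V => LinearMap.ext fun s => congrArg (φ.1 V) ?_)
    exact ConcreteCategory.congr_hom (congrArg (fun q => q.app V.1) e.hom_inv_id) s
  inv_hom_id := by
    ext U φ
    refine Subtype.ext (funext fun V => LinearMap.ext fun s => congrArg (φ.1 V) ?_)
    exact ConcreteCategory.congr_hom (congrArg (fun q => q.app V.1) e.inv_hom_id) s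

/-- Isomorphic presheaves of modules have isomorphic tensor products. -/
def presheafTensorIso {C : Type*} [Category* C] {R : Cᵒᵖ ⥤ CommRingCat.{u}}
    {F G : PresheafOfModules.{u} (R ⋙ forget₂ CommRingCat.{u} RingCat.{u})} (e : F ≅ G)
    (H : PresheafOfModules.{u} (R ⋙ forget₂ CommRingCat.{u} RingCat.{u})) :
    PresheafOfModules.Monoidal.tensorObj F H ≅ PresheafOfModules.Monoidal.tensorObj G H :=
  MonoidalCategory.whiskerRightIso e H

/-- Isomorphic sheaves of modules have isomorphic tensor products. -/
def tensorSheafIso {F G : X.Modules} (e : F ≅ G) (H : X.Modules) :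
    tensorSheaf F H ≅ tensorSheaf G H :=
  (PresheafOfModules.sheafification (𝟙 X.ringCatSheaf.obj)).mapIso
    (presheafTensorIso (R := X.presheaf) ((SheafOfModules.forget X.ringCatSheaf).mapIso e) H.val)

end DualFunctor

/-! ### Duality for the transposed action. -/

section Transpose

variable {k : Type u} [Field k] {r : ℕ} {E : Type v} {M : Type u} [AddCommGroup M] [Module k M]

theorem nonempty_jordanSheaf_transposeDual_iso [CommGroup E] [Module.Finite k M] {p : ℕ} (g : Fin r → E)
    (ρ : Representation k E M) (hM : ConstantJordanType p g ρ) (i : ℕ) (hi : 1 ≤ i) (hip : i ≤ p) :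
    Nonempty (jordanSheaf g (transposeDual ρ) i ≅
      serreTwist (dualSheaf (jordanSheaf g ρ i)) (-(i : ℤ) + 1)) := by
  obtain ⟨μ, hμ⟩ := hM
  obtain ⟨a, rfl⟩ := Nat.exists_eq_add_of_le' hi
  obtain ⟨e⟩ := nonempty_subquotient_transpose_iso (groupX g ρ) hμ a hip
  obtain ⟨e'⟩ := nonempty_subquotient_iso (groupX g ρ) a
  have h : groupX g (transposeDual ρ) = fun i => Module.Dual.transpose (R := k) (groupX g ρ i) := by
    funext i
    simp only [groupX, map_sub]
    rfl
  rw [show (-((a + 1 : ℕ) : ℤ) + 1) = -a by push_cast; ring]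
  unfold jordanSheaf
  rw [h]
  exact ⟨e ≪≫ (tensorSheafIso (dualIso e') _).symm⟩

end Transpose

/-! ### Partial derivatives and the action of `X_j` on the subquotient. -/

section Derivation

variable {k : Type u} [Field k] {r : ℕ} {M : Type u} [AddCommGroup M] [Module k M]

/-- The partial derivative with respect to `Y_j`, on `k[Y₁, …, Y_r] ⊗ M`. -/
def tensorPderiv (M : Type u) [AddCommGroup M] [Module k M] (j : Fin r) :
    Module.End k (Coord k r ⊗[k] M) :=
  (MvPolynomial.pderiv j).toLinearMap.rTensor M

theorem tensorPderiv_X_smul (j l : Fin r) (n : Coord k r ⊗[k] M) :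
    tensorPderiv M j ((MvPolynomial.X l : Coord k r) • n) =
      (MvPolynomial.X l : Coord k r) • tensorPderiv M j n + if j = l then n else 0 := by
  induction n using TensorProduct.induction_on with
  | zero => simp
  | add n n' h h' => rw [smul_add, map_add, h, h', map_add, smul_add]; split_ifs <;> abel
  | tmul f m =>
    simp only [tensorPderiv, TensorProduct.smul_tmul', LinearMap.rTensor_tmul, smul_eq_mul,
      Derivation.coeFn_coe, Derivation.leibniz, MvPolynomial.pderiv_X, TensorProduct.add_tmul]
    by_cases h : j = l
    · subst h; simp
    · simp [h, Ne.symm h]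

theorem tensorPderiv_baseChange (j : Fin r) (T : Module.End k M) (n : Coord k r ⊗[k] M) :
    tensorPderiv M j (T.baseChange (Coord k r) n) =
      T.baseChange (Coord k r) (tensorPderiv M j n) := by
  induction n using TensorProduct.induction_on with
  | zero => simp
  | add n n' h h' => simp only [map_add, h, h']
  | tmul f m => simp [tensorPderiv]

/-- The product rule for `θ = ∑ Yᵢ Xᵢ`: its commutator with `∂/∂Y_j` is `X_j`. -/
theorem tensorPderiv_thetaLin (X : Fin r → Module.End k M) (j : Fin r) (n : Coord k r ⊗[k] M) :
    tensorPderiv M j (thetaLin X n) =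
      thetaLin X (tensorPderiv M j n) + (X j).baseChange (Coord k r) n := by
  simp only [thetaLin, LinearMap.sum_apply, LinearMap.smul_apply, map_sum, tensorPderiv_X_smul,
    tensorPderiv_baseChange, Finset.sum_add_distrib, Finset.sum_ite_eq, Finset.mem_univ, if_true]

theorem commute_baseChange_thetaLin {X : Fin r → Module.End k M} {T : Module.End k M}
    (h : ∀ l, Commute T (X l)) : Commute (T.baseChange (Coord k r)) (thetaLin X) := by
  refine Commute.sum_right _ _ _ fun l _ => Commute.smul_right ?_ _
  change _ * _ = _ * _
  rw [← LinearMap.baseChange_mul, ← LinearMap.baseChange_mul, (h l).eq]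

theorem tensorPderiv_thetaLin_pow {X : Fin r → Module.End k M} (j : Fin r)
    (h : ∀ l, Commute (X j) (X l)) (m : ℕ) (n : Coord k r ⊗[k] M) :
    tensorPderiv M j ((thetaLin X ^ (m + 1)) n) = (thetaLin X ^ (m + 1)) (tensorPderiv M j n) +
      (m + 1) • (thetaLin X ^ m) ((X j).baseChange (Coord k r) n) := by
  induction m generalizing n with
  | zero => simpa using tensorPderiv_thetaLin X j n
  | succ m ih =>
    have hc : (X j).baseChange (Coord k r) (thetaLin X n) =
        thetaLin X ((X j).baseChange (Coord k r) n) :=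
      LinearMap.congr_fun (commute_baseChange_thetaLin h).eq n
    rw [pow_succ, Module.End.mul_apply, ih, tensorPderiv_thetaLin, hc, map_add,
      Module.End.mul_apply, pow_succ (thetaLin X) m, Module.End.mul_apply,
      Module.End.mul_apply, succ_nsmul _ (m + 1), add_assoc, add_comm (_ • _)]

/-- For `n = θ^a z` in `Ker θ`, differentiating `θ^(a+1) z = 0` gives `θ^(a+1) (∂_j z) + (a + 1) X_j
n = 0`, and `a + 1` can be divided out. So `X_j` annihilates the subquotient. -/
theorem baseChange_mem_kerInfRange_succ {X : Fin r → Module.End k M} (j : Fin r)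
    (h : ∀ l, Commute (X j) (X l)) {a : ℕ} (ha : ((a + 1 : ℕ) : k) ≠ 0) {n : Coord k r ⊗[k] M}
    (hn : n ∈ kerInfRange (thetaLin X) a) :
    (X j).baseChange (Coord k r) n ∈ kerInfRange (thetaLin X) (a + 1) := by
  have hc := commute_baseChange_thetaLin (r := r) h
  obtain ⟨h0, z, rfl⟩ := hn
  refine ⟨?_, ?_⟩
  · have h1 := LinearMap.congr_fun hc.eq ((thetaLin X ^ a) z)
    refine h1.symm.trans ?_
    rw [Module.End.mul_apply, LinearMap.mem_ker.1 h0, map_zero]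
  · have h1 := tensorPderiv_thetaLin_pow j h a z
    rw [pow_succ', Module.End.mul_apply, LinearMap.mem_ker.1 h0, map_zero, ← pow_succ'] at h1
    have h2 : (X j).baseChange (Coord k r) ((thetaLin X ^ a) z) =
        (thetaLin X ^ a) ((X j).baseChange (Coord k r) z) :=
      LinearMap.congr_fun (hc.pow_right a).eq z
    have h3 : algebraMap k (Coord k r) ((a + 1 : ℕ) : k)⁻¹ •
        ((a + 1) • (thetaLin X ^ a) ((X j).baseChange (Coord k r) z)) =
        (thetaLin X ^ a) ((X j).baseChange (Coord k r) z) := by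
      rw [← Nat.cast_smul_eq_nsmul (Coord k r), smul_smul, ← map_natCast (algebraMap k (Coord k r)),
        ← map_mul, inv_mul_cancel₀ ha, map_one, one_smul]
    refine ⟨-(algebraMap k (Coord k r) ((a + 1 : ℕ) : k)⁻¹ • tensorPderiv M j z), ?_⟩
    rw [map_neg, map_smul, eq_neg_of_add_eq_zero_left h1.symm, smul_neg, neg_neg, h3, h2]

end Derivation

/-! ### Comparison of the actions of `g` and of its inverse. -/

section Twisting

variable {k : Type u} [Field k] {r : ℕ} {M : Type u} [AddCommGroup M] [Module k M]
variable {E : Type v} [CommGroup E] (σ : Representation k E M)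

/-- The element of the group with exponents `s`. -/
def groupMonomial (h : Fin r → E) (s : Fin r →₀ ℕ) : E := s.prod fun j n => h j ^ n

theorem groupMonomial_add (h : Fin r → E) (s t : Fin r →₀ ℕ) :
    groupMonomial h (s + t) = groupMonomial h s * groupMonomial h t :=
  Finsupp.prod_add_index' (fun _ => pow_zero _) fun _ _ _ => pow_add _ _ _

theorem groupMonomial_single (h : Fin r → E) (j : Fin r) :
    groupMonomial h (Finsupp.single j 1) = h j := by
  simp [groupMonomial]

theorem groupMonomial_mul {h h' : Fin r → E} (hh : ∀ j, h j * h' j = 1) (s : Fin r →₀ ℕ) :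
    groupMonomial h s * groupMonomial h' s = 1 := by
  unfold groupMonomial
  rw [← Finsupp.prod_mul]
  simp only [← mul_pow, hh, one_pow]
  exact Finset.prod_const_one

/-- The map `Y^s ⊗ m ↦ Y^s ⊗ h^s m`. -/
def twistMap (h : Fin r → E) : Module.End k (Coord k r ⊗[k] M) :=
  TensorProduct.lift ((MvPolynomial.basisMonomials (Fin r) k).constr k fun s =>
    TensorProduct.mk k (Coord k r) M (MvPolynomial.monomial s 1) ∘ₗ σ (groupMonomial h s))

theorem twistMap_monomial_tmul (h : Fin r → E) (s : Fin r →₀ ℕ) (c : k) (m : M) :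
    twistMap σ h (MvPolynomial.monomial s c ⊗ₜ m) =
      MvPolynomial.monomial s c ⊗ₜ σ (groupMonomial h s) m := by
  have h1 : (MvPolynomial.monomial s c : Coord k r) =
      c • (MvPolynomial.basisMonomials (Fin r) k s) := by
    rw [MvPolynomial.coe_basisMonomials, MvPolynomial.smul_monomial, smul_eq_mul, mul_one]
  rw [twistMap, TensorProduct.lift.tmul, h1, map_smul, Module.Basis.constr_basis,
    MvPolynomial.coe_basisMonomials]
  rfl

theorem monomial_tmul_induction {motive : Coord k r ⊗[k] M → Prop} (zero : motive 0)
    (add : ∀ y z, motive y → motive z → motive (y + z))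
    (tmul : ∀ s c m, motive (MvPolynomial.monomial s c ⊗ₜ m)) (z) : motive z := by
  induction z using TensorProduct.induction_on with
  | zero => exact zero
  | add y z hy hz => exact add y z hy hz
  | tmul f m =>
    induction f using MvPolynomial.induction_on' with
    | monomial s c => exact tmul _ _ _
    | add f g hf hg => rw [TensorProduct.add_tmul]; exact add _ _ hf hg

theorem twistMap_twistMap {h h' : Fin r → E} (hh : ∀ j, h j * h' j = 1) (n : Coord k r ⊗[k] M) :
    twistMap σ h (twistMap σ h' n) = n := by
  induction n using monomial_tmul_induction with
  | zero => simp
  | add y z hy hz => simp only [map_add, hy, hz]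
  | tmul s c m =>
    rw [twistMap_monomial_tmul, twistMap_monomial_tmul, ← Module.End.mul_apply, ← map_mul,
      groupMonomial_mul hh, map_one]
    rfl

theorem twistMap_X_smul (h : Fin r → E) (j : Fin r) (n : Coord k r ⊗[k] M) :
    twistMap σ h ((MvPolynomial.X j : Coord k r) • n) =
      (MvPolynomial.X j : Coord k r) • (σ (h j)).baseChange (Coord k r) (twistMap σ h n) := by
  induction n using monomial_tmul_induction with
  | zero => simp
  | add y z hy hz => simp only [map_add, smul_add, hy, hz]
  | tmul s c m =>
    rw [TensorProduct.smul_tmul', smul_eq_mul, MvPolynomial.X, MvPolynomial.monomial_mul, one_mul,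
      twistMap_monomial_tmul, twistMap_monomial_tmul, LinearMap.baseChange_tmul,
      TensorProduct.smul_tmul', smul_eq_mul, MvPolynomial.monomial_mul, one_mul,
      groupMonomial_add, groupMonomial_single, map_mul]
    rfl

theorem twistMap_baseChange (h : Fin r → E) (x : E) (n : Coord k r ⊗[k] M) :
    twistMap σ h ((σ x).baseChange (Coord k r) n) =
      (σ x).baseChange (Coord k r) (twistMap σ h n) := by
  induction n using monomial_tmul_induction with
  | zero => simp
  | add y z hy hz => simp only [map_add, hy, hz]
  | tmul s c m =>
    rw [LinearMap.baseChange_tmul, twistMap_monomial_tmul, twistMap_monomial_tmul,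
      LinearMap.baseChange_tmul, ← Module.End.mul_apply, ← map_mul, mul_comm, map_mul]
    rfl

theorem baseChange_groupX_apply (g : Fin r → E) (j : Fin r) (n : Coord k r ⊗[k] M) :
    (groupX g σ j).baseChange (Coord k r) n = (σ (g j)).baseChange (Coord k r) n - n := by
  rw [groupX, LinearMap.baseChange_sub, LinearMap.sub_apply]
  congr 1
  exact LinearMap.congr_fun (LinearMap.baseChange_id (R := k) (A := Coord k r) (M := M)) n

theorem twistMap_X_smul_sub (h : Fin r → E) (j : Fin r) (n : Coord k r ⊗[k] M) :
    twistMap σ h ((MvPolynomial.X j : Coord k r) • n) -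
      (MvPolynomial.X j : Coord k r) • twistMap σ h n =
      (MvPolynomial.X j : Coord k r) • (groupX h σ j).baseChange (Coord k r) (twistMap σ h n) := by
  rw [twistMap_X_smul, baseChange_groupX_apply, smul_sub]

theorem twistMap_mem {h : Fin r → E} {d : ℤ} {n : Coord k r ⊗[k] M}
    (hn : n ∈ (tensorGrading M).piece d) : twistMap σ h n ∈ (tensorGrading M).piece d := by
  induction hn using AddSubgroup.closure_induction with
  | mem z hz =>
    obtain ⟨n, f, m, rfl, hf, rfl⟩ := hz
    rw [← MvPolynomial.support_sum_monomial_coeff f, TensorProduct.sum_tmul, map_sum]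
    refine sum_mem fun s hs => ?_
    rw [twistMap_monomial_tmul]
    refine tmul_mem_piece (MvPolynomial.isHomogeneous_monomial _ ?_) _
    rw [← hf (MvPolynomial.mem_support_iff.1 hs), Finsupp.degree_eq_weight_one]
    rfl
  | zero => rw [map_zero]; exact zero_mem _
  | add y z _ _ hy hz => rw [map_add]; exact add_mem hy hz
  | neg y _ hy => rw [map_neg]; exact neg_mem hy

variable {g g' : Fin r → E}

/-- Moving `Y_j` past the twist produces a factor `g' j`, and `g' j (g j - 1) = -(g' j - 1)`. -/
theorem twistMap_thetaLin (hg : ∀ j, g' j * g j = 1) (n : Coord k r ⊗[k] M) :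
    twistMap σ g' (thetaLin (groupX g σ) n) = -thetaLin (groupX g' σ) (twistMap σ g' n) := by
  simp only [thetaLin, LinearMap.sum_apply, LinearMap.smul_apply, map_sum, twistMap_X_smul,
    baseChange_groupX_apply, map_sub, twistMap_baseChange]
  rw [← Finset.sum_neg_distrib]
  refine Finset.sum_congr rfl fun j _ => ?_
  have h : (σ (g' j)).baseChange (Coord k r) ((σ (g j)).baseChange (Coord k r) (twistMap σ g' n)) =
      twistMap σ g' n := by
    rw [← Module.End.mul_apply, ← LinearMap.baseChange_mul, ← map_mul, hg, map_one]
    exact LinearMap.congr_fun (LinearMap.baseChange_id (R := k) (A := Coord k r) (M := M)) _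
  rw [h, ← smul_neg, neg_sub]

theorem twistMap_thetaLin_pow (hg : ∀ j, g' j * g j = 1) (a : ℕ) (n : Coord k r ⊗[k] M) :
    twistMap σ g' ((thetaLin (groupX g σ) ^ a) n) =
      (-1 : Coord k r) ^ a • (thetaLin (groupX g' σ) ^ a) (twistMap σ g' n) := by
  induction a generalizing n with
  | zero => simp
  | succ a ih =>
    rw [pow_succ, Module.End.mul_apply, ih, twistMap_thetaLin σ hg, map_neg, pow_succ (-1),
      pow_succ (thetaLin (groupX g' σ)), Module.End.mul_apply, mul_smul, neg_one_smul]

theorem twistMap_mem_kerInfRange (hg : ∀ j, g' j * g j = 1) {a : ℕ} {n : Coord k r ⊗[k] M}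
    (hn : n ∈ kerInfRange (thetaLin (groupX g σ)) a) :
    twistMap σ g' n ∈ kerInfRange (thetaLin (groupX g' σ)) a := by
  obtain ⟨h0, z, rfl⟩ := hn
  refine ⟨?_, ?_⟩
  · have := twistMap_thetaLin σ hg ((thetaLin (groupX g σ) ^ a) z)
    rw [LinearMap.mem_ker.1 h0, map_zero] at this
    exact neg_eq_zero.1 this.symm
  · rw [twistMap_thetaLin_pow σ hg]
    exact Submodule.smul_mem _ _ ⟨_, rfl⟩

/-- The map induced by `twistMap` on subquotients, before passing to the quotient in the source. -/
def twistAux (hg : ∀ j, g' j * g j = 1) {a : ℕ} (ha : ((a + 1 : ℕ) : k) ≠ 0) :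
    kerInfRange (thetaLin (groupX g σ)) a →ₗ[Coord k r] Subquot (thetaLin (groupX g' σ)) a where
  toFun n := subquotMk _ a ⟨_, twistMap_mem_kerInfRange σ hg n.2⟩
  map_add' n n' := by
    rw [← map_add]
    exact congrArg _ (Subtype.ext (map_add (twistMap σ g') n.1 n'.1))
  map_smul' f n := by
    rw [RingHom.id_apply]
    -- Before passing to the quotient only `k`-linearity holds. Multiplication by `Y_j` has the
    -- defect of `twistMap_X_smul_sub`, which is a multiple of the operator `g' j - 1` and so
    -- vanishes in the subquotient.
    induction f using MvPolynomial.induction_on generalizing n with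
    | C c =>
      rw [← map_smul]
      refine congrArg _ (Subtype.ext ?_)
      change twistMap σ g' (algebraMap k (Coord k r) c • n.1) =
        algebraMap k (Coord k r) c • twistMap σ g' n.1
      rw [algebraMap_smul, algebraMap_smul, map_smul]
    | add f f' h h' =>
      rw [add_smul _ _ (subquotMk _ a _), ← h, ← h', ← map_add]
      refine congrArg _ (Subtype.ext ?_)
      change twistMap σ g' ((f + f') • n.1) = twistMap σ g' (f • n.1) + twistMap σ g' (f' • n.1)
      rw [add_smul, map_add]
    | mul_X f j h =>
      have h1 := h ((MvPolynomial.X j : Coord k r) • n)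
      have h2 : subquotMk (thetaLin (groupX g' σ)) a
          ⟨_, twistMap_mem_kerInfRange σ hg ((MvPolynomial.X j : Coord k r) • n).2⟩ =
          (MvPolynomial.X j : Coord k r) • subquotMk (thetaLin (groupX g' σ)) a
            ⟨_, twistMap_mem_kerInfRange σ hg n.2⟩ := by
        rw [← map_smul, ← sub_eq_zero, ← map_sub, subquotMk_eq_zero]
        change twistMap σ g' ((MvPolynomial.X j : Coord k r) • n.1) -
          (MvPolynomial.X j : Coord k r) • twistMap σ g' n.1 ∈ _
        refine (congrArg (· ∈ kerInfRange (thetaLin (groupX g' σ)) (a + 1))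
          (twistMap_X_smul_sub σ g' j n.1)).mpr ?_
        refine Submodule.smul_mem _ _ (baseChange_mem_kerInfRange_succ j (fun l => ?_) ha
          (twistMap_mem_kerInfRange σ hg n.2))
        have hc : Commute (σ (g' j)) (σ (g' l)) := (Commute.all (g' j) (g' l)).map σ
        exact (hc.sub_right (Commute.one_right _)).sub_left (Commute.one_left _)
      refine Eq.trans ?_ (h1.trans ((congrArg (f • ·) h2).trans (mul_smul f _ _).symm))
      refine congrArg _ (Subtype.ext (congrArg (twistMap σ g') ?_))
      exact mul_smul f (MvPolynomial.X j) n.1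

/-- The map induced by `twistMap` on subquotients. -/
def twistSubquot (hg : ∀ j, g' j * g j = 1) {a : ℕ} (ha : ((a + 1 : ℕ) : k) ≠ 0) :
    Subquot (thetaLin (groupX g σ)) a →ₗ[Coord k r] Subquot (thetaLin (groupX g' σ)) a :=
  Submodule.liftQ _ (twistAux σ hg ha) fun _ hn =>
    subquotMk_eq_zero.2 (twistMap_mem_kerInfRange σ hg (a := a + 1) hn)

theorem twistSubquot_twistSubquot (hg : ∀ j, g' j * g j = 1) (hg' : ∀ j, g j * g' j = 1) {a : ℕ}
    (ha : ((a + 1 : ℕ) : k) ≠ 0) (q : Subquot (thetaLin (groupX g σ)) a) :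
    twistSubquot σ hg' ha (twistSubquot σ hg ha q) = q := by
  obtain ⟨n, rfl⟩ := Submodule.mkQ_surjective _ q
  exact congrArg (subquotMk _ a) (Subtype.ext (twistMap_twistMap σ hg' n.1))

theorem twistSubquot_mem (hg : ∀ j, g' j * g j = 1) {a : ℕ} (ha : ((a + 1 : ℕ) : k) ≠ 0) (d : ℤ)
    (q : Subquot (thetaLin (groupX g σ)) a)
    (hq : q ∈ (subquotGrading (tensorGrading M) (thetaLin (groupX g σ)) a).piece d) :
    twistSubquot σ hg ha q ∈
      (subquotGrading (tensorGrading M) (thetaLin (groupX g' σ)) a).piece d := by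
  obtain ⟨n, hn, rfl⟩ := hq
  exact ⟨⟨_, twistMap_mem_kerInfRange σ hg n.2⟩, twistMap_mem σ hn, rfl⟩

theorem nonempty_subquotient_inv_iso (hg : ∀ j, g' j * g j = 1) {a : ℕ}
    (ha : ((a + 1 : ℕ) : k) ≠ 0) :
    Nonempty (subquotient (groupX g σ) a ≅ subquotient (groupX g' σ) a) := by
  have hg' : ∀ j, g j * g' j = 1 := fun j => by rw [mul_comm, hg]
  obtain ⟨e⟩ := nonempty_subquotient_iso (groupX g σ) a
  obtain ⟨e'⟩ := nonempty_subquotient_iso (groupX g' σ) a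
  let f : Subquot (thetaLin (groupX g σ)) a ≃ₗ[Coord k r] Subquot (thetaLin (groupX g' σ)) a :=
    { twistSubquot σ hg ha with
      invFun := twistSubquot σ hg' ha
      left_inv := twistSubquot_twistSubquot σ hg hg' ha
      right_inv := twistSubquot_twistSubquot σ hg' hg ha }
  obtain ⟨e₀⟩ := nonempty_tilde_iso f (twistSubquot_mem σ hg ha) (twistSubquot_mem σ hg' ha) 0
  exact ⟨e ≪≫ e₀ ≪≫ e'.symm⟩

/-- The contragredient action of `g j` is the transposed action of its inverse, so the twist applies
to `transposeDual ρ`; `1 ≤ i < p` makes `i` invertible in `k`. -/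
theorem nonempty_jordanSheaf_dual_iso (p : ℕ) [CharP k p] (g : Fin r → E)
    (ρ : Representation k E M) (i : ℕ) (hi : 1 ≤ i) (hip : i < p) :
    Nonempty (jordanSheaf g ρ.dual i ≅ jordanSheaf g (transposeDual ρ) i) := by
  obtain ⟨a, rfl⟩ := Nat.exists_eq_add_of_le' hi
  have ha : ((a + 1 : ℕ) : k) ≠ 0 := fun h =>
    absurd (Nat.le_of_dvd (Nat.succ_pos _) ((CharP.cast_eq_zero_iff k p _).1 h)) (by omega)
  exact nonempty_subquotient_inv_iso (g := fun j => (g j)⁻¹) (g' := g) (transposeDual ρ)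
    (fun j => mul_inv_cancel _) ha

end Twisting

end JordanBundle

end

theorem mainTheorem6 {k : Type u} [Field k] (p : ℕ) [Fact p.Prime] [CharP k p]
    {E : Type v} [CommGroup E] (r : ℕ) (g : Fin r → E)
    (hexp : ∀ x : E, x ^ p = 1) (hcard : Nat.card E = p ^ r)
    (hgen : Subgroup.closure (Set.range g) = ⊤)
    {M : Type u} [AddCommGroup M] [Module k M] [Module.Finite k M]
    (ρ : Representation k E M) (hM : JordanBundle.ConstantJordanType p g ρ)
    (i : ℕ) (hi : 1 ≤ i) (hip : i ≤ p) :
    Nonempty (JordanBundle.jordanSheaf g (JordanBundle.transposeDual ρ) i ≅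
      JordanBundle.serreTwist (JordanBundle.dualSheaf (JordanBundle.jordanSheaf g ρ i))
        (-(i : ℤ) + 1)) ∧
    (i < p → Nonempty (JordanBundle.jordanSheaf g ρ.dual i ≅
      JordanBundle.serreTwist (JordanBundle.dualSheaf (JordanBundle.jordanSheaf g ρ i))
        (-(i : ℤ) + 1))) := by
  refine ⟨JordanBundle.nonempty_jordanSheaf_transposeDual_iso g ρ hM i hi hip, fun hi' => ?_⟩
  obtain ⟨e⟩ := JordanBundle.nonempty_jordanSheaf_transposeDual_iso g ρ hM i hi hip
  obtain ⟨e'⟩ := JordanBundle.nonempty_jordanSheaf_dual_iso p g ρ i hi hi'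
  exact ⟨e' ≪≫ e⟩
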